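/- **Setting.** Let $\tau=\frac{1+\sqrt5}{2}$, $\rho=e^{2\pi i/3}$ and \[ Z=\begin{pmatrix}-1&0&0\\0&1&0\\0&0&-1\end{pmatrix},\quad P=\frac12\begin{pmatrix}1&\tau^{-1}&-\tau\\ \tau^{-1}&\tau&1\\ \tau&-1&\tau^{-1}\end{pmatrix},\quad Q=\begin{pmatrix}1&0&0\\0&0&\rho^2\\0&-\rho&0\end{pmatrix}. \] The Valentiner group $\mathcal V\subset \mathrm{PGL}_3(\mathbb C)$ is the group generated by the classes of $Z,P,Q$, acting on $\mathbb{CP}^2$ with coordinates $x=(x_1,x_2,x_3)$. An icosahedral conic is a conic $\{q=0\}\subset\mathbb{CP}^2$, where $q$ is a nonzero quadratic form that is preserved up to scalars by a subgroup of $\mathcal V$ isomorphic to $A_5$; for example $C_{\bar 1}=\{x_1^2+x_2^2+x_3^2=0\}$, preserved by $\langle Z,P\rangle$. A degree $d$ map of $\mathbb{CP}^2$ is a rational map $[h_1,h_2,h_3]$ given by three forms of degree $d$ without a common factor of positive degree. It is $\mathcal V$-equivariant if $h\circ T=T\circ h$ as rational maps for all $T\in\mathcal V$. Bub-coordinates are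 linear coordinates $y$, with $x=Ay$ and $A\in\mathrm{GL}_3(\mathbb C)$, in which (i) conjugation by $y\mapsto\bar y$ carries $\mathcal V$ to itself, (ii) $y\mapsto\bar y$ exchanges the two $\mathcal V$-orbits of icosahedral conics, that is, the complex conjugate of $C_{\bar1}$ is not in the $\mathcal V$-orbit of $C_{\bar 1}$, and (iii) the form \[F(y)=10y_1^3y_2^3+9y_1^5y_3+9y_2^5y_3-45y_1^2y_2^2y_3^2-135y_1y_2y_3^4+27y_3^6\] is $\mathcal V$-invariant up to scalars. With $\operatorname{Hess}$ the Hessian matrix and $\nabla$ the formal gradient (a column), put \[ \Phi=-\tfrac1{20250}\det \operatorname{Hess}(F),\qquad \Psi=\tfrac1{24300}\det\begin{pmatrix}\operatorname{Hess}(F)&\nabla\Phi\\(\nabla\Phi)^{t}&0\end{pmatrix},\qquad X=-\tfrac1{4860}\det\begin{pmatrix}(\nabla F)^t\\(\nabla\Phi)^t\\(\nabla\Psi)^t\end{pmatrix}, \] $\psi=\nabla F\times\nabla\Phi$, $\phi=\nabla F\times\nabla\Psi$, $f=\nabla\Phi\times\nabla\Psi$ and \[ \begin{aligned} f_{64}={}&\bigl[10F^6\Phi+100F^4\Phi^2+454F^2\Phi^3+156\Phi^4+39F^3\Psi+51F\Phi\Psi\bigr]\psi\\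 &-27\Psi\,\phi+54\Phi^2 f . \end{aligned} \] **Theorem.** $\mathcal V\cong A_6$, there are exactly 12 icosahedral conics, and bub-coordinates exist. The form $X$ is nonzero and divides $f_{64}$; let $f_{19}=f_{64}/X$, let $g_{19}(y;a,b)=f_{19}(y)+\bigl(aF(y)^3+bF(y)\Phi(y)\bigr)y$ and let \[h_{19}(y)=g_{19}(y;1620,0)=f_{19}(y)+1620\,F(y)^3\,y .\] 1. Up to a scalar factor there is exactly one $\mathcal V$-equivariant map $h$ of degree 19 that preserves all 12 icosahedral conics. Existence holds in the strong sense that $h$ is defined at each point of each icosahedral conic $C$ and $h(C)=C$. Uniqueness holds already among the $\mathcal V$-equivariant maps $h'$ of degree 19 that only satisfy $h'(p)\in C$ for each icosahedral conic $C$ and each point $p\in C$ where $h'$ is defined. 2. In every system of bub-coordinates, $h$ is the map $h_{19}$, up to a scalar factor. 3. Explicitly, $h_{19}=810\,[H_1,H_2,H_3]$, where \[\begin{aligned} H_1={}&-3591y_1^{15}y_2^{4} - 5263y_1^{10}y_2^{9} + 9747y_1^{5}y_2^{14} - 81y_2^{19}\\ & + 17955y_1^{12}y_2^{6}y_3 +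 10260y_1^{7}y_2^{11}y_3 - 7695y_1^{2}y_2^{16}y_3\\ & - 107730y_1^{14}y_2^{3}y_3^{2} - 74385y_1^{9}y_2^{8}y_3^{2} + 161595y_1^{4}y_2^{13}y_3^{2}\\ & - 969570y_1^{11}y_2^{5}y_3^{3} + 1292760y_1^{6}y_2^{10}y_3^{3} - 46170y_1y_2^{15}y_3^{3}\\ & - 2346975y_1^{8}y_2^{7}y_3^{4} - 807975y_1^{3}y_2^{12}y_3^{4}\\ & - 3587409y_1^{10}y_2^{4}y_3^{5} + 10277442y_1^{5}y_2^{9}y_3^{5} + 13851y_2^{14}y_3^{5}\\ & - 969570y_1^{12}y_2y_3^{6} - 3986010y_1^{7}y_2^{6}y_3^{6} - 1939140y_1^{2}y_2^{11}y_3^{6}\\ & - 5263380y_1^{9}y_2^{3}y_3^{7} - 28117530y_1^{4}y_2^{8}y_3^{7} + 831060y_1^{11}y_3^{8}\\ & + 2423925y_1^{6}y_2^{5}y_3^{8} + 4363065y_1y_2^{10}y_3^{8} - 24931800y_1^{8}y_2^{2}y_3^{9}\\ & + 43630650y_1^{3}y_2^{7}y_3^{9} - 31123197y_1^{5}y_2^{4}y_3^{10}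 + 9598743y_2^{9}y_3^{10}\\ & + 14959080y_1^{7}y_2y_3^{11} + 23269680y_1^{4}y_2^{3}y_3^{12} - 26178390y_1^{6}y_3^{13}\\ & + 52356780y_1y_2^{5}y_3^{13} + 18698850y_1^{3}y_2^{2}y_3^{14} + 20194758y_2^{4}y_3^{15}\\ & + 22438620y_1^{2}y_2y_3^{16} + 7479540y_1y_3^{18} \end{aligned}\] \[\begin{aligned} H_2={}&-81y_1^{19} + 9747y_1^{14}y_2^{5} - 5263y_1^{9}y_2^{10} - 3591y_1^{4}y_2^{15}\\ & - 7695y_1^{16}y_2^{2}y_3 + 10260y_1^{11}y_2^{7}y_3 + 17955y_1^{6}y_2^{12}y_3\\ & + 161595y_1^{13}y_2^{4}y_3^{2} - 74385y_1^{8}y_2^{9}y_3^{2} - 107730y_1^{3}y_2^{14}y_3^{2}\\ & - 46170y_1^{15}y_2y_3^{3} + 1292760y_1^{10}y_2^{6}y_3^{3} - 969570y_1^{5}y_2^{11}y_3^{3}\\ & - 807975y_1^{12}y_2^{3}y_3^{4} - 2346975y_1^{7}y_2^{8}y_3^{4} + 13851y_1^{14}y_3^{5}\\ & + 10277442y_1^{9}y_2^{5}y_3^{5}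 - 3587409y_1^{4}y_2^{10}y_3^{5}\\ & - 1939140y_1^{11}y_2^{2}y_3^{6} - 3986010y_1^{6}y_2^{7}y_3^{6} - 969570y_1y_2^{12}y_3^{6}\\ & - 28117530y_1^{8}y_2^{4}y_3^{7} - 5263380y_1^{3}y_2^{9}y_3^{7} + 4363065y_1^{10}y_2y_3^{8}\\ & + 2423925y_1^{5}y_2^{6}y_3^{8} + 831060y_2^{11}y_3^{8} + 43630650y_1^{7}y_2^{3}y_3^{9}\\ & - 24931800y_1^{2}y_2^{8}y_3^{9} + 9598743y_1^{9}y_3^{10} - 31123197y_1^{4}y_2^{5}y_3^{10}\\ & + 14959080y_1y_2^{7}y_3^{11} + 23269680y_1^{3}y_2^{4}y_3^{12} + 52356780y_1^{5}y_2y_3^{13}\\ & - 26178390y_2^{6}y_3^{13} + 18698850y_1^{2}y_2^{3}y_3^{14} + 20194758y_1^{4}y_3^{15}\\ & + 22438620y_1y_2^{2}y_3^{16} + 7479540y_2y_3^{18} \end{aligned}\] \[\begin{aligned} H_3={}&-1026y_1^{17}y_2^{2} - 3078y_1^{12}y_2^{7} - 3078y_1^{7}y_2^{12} - 1026y_1^{2}y_2^{17}\\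 & - 5130y_1^{14}y_2^{4}y_3 + 113240y_1^{9}y_2^{9}y_3 - 5130y_1^{4}y_2^{14}y_3\\ & + 3078y_1^{16}y_2y_3^{2} - 272916y_1^{11}y_2^{6}y_3^{2} - 272916y_1^{6}y_2^{11}y_3^{2}\\ & + 3078y_1y_2^{16}y_3^{2} + 215460y_1^{13}y_2^{3}y_3^{3} + 687420y_1^{8}y_2^{8}y_3^{3}\\ & + 215460y_1^{3}y_2^{13}y_3^{3} + 4617y_1^{15}y_3^{4} + 937251y_1^{10}y_2^{5}y_3^{4}\\ & + 937251y_1^{5}y_2^{10}y_3^{4} + 4617y_2^{15}y_3^{4} + 290871y_1^{12}y_2^{2}y_3^{5}\\ & + 4813992y_1^{7}y_2^{7}y_3^{5} + 290871y_1^{2}y_2^{12}y_3^{5} - 1454355y_1^{9}y_2^{4}y_3^{6}\\ & - 1454355y_1^{4}y_2^{9}y_3^{6} + 2520882y_1^{11}y_2y_3^{7} + 8812314y_1^{6}y_2^{6}y_3^{7}\\ & + 2520882y_1y_2^{11}y_3^{7} + 19876185y_1^{8}y_2^{3}y_3^{8} + 19876185y_1^{3}y_2^{8}y_3^{8}\\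 & - 2036097y_1^{10}y_3^{9} + 5623506y_1^{5}y_2^{5}y_3^{9} - 2036097y_2^{10}y_3^{9}\\ & + 5235678y_1^{7}y_2^{2}y_3^{10} + 5235678y_1^{2}y_2^{7}y_3^{10}\\ & + 37813230y_1^{4}y_2^{4}y_3^{11} - 2617839y_1^{6}y_2y_3^{12} - 2617839y_1y_2^{6}y_3^{12}\\ & - 2908710y_1^{3}y_2^{3}y_3^{13} + 6357609y_1^{5}y_3^{14} + 6357609y_2^{5}y_3^{14}\\ & - 5983632y_1^{2}y_2^{2}y_3^{15} - 4487724y_1y_2y_3^{17} - 1023516y_3^{19} \end{aligned}\] -/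

import Mathlib

open scoped MatrixGroups LinearAlgebra.Projectivization

noncomputable section

namespace Valentiner

/-! ### Polynomials and polynomial triples on the space of three complex variables -/

/-- Polynomials in three complex variables. -/
abbrev Poly : Type := MvPolynomial (Fin 3) ℂ

/-- The polynomial `x ↦ q (g x)`. -/
def precompPoly (g : GL (Fin 3) ℂ) (q : Poly) : Poly :=
  MvPolynomial.aeval (fun i => ∑ j, MvPolynomial.C (g i j) * (MvPolynomial.X j : Poly)) q

/-- The polynomial triple `x ↦ h (g x)`. -/
def precomp (h : Fin 3 → Poly) (g : GL (Fin 3) ℂ) : Fin 3 → Poly :=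
  fun i => precompPoly g (h i)

/-- The polynomial triple `x ↦ g (h x)`. -/
def postcomp (g : GL (Fin 3) ℂ) (h : Fin 3 → Poly) : Fin 3 → Poly :=
  fun i => ∑ j, MvPolynomial.C (g i j) * h j

/-- The value of a polynomial triple at a vector. -/
def evalMap (h : Fin 3 → Poly) (v : Fin 3 → ℂ) : Fin 3 → ℂ :=
  fun i => MvPolynomial.eval v (h i)

/-- The triple `h` of homogeneous polynomials of degree `d` without a common factor of positive
degree: this is a rational map of degree `d` of the complex projective plane. Two such triples
give the same rational map if and only if they are proportional. -/
def IsRationalMap (d : ℕ) (h : Fin 3 → Poly) : Prop :=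
  (∀ i, (h i).IsHomogeneous d) ∧ ∀ p : Poly, (∀ i, p ∣ h i) → IsUnit p

/-- `h ∘ T = T ∘ h`, as rational maps of the projective plane, for each `T` in the group `G` of
projective transformations. -/
def IsEquivariant (G : Subgroup PGL(3, ℂ)) (h : Fin 3 → Poly) : Prop :=
  ∀ g : GL (Fin 3) ℂ, Matrix.ProjGenLinGroup.mk g ∈ G →
    ∃ c : ℂ, c ≠ 0 ∧ precomp h g = c • postcomp g h

/-- The rational map given by `h` is defined at the point `p`. -/
def IsDefinedAt (h : Fin 3 → Poly) (p : ℙ ℂ (Fin 3 → ℂ)) : Prop :=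
  evalMap h p.rep ≠ 0

/-- The image of a set under the rational map given by `h`: the set of all values at those points
of the set where the map is defined. -/
def ratImage (h : Fin 3 → Poly) (S : Set (ℙ ℂ (Fin 3 → ℂ))) : Set (ℙ ℂ (Fin 3 → ℂ)) :=
  {p | ∃ (v : Fin 3 → ℂ) (hv : v ≠ 0) (hw : evalMap h v ≠ 0),
    Projectivization.mk ℂ v hv ∈ S ∧ p = Projectivization.mk ℂ (evalMap h v) hw}

/-- The zero locus of a (homogeneous) polynomial in the projective plane. -/
def zeroLocus (q : Poly) : Set (ℙ ℂ (Fin 3 → ℂ)) :=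
  {p | MvPolynomial.eval p.rep q = 0}

/-! ### The Valentiner group, in orthogonal coordinates -/

/-- The golden ratio. -/
def τ : ℂ := (Real.goldenRatio : ℂ)

/-- The primitive cube root of unity `exp (2 π i / 3)`. -/
def ρ : ℂ := Complex.exp (2 * Real.pi * Complex.I / 3)

def matZ : Matrix (Fin 3) (Fin 3) ℂ :=
  !![-1, 0, 0; 0, 1, 0; 0, 0, -1]

def matP : Matrix (Fin 3) (Fin 3) ℂ :=
  (1 / 2 : ℂ) • !![1, τ⁻¹, -τ; τ⁻¹, τ, 1; τ, -1, τ⁻¹]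

def matQ : Matrix (Fin 3) (Fin 3) ℂ :=
  !![1, 0, 0; 0, 0, ρ ^ 2; 0, -ρ, 0]

theorem tau_sq : τ ^ 2 = τ + 1 := by
  have h := Real.goldenRatio_sq
  unfold τ
  exact_mod_cast h

theorem tau_inv : τ⁻¹ = τ - 1 := by
  have h := tau_sq
  have h0 : τ ≠ 0 := by
    intro h0
    rw [h0] at h
    norm_num at h
  field_simp
  linear_combination -h

theorem rho_cube : ρ ^ 3 = 1 := by
  unfold ρ
  rw [← Complex.exp_nat_mul, Complex.exp_eq_one_iff]
  exact ⟨1, by push_cast; ring⟩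

theorem det_matZ : matZ.det = 1 := by
  simp [matZ, Matrix.det_fin_three]

theorem det_matP : matP.det = 1 := by
  have h := tau_sq
  simp only [matP, tau_inv, Matrix.det_fin_three, Matrix.smul_apply, Matrix.of_apply,
    Matrix.cons_val', Matrix.cons_val_zero, Matrix.cons_val_one, Matrix.cons_val, smul_eq_mul]
  linear_combination (3 / 4) * h

theorem det_matQ : matQ.det = 1 := by
  have h := rho_cube
  simp [matQ, Matrix.det_fin_three]
  linear_combination h

/-- The subgroup of `PGL₃(ℂ)` that is generated by the classes of the three matrices. -/
def V : Subgroup PGL(3, ℂ) :=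
  Subgroup.closure
    {Matrix.ProjGenLinGroup.mk
        (Matrix.GeneralLinearGroup.mkOfDetNeZero matZ (by rw [det_matZ]; exact one_ne_zero)),
      Matrix.ProjGenLinGroup.mk
        (Matrix.GeneralLinearGroup.mkOfDetNeZero matP (by rw [det_matP]; exact one_ne_zero)),
      Matrix.ProjGenLinGroup.mk
        (Matrix.GeneralLinearGroup.mkOfDetNeZero matQ (by rw [det_matQ]; exact one_ne_zero))}

/-- The icosahedral conics of `G`: the conics `{q = 0}` where `q` is a nonzero quadratic form that
some subgroup of `G` isomorphic to `A₅` preserves up to scalars. -/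
def icosahedralConics (G : Subgroup PGL(3, ℂ)) : Set (Set (ℙ ℂ (Fin 3 → ℂ))) :=
  {S | ∃ (H : Subgroup PGL(3, ℂ)) (q : Poly), H ≤ G ∧ Nonempty (H ≃* alternatingGroup (Fin 5)) ∧
    q ≠ 0 ∧ q.IsHomogeneous 2 ∧
    (∀ g : GL (Fin 3) ℂ, Matrix.ProjGenLinGroup.mk g ∈ H →
      ∃ c : ℂ, precompPoly g q = MvPolynomial.C c * q) ∧
    S = zeroLocus q}

/-! ### Invariant forms and the family of degree 19 maps, in bub-coordinates -/

abbrev y₁ : Poly := MvPolynomial.X 0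
abbrev y₂ : Poly := MvPolynomial.X 1
abbrev y₃ : Poly := MvPolynomial.X 2

/-- The formal gradient. -/
def grad (p : Poly) : Fin 3 → Poly := fun i => MvPolynomial.pderiv i p

/-- The Hessian matrix. -/
def hess (p : Poly) : Matrix (Fin 3) (Fin 3) Poly :=
  Matrix.of fun i j => MvPolynomial.pderiv i (MvPolynomial.pderiv j p)

/-- The form of degree 6. -/
def F : Poly :=
  10 * y₁ ^ 3 * y₂ ^ 3 + 9 * y₁ ^ 5 * y₃ + 9 * y₂ ^ 5 * y₃ - 45 * y₁ ^ 2 * y₂ ^ 2 * y₃ ^ 2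
    - 135 * y₁ * y₂ * y₃ ^ 4 + 27 * y₃ ^ 6

/-- The form of degree 12: `6 y₁¹¹ y₂ + … + 729 y₃¹²`. -/
def Φ : Poly := MvPolynomial.C (-1 / 20250) * (hess F).det

/-- The form of degree 30, by a bordered Hessian: `3 y₁³⁰ + … + 57395628 y₃³⁰`. -/
def Ψ : Poly := MvPolynomial.C (1 / 24300) *
  (Matrix.fromBlocks (hess F) (Matrix.replicateCol Unit (grad Φ))
    (Matrix.replicateRow Unit (grad Φ)) 0).det

/-- The form of degree 45, by a Jacobian: `y₁⁴⁵ + … - y₂⁴⁵ + … + 3570467226624 y₂⁵ y₃⁴⁰`. -/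
def X45 : Poly := MvPolynomial.C (-1 / 4860) * (Matrix.of ![grad F, grad Φ, grad Ψ]).det

def ψ16 : Fin 3 → Poly := crossProduct (grad F) (grad Φ)

def φ34 : Fin 3 → Poly := crossProduct (grad F) (grad Ψ)

def f40 : Fin 3 → Poly := crossProduct (grad Φ) (grad Ψ)

/-- The map of degree 64 that is divisible by the form of degree 45. -/
def f64 : Fin 3 → Poly := fun i =>
  (10 * F ^ 6 * Φ + 100 * F ^ 4 * Φ ^ 2 + 454 * F ^ 2 * Φ ^ 3 + 156 * Φ ^ 4
      + 39 * F ^ 3 * Ψ + 51 * F * Φ * Ψ) * ψ16 i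
    - 27 * Ψ * φ34 i + 54 * Φ ^ 2 * f40 i

/-- The two-parameter family `g₁₉(y; a, b) = f₁₉(y) + (a F(y)³ + b F(y) Φ(y)) y`. -/
def g19 (f19 : Fin 3 → Poly) (a b : ℂ) : Fin 3 → Poly := fun i =>
  f19 i + (MvPolynomial.C a * F ^ 3 + MvPolynomial.C b * F * Φ) * MvPolynomial.X i

/-- The polynomial with the terms `c y₁^i y₂^j y₃^k`, for the `(c, i, j, k)` in the list. -/
def ofTerms (l : List (ℤ × ℕ × ℕ × ℕ)) : Poly :=
  (l.map fun t => MvPolynomial.C (t.1 : ℂ) * y₁ ^ t.2.1 * y₂ ^ t.2.2.1 * y₃ ^ t.2.2.2).sum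

/-- The explicit form of the conic-preserving map of degree 19. -/
def hExplicit : Fin 3 → Poly :=
  ![
    ofTerms [(-3591, 15, 4, 0), (-5263, 10, 9, 0), (9747, 5, 14, 0), (-81, 0, 19, 0),
      (17955, 12, 6, 1), (10260, 7, 11, 1), (-7695, 2, 16, 1), (-107730, 14, 3, 2),
      (-74385, 9, 8, 2), (161595, 4, 13, 2), (-969570, 11, 5, 3), (1292760, 6, 10, 3),
      (-46170, 1, 15, 3), (-2346975, 8, 7, 4), (-807975, 3, 12, 4), (-3587409, 10, 4, 5),
      (10277442, 5, 9, 5), (13851, 0, 14, 5), (-969570, 12, 1, 6), (-3986010, 7, 6, 6),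
      (-1939140, 2, 11, 6), (-5263380, 9, 3, 7), (-28117530, 4, 8, 7), (831060, 11, 0, 8),
      (2423925, 6, 5, 8), (4363065, 1, 10, 8), (-24931800, 8, 2, 9), (43630650, 3, 7, 9),
      (-31123197, 5, 4, 10), (9598743, 0, 9, 10), (14959080, 7, 1, 11), (23269680, 4, 3, 12),
      (-26178390, 6, 0, 13), (52356780, 1, 5, 13), (18698850, 3, 2, 14), (20194758, 0, 4, 15),
      (22438620, 2, 1, 16), (7479540, 1, 0, 18)],
    ofTerms [(-81, 19, 0, 0), (9747, 14, 5, 0), (-5263, 9, 10, 0), (-3591, 4, 15, 0),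
      (-7695, 16, 2, 1), (10260, 11, 7, 1), (17955, 6, 12, 1), (161595, 13, 4, 2),
      (-74385, 8, 9, 2), (-107730, 3, 14, 2), (-46170, 15, 1, 3), (1292760, 10, 6, 3),
      (-969570, 5, 11, 3), (-807975, 12, 3, 4), (-2346975, 7, 8, 4), (13851, 14, 0, 5),
      (10277442, 9, 5, 5), (-3587409, 4, 10, 5), (-1939140, 11, 2, 6), (-3986010, 6, 7, 6),
      (-969570, 1, 12, 6), (-28117530, 8, 4, 7), (-5263380, 3, 9, 7), (4363065, 10, 1, 8),
      (2423925, 5, 6, 8), (831060, 0, 11, 8), (43630650, 7, 3, 9), (-24931800, 2, 8, 9),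
      (9598743, 9, 0, 10), (-31123197, 4, 5, 10), (14959080, 1, 7, 11), (23269680, 3, 4, 12),
      (52356780, 5, 1, 13), (-26178390, 0, 6, 13), (18698850, 2, 3, 14), (20194758, 4, 0, 15),
      (22438620, 1, 2, 16), (7479540, 0, 1, 18)],
    ofTerms [(-1026, 17, 2, 0), (-3078, 12, 7, 0), (-3078, 7, 12, 0), (-1026, 2, 17, 0),
      (-5130, 14, 4, 1), (113240, 9, 9, 1), (-5130, 4, 14, 1), (3078, 16, 1, 2),
      (-272916, 11, 6, 2), (-272916, 6, 11, 2), (3078, 1, 16, 2), (215460, 13, 3, 3),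
      (687420, 8, 8, 3), (215460, 3, 13, 3), (4617, 15, 0, 4), (937251, 10, 5, 4),
      (937251, 5, 10, 4), (4617, 0, 15, 4), (290871, 12, 2, 5), (4813992, 7, 7, 5),
      (290871, 2, 12, 5), (-1454355, 9, 4, 6), (-1454355, 4, 9, 6), (2520882, 11, 1, 7),
      (8812314, 6, 6, 7), (2520882, 1, 11, 7), (19876185, 8, 3, 8), (19876185, 3, 8, 8),
      (-2036097, 10, 0, 9), (5623506, 5, 5, 9), (-2036097, 0, 10, 9), (5235678, 7, 2, 10),
      (5235678, 2, 7, 10), (37813230, 4, 4, 11), (-2617839, 6, 1, 12), (-2617839, 1, 6, 12),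
      (-2908710, 3, 3, 13), (6357609, 5, 0, 14), (6357609, 0, 5, 14), (-5983632, 2, 2, 15),
      (-4487724, 1, 1, 17), (-1023516, 0, 0, 19)]
  ]

/-! ### Bub-coordinates -/

/-- The quadratic form `x₁² + x₂² + x₃²`, which the icosahedral group generated by `matZ` and
`matP` preserves. -/
def C1 : Poly := MvPolynomial.X 0 ^ 2 + MvPolynomial.X 1 ^ 2 + MvPolynomial.X 2 ^ 2

/-- The class of `g`, read in the coordinates `y` with `x = A y`, belongs to the group `V`. -/
def MemVIn (A g : GL (Fin 3) ℂ) : Prop := Matrix.ProjGenLinGroup.mk (A * g * A⁻¹) ∈ V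

/-- `A` is a change of coordinates `x = A y` to bub-coordinates `y`. -/
structure IsBub (A : GL (Fin 3) ℂ) : Prop where
  /-- Conjugation by `y ↦ conj y` carries `V` to itself. -/
  conj_mem : ∀ g : GL (Fin 3) ℂ, MemVIn A g →
    MemVIn A (Matrix.GeneralLinearGroup.map (starRingEnd ℂ) g)
  /-- The map `y ↦ conj y` exchanges the two systems of icosahedral conics: the conjugate of
  the first conic is not in the `V`-orbit of the first conic. -/
  exchanges : ∀ g : GL (Fin 3) ℂ, MemVIn A g → ∀ c : ℂ,
    precompPoly g (precompPoly A C1) ≠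
      MvPolynomial.C c * MvPolynomial.map (starRingEnd ℂ) (precompPoly A C1)
  /-- The form `F` is the `V`-invariant of degree 6 in the coordinates `y`. -/
  sextic : ∀ g : GL (Fin 3) ℂ, MemVIn A g → ∃ c : ℂ, precompPoly g F = MvPolynomial.C c * F

/-- The map `h`, given in the coordinates `x`, read in the coordinates `y` with `x = A y`. -/
def inCoords (A : GL (Fin 3) ℂ) (h : Fin 3 → Poly) : Fin 3 → Poly :=
  postcomp A⁻¹ (precomp h A)

end Valentiner

end

/-!
The forms `F`, `Φ`, `Ψ`, `X45` are classical covariants of `F`, and so is the map `f64`; the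
quotient `f64 / X45` and the expansion of the map of degree 19 are identities between explicit
polynomials with integer coefficients. They are verified in the kernel, with sparse polynomials
(`SP`). The large one, `X45_mul_lf19`, is checked by a single evaluation at a point with widely
separated coordinates (Kronecker substitution, `SP.poly_eq_zero_of_ev_eq_zero`).

*The group.* The generators permute two families of six quadratic forms `fam k i` up to scalars;
this is a computation in `ℤ[τ, ρ]`. Each of the two actions is faithful, because a matrix that
scales all forms of a family is scalar, and its image is generated by three explicit permutations,
which generate `A₆`. This gives the isomorphisms `altEquiv k` of the group with `A₆`. An element
of order 3 is a three-cycle in one of the two actions, so a subgroup isomorphic to `A₅` is the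
stabilizer of one of the twelve forms (`exists_eq_icosa`). Such a stabilizer preserves, up to
scalars, only the form that it fixes (`onlyInvariant`). Hence there are exactly twelve icosahedral
conics (`icosahedralConics_V`).

*Bub-coordinates.* The matrix `matA` is an explicit change to bub-coordinates. Complex conjugation
in these coordinates is `x ↦ B (conj x)` for a matrix `B` over `ℚ(τ, ρ)`, which exchanges the two
families.

*Covariance.* A linear map that preserves `F` has determinant `±1`, by a covariant of `F` and `Φ`
with two terms of different weights. It therefore preserves `Φ` and `Ψ`, and it commutes with the
map `hExplicit` (`lin_hExplicit`). In particular this map, read in the coordinates `x` as `hX`, is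
equivariant.

*The conics.* The conic `x₁² + x₂² + x₃² = 0` has a parametrization `conicN` of degree 2 in
bub-coordinates, along which `hExplicit` is given by two binary forms of degree 19 without a
common zero (`evalMap_hExplicit_conicN`). So the map is defined on the conic and carries it onto
itself. By equivariance and by complex conjugation, the same holds for the other eleven. The
absence of zeros on the cone over the conic also excludes a common factor of the components
(`isUnit_of_dvd_hExplicit`).

*Uniqueness.* The multipliers of an equivariant map are trivial, so that it is a covariant: it
commutes with the generating matrices. A covariant of degree 19 is determined by its first
component, whose coefficients solve a linear system. Its rank modulo a prime above 31 shows that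
the space of covariants has dimension at most 3 (`exists_linear_relation`); hence it is spanned by
`hX`, `F³ x` and `F Φ x`. If a combination `a hX + (b F³ + c F Φ) x` preserves the conics, then
`b F² + c Φ` vanishes at a chosen point of a conic of each family, and this forces `b = c = 0`
(`eq_smul_hX`).

*All bub-coordinates.* The same kind of linear system shows that the invariants of degree 6 form a
line. So two systems of bub-coordinates differ by a linear map that preserves `F` up to a scalar
(`IsBub.precompPoly_F`), and by covariance the map has the same expression in both, up to a scalar
factor (`IsBub.inCoords_hX`).
-/

namespace Valentiner

open scoped Matrix ComplexConjugate
open Matrix.ProjGenLinGroup (mk)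

/-! ### Computable sparse polynomials -/

/-- Exponents of a monomial in three variables. -/
abbrev Mon : Type := ℕ × ℕ × ℕ

/-- Sparse polynomials in three variables, as lists of terms. They serve for computations inside
the kernel. The arithmetic keeps the terms in lexicographic order of the exponents, but no lemma
depends on that order. -/
abbrev SP (K : Type) : Type := List (Mon × K)

/-- Lexicographic comparison of exponents. -/
def Mon.lt (m n : Mon) : Bool :=
  match Nat.blt m.1 n.1 with
  | true => true
  | false => match Nat.beq m.1 n.1 with
    | false => false
    | true => Nat.blt m.2.1 n.2.1

/-- Equality of exponents. -/
def Mon.eqb (m n : Mon) : Bool :=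
  Nat.beq m.1 n.1 && (Nat.beq m.2.1 n.2.1 && Nat.beq m.2.2 n.2.2)

theorem Mon.eq_of_eqb {m n : Mon} (h : Mon.eqb m n = true) : m = n := by
  obtain ⟨a, b, c⟩ := m
  obtain ⟨a', b', c'⟩ := n
  simp only [Mon.eqb, Bool.and_eq_true] at h
  rw [Nat.eq_of_beq_eq_true h.1, Nat.eq_of_beq_eq_true h.2.1, Nat.eq_of_beq_eq_true h.2.2]

namespace SP

section Operations

variable {K : Type} [Add K] [Mul K]

/-- Merges one term, followed by the terms that `rec` merges, into a sparse polynomial. -/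
def addTerm (m : Mon) (a : K) (rec : SP K → SP K) : SP K → SP K
  | [] => (m, a) :: rec []
  | (n, b) :: q =>
    match Mon.eqb m n with
    | true => (m, a + b) :: rec q
    | false => match Mon.lt m n with
      | true => (m, a) :: rec ((n, b) :: q)
      | false => (n, b) :: addTerm m a rec q

/-- The sum, by merging. The recursion is structural, so that the kernel evaluates it. -/
def add : SP K → SP K → SP K
  | [] => id
  | (m, a) :: p => addTerm m a (add p)

/-- The product with a single term. -/
def mulTerm (m : Mon) (a : K) (q : SP K) : SP K :=
  q.map fun t => ((m.1 + t.1.1, m.2.1 + t.1.2.1, m.2.2 + t.1.2.2), a * t.2)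

/-- The product. -/
def mul (p q : SP K) : SP K := p.foldr (fun t acc => add (mulTerm t.1 t.2 q) acc) []

/-- The product with a scalar. -/
def scale (a : K) (q : SP K) : SP K := q.map fun t => (t.1, a * t.2)

/-- Sorts and collects the terms of a list. -/
def collect (p : SP K) : SP K := p.foldr (fun t acc => add [t] acc) []

end Operations

/-- The `n`-th power. -/
def pow {K : Type} [CommRing K] (p : SP K) : ℕ → SP K
  | 0 => [((0, 0, 0), 1)]
  | n + 1 => mul p (pow p n)

section Semantics

variable {K S : Type} [CommRing K] [CommRing S] (φ : K →+* S) (v : Fin 3 → S)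

/-- The value of a monomial. -/
def mon (m : Mon) : S := v 0 ^ m.1 * v 1 ^ m.2.1 * v 2 ^ m.2.2

/-- The value of a sparse polynomial. -/
def ev (p : SP K) : S := (p.map fun t => φ t.2 * mon v t.1).sum

@[simp] theorem ev_nil : ev φ v [] = 0 := rfl

@[simp] theorem ev_cons (t : Mon × K) (p : SP K) :
    ev φ v (t :: p) = φ t.2 * mon v t.1 + ev φ v p := by
  simp [ev]

theorem ev_addTerm (m : Mon) (a : K) (rec : SP K → SP K) (p : SP K)
    (hrec : ∀ q, ev φ v (rec q) = ev φ v p + ev φ v q) (q : SP K) :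
    ev φ v (addTerm m a rec q) = φ a * mon v m + ev φ v p + ev φ v q := by
  induction q with
  | nil => simp [addTerm, hrec]
  | cons t q ih =>
    obtain ⟨n, b⟩ := t
    rw [addTerm]
    split
    · next h =>
      rw [Mon.eq_of_eqb h]
      simp only [ev_cons, hrec, map_add]
      ring
    · split
      · simp only [ev_cons, hrec]
        ring
      · simp only [ev_cons, ih]
        ring

theorem ev_add (p q : SP K) : ev φ v (add p q) = ev φ v p + ev φ v q := by
  induction p generalizing q with
  | nil => simp [add]
  | cons t p ih =>
    obtain ⟨m, a⟩ := t
    rw [add, ev_addTerm φ v m a (add p) p ih]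
    simp

theorem ev_mulTerm (m : Mon) (a : K) (q : SP K) :
    ev φ v (mulTerm m a q) = φ a * mon v m * ev φ v q := by
  induction q with
  | nil => simp [mulTerm]
  | cons t q ih =>
    simp only [mulTerm, List.map_cons, ev_cons] at ih ⊢
    rw [ih, map_mul]
    simp only [mon]
    ring

theorem ev_mul (p q : SP K) : ev φ v (mul p q) = ev φ v p * ev φ v q := by
  induction p with
  | nil => simp [mul]
  | cons t p ih =>
    simp only [mul, List.foldr_cons, ev_cons] at ih ⊢
    rw [ev_add, ih, ev_mulTerm]
    ring

theorem ev_scale (a : K) (q : SP K) : ev φ v (scale a q) = φ a * ev φ v q := by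
  induction q with
  | nil => simp [scale]
  | cons t q ih =>
    simp only [scale, List.map_cons, ev_cons] at ih ⊢
    rw [ih, map_mul]
    ring

theorem ev_collect (p : SP K) : ev φ v (collect p) = ev φ v p := by
  induction p with
  | nil => rfl
  | cons t p ih =>
    simp only [collect, List.foldr_cons, ev_cons] at ih ⊢
    rw [ev_add, ih]
    simp

theorem ev_pow (p : SP K) (n : ℕ) : ev φ v (pow p n) = ev φ v p ^ n := by
  induction n with
  | zero => simp [pow, mon]
  | succ n ih => rw [pow, ev_mul, ih, pow_succ']

/-- Substitution of sparse polynomials for the three variables. -/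
def subst (l : SP K) (a b c : SP K) : SP K :=
  l.foldr (fun t acc =>
    add (scale t.2 (mul (pow a t.1.1) (mul (pow b t.1.2.1) (pow c t.1.2.2)))) acc) []

theorem ev_subst (l a b c : SP K) :
    ev φ v (subst l a b c) = ev φ ![ev φ v a, ev φ v b, ev φ v c] l := by
  induction l with
  | nil => rfl
  | cons t l ih =>
    simp only [subst, List.foldr_cons, ev_cons] at ih ⊢
    rw [ev_add, ih, ev_scale, ev_mul, ev_mul, ev_pow, ev_pow, ev_pow]
    simp only [mon, Matrix.cons_val_zero, Matrix.cons_val_one, Matrix.cons_val]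
    ring

theorem map_ev {T : Type} [CommRing T] (f : S →+* T) (p : SP K) :
    f (ev φ v p) = ev (f.comp φ) (fun i => f (v i)) p := by
  induction p with
  | nil => simp
  | cons t p ih => simp [ih, mon]

end Semantics

/-- Whether the difference of two sparse polynomials has only zero coefficients. -/
def same {K : Type} [CommRing K] [DecidableEq K] (p q : SP K) : Bool :=
  (add p (scale (-1) q)).all fun t => decide (t.2 = 0)

theorem ev_eq_of_same {K S : Type} [CommRing K] [DecidableEq K] [CommRing S] (φ : K →+* S)
    (v : Fin 3 → S) {p q : SP K} (h : same p q = true) : ev φ v p = ev φ v q := by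
  have key : ∀ r : SP K, (r.all fun t => decide (t.2 = 0)) = true → ev φ v r = 0 := by
    intro r
    induction r with
    | nil => simp
    | cons t r ih =>
      intro h
      simp only [List.all_cons, Bool.and_eq_true, decide_eq_true_eq] at h
      rw [ev_cons, ih h.2, h.1]
      simp
  have := key _ h
  rw [ev_add, ev_scale, map_neg, map_one] at this
  linear_combination this

/-- The polynomial that a sparse polynomial stands for. -/
noncomputable def toPoly {K : Type} [CommRing K] (φ : K →+* ℂ) (p : SP K) : Poly :=
  ev (MvPolynomial.C.comp φ) MvPolynomial.X p

theorem eval_toPoly {K : Type} [CommRing K] (φ : K →+* ℂ) (p : SP K) (v : Fin 3 → ℂ) :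
    MvPolynomial.eval v (toPoly φ p) = ev φ v p := by
  rw [toPoly, map_ev]
  congr 1
  · ext x; simp
  · ext i; simp

theorem ev_filter {K S : Type} [CommRing K] [DecidableEq K] [CommRing S] (φ : K →+* S)
    (v : Fin 3 → S) (p : SP K) : ev φ v (p.filter fun t => decide (t.2 ≠ 0)) = ev φ v p := by
  induction p with
  | nil => rfl
  | cons t p ih =>
    rw [List.filter_cons]
    by_cases h : t.2 = 0 <;> simp [h] at ih ⊢ <;> exact ih

/-- The derivatives of the terms with respect to a variable. -/
def derivTerms (i : Fin 3) (p : SP ℤ) : SP ℤ :=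
  match i with
  | 0 => p.map fun t => ((t.1.1 - 1, t.1.2.1, t.1.2.2), (t.1.1 : ℤ) * t.2)
  | 1 => p.map fun t => ((t.1.1, t.1.2.1 - 1, t.1.2.2), (t.1.2.1 : ℤ) * t.2)
  | 2 => p.map fun t => ((t.1.1, t.1.2.1, t.1.2.2 - 1), (t.1.2.2 : ℤ) * t.2)

/-- The partial derivative with respect to a variable. Zero terms are removed, as their exponents
may be out of order. -/
def deriv (i : Fin 3) (p : SP ℤ) : SP ℤ := (derivTerms i p).filter fun t => decide (t.2 ≠ 0)

/-- The polynomial that a sparse polynomial with integer coefficients stands for. -/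
noncomputable abbrev poly (p : SP ℤ) : Poly := toPoly (Int.castRingHom ℂ) p

theorem pderiv_poly (i : Fin 3) (p : SP ℤ) :
    MvPolynomial.pderiv i (poly p) = poly (deriv i p) := by
  rw [deriv, poly, poly, toPoly, toPoly, ev_filter]
  induction p with
  | nil => fin_cases i <;> simp [derivTerms]
  | cons t p ih =>
    obtain ⟨⟨a, b, c⟩, k⟩ := t
    fin_cases i <;>
    · simp only [derivTerms, List.map_cons, ev_cons, map_add] at ih ⊢
      simp only [Fin.zero_eta, Fin.mk_one, Fin.reduceFinMk] at ih ⊢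
      rw [ih]
      simp [mon, MvPolynomial.pderiv_X, Derivation.leibniz, Derivation.leibniz_pow]
      ring

theorem poly_add (p q : SP ℤ) : poly (add p q) = poly p + poly q := ev_add _ _ p q

theorem poly_mul (p q : SP ℤ) : poly (mul p q) = poly p * poly q := ev_mul _ _ p q

theorem poly_scale (a : ℤ) (q : SP ℤ) : poly (scale a q) = MvPolynomial.C (a : ℂ) * poly q :=
  ev_scale _ _ a q

theorem poly_eq_of_same {p q : SP ℤ} (h : same p q = true) : poly p = poly q :=
  ev_eq_of_same _ _ h

/-! ### Identities of integer forms from a single evaluation -/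

/-- The sum of the absolute values of the coefficients. -/
def l1 (p : SP ℤ) : ℕ := (p.map fun t => t.2.natAbs).sum

/-- All terms have degree `d`. -/
def IsHom (d : ℕ) (p : SP ℤ) : Prop := ∀ t ∈ p, t.1.1 + t.1.2.1 + t.1.2.2 = d

instance (d : ℕ) (p : SP ℤ) : Decidable (IsHom d p) :=
  inferInstanceAs (Decidable (∀ t ∈ p, _))

@[simp] theorem l1_cons (t : Mon × ℤ) (p : SP ℤ) : l1 (t :: p) = t.2.natAbs + l1 p := by
  simp [l1]

@[simp] theorem l1_nil : l1 [] = 0 := rfl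

theorem isHom_cons {d : ℕ} {t : Mon × ℤ} {p : SP ℤ} :
    IsHom d (t :: p) ↔ t.1.1 + t.1.2.1 + t.1.2.2 = d ∧ IsHom d p := by
  simp [IsHom]

theorem l1_add_le (p q : SP ℤ) : l1 (add p q) ≤ l1 p + l1 q := by
  induction p generalizing q with
  | nil => simp [add]
  | cons t p ih =>
    obtain ⟨m, a⟩ := t
    rw [add]
    induction q with
    | nil => simpa [addTerm, l1] using ih []
    | cons s q ihq =>
      obtain ⟨n, b⟩ := s
      rw [addTerm]
      have h1 := ih q
      have h2 := ih ((n, b) :: q)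
      have h3 := Int.natAbs_add_le a b
      simp only [l1_cons] at h2 ihq
      split
      · simp only [l1_cons]
        omega
      · split <;> simp only [l1_cons] <;> omega

theorem l1_add {p q : SP ℤ} {a b : ℕ} (hp : l1 p ≤ a) (hq : l1 q ≤ b) : l1 (add p q) ≤ a + b :=
  (l1_add_le p q).trans (add_le_add hp hq)

theorem IsHom.add {d : ℕ} {p q : SP ℤ} (hp : IsHom d p) (hq : IsHom d q) :
    IsHom d (add p q) := by
  induction p generalizing q with
  | nil => simpa [SP.add] using hq
  | cons t p ih =>
    obtain ⟨m, a⟩ := t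
    rw [isHom_cons] at hp
    rw [SP.add]
    induction q with
    | nil => exact isHom_cons.2 ⟨hp.1, ih hp.2 hq⟩
    | cons s q ihq =>
      obtain ⟨n, b⟩ := s
      have hq' := isHom_cons.1 hq
      rw [addTerm]
      split
      · exact isHom_cons.2 ⟨hp.1, ih hp.2 hq'.2⟩
      · split
        · exact isHom_cons.2 ⟨hp.1, ih hp.2 hq⟩
        · exact isHom_cons.2 ⟨hq'.1, ihq hq'.2⟩

theorem l1_mulTerm (m : Mon) (a : ℤ) (q : SP ℤ) : l1 (mulTerm m a q) = a.natAbs * l1 q := by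
  induction q with
  | nil => simp [mulTerm]
  | cons t q ih =>
    simp only [mulTerm, List.map_cons, l1_cons] at ih ⊢
    rw [ih, Int.natAbs_mul, mul_add]

theorem l1_mul_le (p q : SP ℤ) : l1 (mul p q) ≤ l1 p * l1 q := by
  induction p with
  | nil => simp [mul]
  | cons t p ih =>
    simp only [mul, List.foldr_cons, l1_cons] at ih ⊢
    refine (l1_add_le _ _).trans ?_
    rw [l1_mulTerm, add_mul]
    exact Nat.add_le_add_left ih _

theorem l1_mul {p q : SP ℤ} {a b : ℕ} (hp : l1 p ≤ a) (hq : l1 q ≤ b) : l1 (mul p q) ≤ a * b :=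
  (l1_mul_le p q).trans (Nat.mul_le_mul hp hq)

theorem IsHom.mul {d e : ℕ} {p q : SP ℤ} (hp : IsHom d p) (hq : IsHom e q) :
    IsHom (d + e) (mul p q) := by
  induction p with
  | nil => simp [SP.mul, IsHom]
  | cons t p ih =>
    rw [isHom_cons] at hp
    simp only [SP.mul, List.foldr_cons] at ih ⊢
    refine IsHom.add ?_ (ih hp.2)
    intro s hs
    obtain ⟨u, hu, rfl⟩ := List.mem_map.1 hs
    have := hq u hu
    have := hp.1
    dsimp only
    omega

theorem l1_scale_eq (a : ℤ) (q : SP ℤ) : l1 (scale a q) = a.natAbs * l1 q := by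
  induction q with
  | nil => simp [scale]
  | cons t q ih =>
    simp only [scale, List.map_cons, l1_cons] at ih ⊢
    rw [ih, Int.natAbs_mul, mul_add]

theorem l1_scale (c : ℤ) {p : SP ℤ} {a : ℕ} (hp : l1 p ≤ a) : l1 (scale c p) ≤ c.natAbs * a :=
  (l1_scale_eq c p).trans_le (Nat.mul_le_mul_left _ hp)

theorem IsHom.scale {d : ℕ} {q : SP ℤ} (a : ℤ) (hq : IsHom d q) : IsHom d (scale a q) := by
  intro s hs
  obtain ⟨u, hu, rfl⟩ := List.mem_map.1 hs
  exact hq u hu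

theorem l1_pow_le (p : SP ℤ) (n : ℕ) : l1 (pow p n) ≤ l1 p ^ n := by
  induction n with
  | zero => simp [pow, l1]
  | succ n ih => exact (l1_mul_le _ _).trans (by rw [pow_succ']; gcongr)

theorem l1_pow {p : SP ℤ} {a : ℕ} (hp : l1 p ≤ a) (n : ℕ) : l1 (pow p n) ≤ a ^ n :=
  (l1_pow_le p n).trans (Nat.pow_le_pow_left hp n)

theorem IsHom.pow {d : ℕ} {p : SP ℤ} (hp : IsHom d p) (n : ℕ) : IsHom (n * d) (pow p n) := by
  induction n with
  | zero => simp [SP.pow, IsHom]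
  | succ n ih =>
    have := hp.mul ih
    rwa [show d + n * d = (n + 1) * d by ring] at this

/-- An integer polynomial with a root `N` that exceeds the absolute values of all coefficients is
zero: the lowest coefficient would be a nonzero multiple of `N`. -/
theorem polynomial_eq_zero_of_eval_eq_zero {P : Polynomial ℤ} {N : ℤ}
    (hP : ∀ n, |P.coeff n| < N) (h : P.eval N = 0) : P = 0 := by
  have key : ∀ d : ℕ, ∀ P : Polynomial ℤ, P.natDegree ≤ d → (∀ n, |P.coeff n| < N) →
      P.eval N = 0 → P = 0 := by
    intro d
    induction d with
    | zero =>
      intro P hd _ h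
      rw [Polynomial.eq_C_of_natDegree_le_zero hd] at h ⊢
      rw [Polynomial.eval_C] at h
      rw [h, map_zero]
    | succ d ih =>
      intro P hd hP h
      have hN : N ≠ 0 := ((abs_nonneg _).trans_lt (hP 0)).ne'
      have h0 : P.coeff 0 = 0 := by
        refine Int.eq_zero_of_abs_lt_dvd ?_ (hP 0)
        rw [← P.divX_mul_X_add, Polynomial.eval_add, Polynomial.eval_mul, Polynomial.eval_X,
          Polynomial.eval_C] at h
        exact ⟨-P.divX.eval N, by linear_combination h⟩
      have hX := P.divX_mul_X_add
      rw [h0, map_zero, add_zero] at hX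
      have : P.divX = 0 := by
        refine ih _ ?_ (fun n => ?_) ?_
        · rw [Polynomial.natDegree_divX_eq_natDegree_tsub_one]
          omega
        · rw [Polynomial.coeff_divX]
          exact hP _
        · rw [← hX, Polynomial.eval_mul, Polynomial.eval_X] at h
          exact (mul_eq_zero.1 h).resolve_right hN
      rw [← hX, this, zero_mul]
  exact key _ P le_rfl hP h

/-- Kronecker substitution: a form with integer coefficients vanishes if its value at a single
point with widely separated coordinates does. -/
theorem poly_eq_zero_of_ev_eq_zero {d N : ℕ} {l : SP ℤ} (hl : IsHom d l) (hN : l1 l < N)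
    (h : ev (RingHom.id ℤ) ![(N : ℤ) ^ (d + 1), (N : ℤ), 1] l = 0) : poly l = 0 := by
  set P : Polynomial ℤ := ev Polynomial.C ![Polynomial.X ^ (d + 1), Polynomial.X, 1] l with hPdef
  have hterm : ∀ t : Mon × ℤ, Polynomial.C t.2 *
      mon ![Polynomial.X ^ (d + 1), Polynomial.X, 1] t.1 =
        Polynomial.monomial ((d + 1) * t.1.1 + t.1.2.1) t.2 := by
    intro t
    simp [mon, ← Polynomial.C_mul_X_pow_eq_monomial, pow_add, pow_mul]
  have hP : P = 0 := by
    refine polynomial_eq_zero_of_eval_eq_zero (N := N) (fun n => ?_) ?_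
    · refine lt_of_le_of_lt ?_ (Int.ofNat_lt.2 hN)
      rw [hPdef]
      clear hPdef h hN hl P
      induction l with
      | nil => simp
      | cons t l ih =>
        rw [ev_cons, hterm, Polynomial.coeff_add, Polynomial.coeff_monomial, l1_cons]
        push_cast
        refine (abs_add_le _ _).trans (add_le_add ?_ ih)
        split <;> simp
    · rw [hPdef, ← Polynomial.coe_evalRingHom, map_ev, ← h]
      congr 1
      · ext x; simp
      · ext i; fin_cases i <;> simp
  have hcoeff : ∀ m : Fin 3 →₀ ℕ, MvPolynomial.coeff m (ev MvPolynomial.C MvPolynomial.X l :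
      MvPolynomial (Fin 3) ℤ) =
        if m 0 + m 1 + m 2 = d then P.coeff ((d + 1) * m 0 + m 1) else 0 := by
    intro m
    rw [hPdef]
    clear hPdef h hN hP P
    induction l with
    | nil => simp
    | cons t l ih =>
      obtain ⟨⟨a, b, c⟩, k⟩ := t
      obtain ⟨h1, h2⟩ := isHom_cons.1 hl
      dsimp only at h1
      have hmon : (MvPolynomial.C k * mon MvPolynomial.X (a, b, c) : MvPolynomial (Fin 3) ℤ) =
          MvPolynomial.monomial
            (Finsupp.single 0 a + Finsupp.single 1 b + Finsupp.single 2 c) k := by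
        rw [mon, MvPolynomial.X_pow_eq_monomial, MvPolynomial.X_pow_eq_monomial,
          MvPolynomial.X_pow_eq_monomial, MvPolynomial.monomial_mul, MvPolynomial.monomial_mul,
          MvPolynomial.C_mul_monomial]
        simp
      rw [ev_cons, MvPolynomial.coeff_add, ih h2, ev_cons, hterm, Polynomial.coeff_add,
        Polynomial.coeff_monomial, hmon, MvPolynomial.coeff_monomial]
      have hm : (Finsupp.single 0 a + Finsupp.single 1 b + Finsupp.single 2 c = m) ↔
          a = m 0 ∧ b = m 1 ∧ c = m 2 := by
        constructor
        · rintro rfl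
          simp
        · rintro ⟨rfl, rfl, rfl⟩
          ext i
          fin_cases i <;> simp
      by_cases hd : m 0 + m 1 + m 2 = d
      · rw [if_pos hd, if_pos hd]
        congr 1
        refine if_congr (hm.trans ⟨?_, ?_⟩) rfl rfl
        · rintro ⟨rfl, rfl, -⟩
          rfl
        · intro he
          dsimp only at he
          have hb : b = m 1 := by
            have := congrArg (· % (d + 1)) he
            simpa [Nat.mul_add_mod, Nat.mod_eq_of_lt (show b < d + 1 by omega),
              Nat.mod_eq_of_lt (show m 1 < d + 1 by omega)] using this
          have ha : a = m 0 := by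
            rw [hb] at he
            exact Nat.eq_of_mul_eq_mul_left (Nat.succ_pos d) (Nat.add_right_cancel he)
          omega
      · rw [if_neg hd, if_neg hd, if_neg (fun he => hd (by rw [hm] at he; omega)), zero_add]
  have hz : (ev MvPolynomial.C MvPolynomial.X l : MvPolynomial (Fin 3) ℤ) = 0 := by
    ext m
    rw [hcoeff, hP]
    simp
  have := congrArg (MvPolynomial.map (Int.castRingHom ℂ)) hz
  rw [map_ev, map_zero] at this
  rw [poly, toPoly, ← this]
  congr 1
  · ext x; simp
  · ext i; simp

end SP

open SP

/-! ### The forms of degree 6, 12, 30, 45 and the map of degree 19 as sparse polynomials -/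

/-- The form `F`. -/
def lF : SP ℤ :=
  [((0, 0, 6), 27), ((0, 5, 1), 9), ((1, 1, 4), -135), ((2, 2, 2), -45), ((3, 3, 0), 10),
    ((5, 0, 1), 9)]

/-- The form `Φ`. -/
def lΦ : SP ℤ :=
  [((0, 0, 12), 729), ((0, 5, 7), 2916), ((0, 10, 2), -9), ((1, 1, 10), 4374),
    ((1, 6, 5), -324), ((1, 11, 0), 6), ((2, 2, 8), 1215), ((2, 7, 3), 1080),
    ((3, 3, 6), -1080), ((3, 8, 1), 90), ((4, 4, 4), 3375), ((5, 0, 7), 2916),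
    ((5, 5, 2), -468), ((6, 1, 5), -324), ((6, 6, 0), -38), ((7, 2, 3), 1080), ((8, 3, 1), 90),
    ((10, 0, 2), -9), ((11, 1, 0), 6)]

/-- The form `Ψ`. -/
def lΨ : SP ℤ :=
  [((0, 0, 30), 57395628), ((0, 5, 25), -1422136116), ((0, 10, 20), 1459396035),
    ((0, 15, 15), 188628750), ((0, 20, 10), -365715), ((0, 25, 5), -1134), ((0, 30, 0), 3),
    ((1, 1, 28), 95659380), ((1, 6, 23), -4081466880), ((1, 11, 18), -1378400490),
    ((1, 16, 13), -357377670), ((1, 21, 8), -1361610), ((1, 26, 3), 3780),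
    ((2, 2, 26), 121168548), ((2, 7, 21), -903449700), ((2, 12, 16), 1891897155),
    ((2, 17, 11), -121137930), ((2, 22, 6), 1244430), ((2, 27, 1), 306),
    ((3, 3, 24), 1296716040), ((3, 8, 19), -7258303080), ((3, 13, 14), -3673875690),
    ((3, 18, 9), -2950020), ((3, 23, 4), 102690), ((4, 4, 22), -7702351560),
    ((4, 9, 17), -11324810880), ((4, 14, 12), 877745160), ((4, 19, 7), 16372530),
    ((4, 24, 2), 67965), ((5, 0, 25), -1422136116), ((5, 5, 20), -24824790090),
    ((5, 10, 15), -3320062830), ((5, 15, 10), 337587750), ((5, 20, 5), 247860),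
    ((5, 25, 0), 1558), ((6, 1, 23), -4081466880), ((6, 6, 18), -4441665780),
    ((6, 11, 13), -2330532810), ((6, 16, 8), 181118835), ((6, 21, 3), 492750),
    ((7, 2, 21), -903449700), ((7, 7, 16), -19366694190), ((7, 12, 11), 969198210),
    ((7, 17, 6), -28198530), ((7, 22, 1), -19470), ((8, 3, 19), -7258303080),
    ((8, 8, 14), 990186120), ((8, 13, 9), -790095060), ((8, 18, 4), 8505135),
    ((9, 4, 17), -11324810880), ((9, 9, 12), -7077438180), ((9, 14, 7), 32998590),
    ((9, 19, 2), 360360), ((10, 0, 20), 1459396035), ((10, 5, 15), -3320062830),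
    ((10, 10, 10), 1612428930), ((10, 15, 5), 34809750), ((10, 20, 0), 14205),
    ((11, 1, 18), -1378400490), ((11, 6, 13), -2330532810), ((11, 11, 8), -506396610),
    ((11, 16, 3), -3805650), ((12, 2, 16), 1891897155), ((12, 7, 11), 969198210),
    ((12, 12, 6), -318828420), ((12, 17, 1), -44940), ((13, 3, 14), -3673875690),
    ((13, 8, 9), -790095060), ((13, 13, 4), -10982610), ((14, 4, 12), 877745160),
    ((14, 9, 7), 32998590), ((14, 14, 2), 509790), ((15, 0, 15), 188628750),
    ((15, 5, 10), 337587750), ((15, 10, 5), 34809750), ((15, 15, 0), -24700),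
    ((16, 1, 13), -357377670), ((16, 6, 8), 181118835), ((16, 11, 3), -3805650),
    ((17, 2, 11), -121137930), ((17, 7, 6), -28198530), ((17, 12, 1), -44940),
    ((18, 3, 9), -2950020), ((18, 8, 4), 8505135), ((19, 4, 7), 16372530), ((19, 9, 2), 360360),
    ((20, 0, 10), -365715), ((20, 5, 5), 247860), ((20, 10, 0), 14205), ((21, 1, 8), -1361610),
    ((21, 6, 3), 492750), ((22, 2, 6), 1244430), ((22, 7, 1), -19470), ((23, 3, 4), 102690),
    ((24, 4, 2), 67965), ((25, 0, 5), -1134), ((25, 5, 0), 1558), ((26, 1, 3), 3780),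
    ((27, 2, 1), 306), ((30, 0, 0), 3)]

/-- The form `X45`. -/
def lX : SP ℤ :=
  [((0, 5, 40), 3570467226624), ((0, 10, 35), -19178863887456), ((0, 15, 30), 3972193575903),
    ((0, 20, 25), -399889689183), ((0, 25, 20), 49369097430), ((0, 30, 15), 378917433),
    ((0, 35, 10), -790722), ((0, 40, 5), 81), ((0, 45, 0), -1), ((1, 6, 38), 16364641455360),
    ((1, 11, 33), -37027067535360), ((1, 16, 28), 1188017755065), ((1, 21, 23), 1058789904300),
    ((1, 26, 18), 115545606975), ((1, 31, 13), -742136580), ((1, 36, 8), -509895),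
    ((1, 41, 3), -270), ((2, 7, 36), 28762097103360), ((2, 12, 31), -30047041725210),
    ((2, 17, 26), 917540858115), ((2, 22, 21), 4484060009550), ((2, 27, 16), -62879147775),
    ((2, 32, 11), -257442705), ((2, 37, 6), 300780), ((2, 42, 1), -45),
    ((3, 8, 34), 28049243403600), ((3, 13, 29), -27803159648550), ((3, 18, 24), 35046408186000),
    ((3, 23, 19), -516294931500), ((3, 28, 14), -65967847875), ((3, 33, 9), -34105050),
    ((3, 38, 4), -2475), ((4, 9, 32), 1089082041300), ((4, 14, 27), 65240414605350),
    ((4, 19, 22), 2525606922375), ((4, 24, 17), -2380479242625), ((4, 29, 12), 1383642000),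
    ((4, 34, 7), 31668975), ((4, 39, 2), 17700), ((5, 0, 40), -3570467226624),
    ((5, 10, 30), 58074747419403), ((5, 15, 25), -22437931134366),
    ((5, 20, 20), -12691839418335), ((5, 25, 15), -563657071518), ((5, 30, 10), 447874515),
    ((5, 35, 5), -8443764), ((5, 40, 0), 493), ((6, 1, 38), -16364641455360),
    ((6, 11, 28), -102078674439435), ((6, 16, 23), 48179564182350),
    ((6, 21, 18), -15715872159075), ((6, 26, 13), 219540934305), ((6, 31, 8), 1122793650),
    ((6, 36, 3), -297495), ((7, 2, 36), -28762097103360), ((7, 12, 26), 221460241448115),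
    ((7, 17, 21), -112881336762150), ((7, 22, 16), 3716039191050), ((7, 27, 11), -9577295820),
    ((7, 32, 6), -188424225), ((7, 37, 1), -82770), ((8, 3, 34), -28049243403600),
    ((8, 13, 24), -319232091451500), ((8, 18, 19), 42891008787000), ((8, 23, 14), 290255359500),
    ((8, 28, 9), 10224492300), ((8, 33, 4), 38350125), ((9, 4, 32), -1089082041300),
    ((9, 14, 22), 246224520484875), ((9, 19, 17), -8881471516500), ((9, 24, 12), -145111824000),
    ((9, 29, 7), -3556292850), ((9, 34, 2), 1401000), ((10, 0, 35), 19178863887456),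
    ((10, 5, 30), -58074747419403), ((10, 15, 20), -139246309890765),
    ((10, 20, 15), 6334727610915), ((10, 25, 10), -6185391498), ((10, 30, 5), 265502259),
    ((10, 35, 0), 52480), ((11, 1, 33), 37027067535360), ((11, 6, 28), 102078674439435),
    ((11, 16, 18), 81455500296450), ((11, 21, 13), -822504346650), ((11, 26, 8), -25989794055),
    ((11, 31, 3), -45062280), ((12, 2, 31), 30047041725210), ((12, 7, 26), -221460241448115),
    ((12, 17, 16), -11430709848675), ((12, 22, 11), 387329017725), ((12, 27, 6), 1982313270),
    ((12, 32, 1), -1080630), ((13, 3, 29), 27803159648550), ((13, 8, 24), 319232091451500),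
    ((13, 18, 14), 10424624457375), ((13, 23, 9), -8646669000), ((13, 28, 4), -171809775),
    ((14, 4, 27), -65240414605350), ((14, 9, 22), -246224520484875),
    ((14, 19, 12), 2528706721500), ((14, 24, 7), 14928188625), ((14, 29, 2), 15346800),
    ((15, 0, 30), -3972193575903), ((15, 5, 25), 22437931134366),
    ((15, 10, 20), 139246309890765), ((15, 20, 10), 876139380765), ((15, 25, 5), -624913866),
    ((15, 30, 0), 154472), ((16, 1, 28), -1188017755065), ((16, 6, 23), -48179564182350),
    ((16, 11, 18), -81455500296450), ((16, 21, 8), 167413464900), ((16, 26, 3), 23266845),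
    ((17, 2, 26), -917540858115), ((17, 7, 21), 112881336762150),
    ((17, 12, 16), 11430709848675), ((17, 22, 6), 13983538275), ((17, 27, 1), -1913130),
    ((18, 3, 24), -35046408186000), ((18, 8, 19), -42891008787000),
    ((18, 13, 14), -10424624457375), ((18, 23, 4), 914837625), ((19, 4, 22), -2525606922375),
    ((19, 9, 17), 8881471516500), ((19, 14, 12), -2528706721500), ((19, 24, 2), 13963500),
    ((20, 0, 25), 399889689183), ((20, 5, 20), 12691839418335), ((20, 10, 15), -6334727610915),
    ((20, 15, 10), -876139380765), ((20, 25, 0), 102486), ((21, 1, 23), -1058789904300),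
    ((21, 6, 18), 15715872159075), ((21, 11, 13), 822504346650), ((21, 16, 8), -167413464900),
    ((22, 2, 21), -4484060009550), ((22, 7, 16), -3716039191050), ((22, 12, 11), -387329017725),
    ((22, 17, 6), -13983538275), ((23, 3, 19), 516294931500), ((23, 8, 14), -290255359500),
    ((23, 13, 9), 8646669000), ((23, 18, 4), -914837625), ((24, 4, 17), 2380479242625),
    ((24, 9, 12), 145111824000), ((24, 14, 7), -14928188625), ((24, 19, 2), -13963500),
    ((25, 0, 20), -49369097430), ((25, 5, 15), 563657071518), ((25, 10, 10), 6185391498),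
    ((25, 15, 5), 624913866), ((25, 20, 0), -102486), ((26, 1, 18), -115545606975),
    ((26, 6, 13), -219540934305), ((26, 11, 8), 25989794055), ((26, 16, 3), -23266845),
    ((27, 2, 16), 62879147775), ((27, 7, 11), 9577295820), ((27, 12, 6), -1982313270),
    ((27, 17, 1), 1913130), ((28, 3, 14), 65967847875), ((28, 8, 9), -10224492300),
    ((28, 13, 4), 171809775), ((29, 4, 12), -1383642000), ((29, 9, 7), 3556292850),
    ((29, 14, 2), -15346800), ((30, 0, 15), -378917433), ((30, 5, 10), -447874515),
    ((30, 10, 5), -265502259), ((30, 15, 0), -154472), ((31, 1, 13), 742136580),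
    ((31, 6, 8), -1122793650), ((31, 11, 3), 45062280), ((32, 2, 11), 257442705),
    ((32, 7, 6), 188424225), ((32, 12, 1), 1080630), ((33, 3, 9), 34105050),
    ((33, 8, 4), -38350125), ((34, 4, 7), -31668975), ((34, 9, 2), -1401000),
    ((35, 0, 10), 790722), ((35, 5, 5), 8443764), ((35, 10, 0), -52480), ((36, 1, 8), 509895),
    ((36, 6, 3), 297495), ((37, 2, 6), -300780), ((37, 7, 1), 82770), ((38, 3, 4), 2475),
    ((39, 4, 2), -17700), ((40, 0, 5), -81), ((40, 5, 0), -493), ((41, 1, 3), 270),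
    ((42, 2, 1), 45), ((45, 0, 0), 1)]

namespace SP

/-- The difference. -/
def sub (p q : SP ℤ) : SP ℤ := add p (scale (-1) q)

/-- The dot product of two triples. -/
def dot (u v : Fin 3 → SP ℤ) : SP ℤ :=
  add (mul (u 0) (v 0)) (add (mul (u 1) (v 1)) (mul (u 2) (v 2)))

/-- The cross product of two triples. -/
def cross (u v : Fin 3 → SP ℤ) : Fin 3 → SP ℤ :=
  ![sub (mul (u 1) (v 2)) (mul (u 2) (v 1)), sub (mul (u 2) (v 0)) (mul (u 0) (v 2)),
    sub (mul (u 0) (v 1)) (mul (u 1) (v 0))]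

/-- The gradient. -/
def gradient (p : SP ℤ) : Fin 3 → SP ℤ := fun i => deriv i p

theorem poly_sub (p q : SP ℤ) : poly (sub p q) = poly p - poly q := by
  rw [sub, poly_add, poly_scale]
  simp [sub_eq_add_neg]

theorem poly_dot (u v : Fin 3 → SP ℤ) :
    poly (dot u v) = (fun i => poly (u i)) ⬝ᵥ (fun i => poly (v i)) := by
  simp only [dot, poly_add, poly_mul, dotProduct, Fin.sum_univ_three]
  ring

theorem poly_cross (u v : Fin 3 → SP ℤ) :
    (fun i => poly (cross u v i)) = crossProduct (fun i => poly (u i)) (fun i => poly (v i)) := by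
  ext1 i
  fin_cases i <;> simp [cross, cross_apply, poly_sub, poly_mul]

theorem poly_grad (p : SP ℤ) : grad (poly p) = fun i => poly (gradient p i) := by
  ext1 i
  exact pderiv_poly i p

theorem hess_poly (p : SP ℤ) :
    hess (poly p) = Matrix.of fun i j => poly (deriv i (deriv j p)) := by
  ext1 i j
  simp only [hess, Matrix.of_apply, pderiv_poly]

/-- The matrix of cofactors of the Hessian matrix. -/
def cofactor (p : SP ℤ) (i : Fin 3) : Fin 3 → SP ℤ :=
  cross (fun j => deriv (i + 1) (deriv j p)) (fun j => deriv (i + 2) (deriv j p))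

theorem l1_sub {p q : SP ℤ} {a b : ℕ} (hp : l1 p ≤ a) (hq : l1 q ≤ b) : l1 (sub p q) ≤ a + b := by
  simpa [sub] using l1_add hp (l1_scale (-1) hq)

theorem IsHom.sub {d : ℕ} {p q : SP ℤ} (hp : IsHom d p) (hq : IsHom d q) : IsHom d (sub p q) :=
  hp.add (hq.scale _)

theorem l1_cross {u v : Fin 3 → SP ℤ} {a b : ℕ} (hu : ∀ i, l1 (u i) ≤ a)
    (hv : ∀ i, l1 (v i) ≤ b) (i : Fin 3) : l1 (cross u v i) ≤ 2 * (a * b) := by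
  rw [two_mul]
  fin_cases i <;> exact l1_sub (l1_mul (hu _) (hv _)) (l1_mul (hu _) (hv _))

theorem IsHom.cross {d e : ℕ} {u v : Fin 3 → SP ℤ} (hu : ∀ i, IsHom d (u i))
    (hv : ∀ i, IsHom e (v i)) (i : Fin 3) : IsHom (d + e) (cross u v i) := by
  fin_cases i <;> exact ((hu _).mul (hv _)).sub ((hu _).mul (hv _))

end SP

theorem det_of_rows {R : Type*} [CommRing R] (u v w : Fin 3 → R) :
    (Matrix.of ![u, v, w]).det = u ⬝ᵥ crossProduct v w := by
  rw [triple_product_eq_det]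
  rfl

/-- A bordered determinant in terms of the cofactors. -/
theorem det_bordered {R : Type*} [CommRing R] (M : Matrix (Fin 3) (Fin 3) R) (v : Fin 3 → R) :
    (Matrix.fromBlocks M (Matrix.replicateCol Unit v) (Matrix.replicateRow Unit v) 0).det =
      -(v ⬝ᵥ fun i => crossProduct (M (i + 1)) (M (i + 2)) ⬝ᵥ v) := by
  let e : Fin 4 ≃ Fin 3 ⊕ Unit := Equiv.ofBijective
    ![Sum.inl 0, Sum.inl 1, Sum.inl 2, Sum.inr ()] (by decide)
  have e0 : e 0 = Sum.inl 0 := rfl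
  have e1 : e 1 = Sum.inl 1 := rfl
  have e2 : e 2 = Sum.inl 2 := rfl
  have e3 : e 3 = Sum.inr () := rfl
  rw [← Matrix.det_submatrix_equiv_self e, Matrix.det_succ_row_zero]
  simp only [Fin.sum_univ_four, Matrix.det_fin_three, Matrix.submatrix_apply, e0,
    dotProduct, Fin.sum_univ_three, cross_apply]
  simp only [Fin.succAbove, Fin.isValue, Fin.succ_zero_eq_one, Fin.succ_one_eq_two]
  simp [e0, e1, e2, e3, Fin.lt_def, show (Fin.succ 2 : Fin 4) = 3 from rfl,
    show (2 : Fin 3) + 1 = 0 from rfl, show (2 : Fin 3) + 2 = 1 from rfl,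
    show (1 : Fin 3) + 2 = 0 from rfl, show (1 : Fin 3) + 1 = 2 from rfl]
  ring

theorem F_eq : F = poly lF := by
  simp [F, poly, toPoly, mon, lF]
  ring

theorem Φ_eq : Φ = poly lΦ := by
  have h : poly (scale (-20250) lΦ) =
      poly (dot (fun j => deriv 0 (deriv j lF)) (cofactor lF 0)) :=
    poly_eq_of_same (by decide +kernel)
  have hd : (hess F).det = poly (dot (fun j => deriv 0 (deriv j lF)) (cofactor lF 0)) := by
    rw [F_eq, hess_poly, poly_dot, cofactor, poly_cross, triple_product_eq_det]
    congr 1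
    ext1 i j
    fin_cases i <;> rfl
  rw [Φ, hd, ← h, poly_scale, ← mul_assoc, ← map_mul]
  norm_num

theorem Ψ_eq : Ψ = poly lΨ := by
  have h : poly (scale (-24300) lΨ) =
      poly (dot (gradient lΦ) fun i => dot (cofactor lF i) (gradient lΦ)) :=
    poly_eq_of_same (by decide +kernel)
  have hd : (Matrix.fromBlocks (hess F) (Matrix.replicateCol Unit (grad Φ))
      (Matrix.replicateRow Unit (grad Φ)) 0).det =
        -poly (dot (gradient lΦ) fun i => dot (cofactor lF i) (gradient lΦ)) := by
    rw [det_bordered, poly_dot, F_eq, Φ_eq, hess_poly, poly_grad]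
    have hc : ∀ i, (fun j => poly (cofactor lF i j)) =
        crossProduct ((Matrix.of fun i j => poly (deriv i (deriv j lF))) (i + 1))
          ((Matrix.of fun i j => poly (deriv i (deriv j lF))) (i + 2)) := fun i => poly_cross _ _
    simp only [poly_dot, hc]
  rw [Ψ, hd, ← h, poly_scale, ← neg_mul, ← map_neg, ← mul_assoc, ← map_mul]
  norm_num

theorem X45_eq : X45 = poly lX := by
  have h : poly (scale (-4860) lX) = poly (dot (gradient lF) (cross (gradient lΦ) (gradient lΨ))) :=
    poly_eq_of_same (by decide +kernel)
  have hd : (Matrix.of ![grad F, grad Φ, grad Ψ]).det =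
      poly (dot (gradient lF) (cross (gradient lΦ) (gradient lΨ))) := by
    rw [det_of_rows, F_eq, Φ_eq, Ψ_eq, poly_grad, poly_grad, poly_grad, ← poly_cross, poly_dot]
  rw [X45, hd, ← h, poly_scale, ← mul_assoc, ← map_mul]
  norm_num

theorem ofTerms_eq (l : List (ℤ × ℕ × ℕ × ℕ)) :
    ofTerms l = poly (collect (l.map fun t => (t.2, t.1))) := by
  rw [poly, toPoly, ev_collect]
  induction l with
  | nil => rfl
  | cons t l ih =>
    simp only [ofTerms, List.map_cons, List.sum_cons, ev_cons] at ih ⊢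
    rw [ih]
    simp [mon]
    ring

/-- The components of `hExplicit`. -/
def lH : Fin 3 → SP ℤ :=
  ![[((0, 4, 15), 20194758), ((0, 9, 10), 9598743), ((0, 14, 5), 13851), ((0, 19, 0), -81),
    ((1, 0, 18), 7479540), ((1, 5, 13), 52356780), ((1, 10, 8), 4363065), ((1, 15, 3), -46170),
    ((2, 1, 16), 22438620), ((2, 11, 6), -1939140), ((2, 16, 1), -7695), ((3, 2, 14), 18698850),
    ((3, 7, 9), 43630650), ((3, 12, 4), -807975), ((4, 3, 12), 23269680),
    ((4, 8, 7), -28117530), ((4, 13, 2), 161595), ((5, 4, 10), -31123197),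
    ((5, 9, 5), 10277442), ((5, 14, 0), 9747), ((6, 0, 13), -26178390), ((6, 5, 8), 2423925),
    ((6, 10, 3), 1292760), ((7, 1, 11), 14959080), ((7, 6, 6), -3986010), ((7, 11, 1), 10260),
    ((8, 2, 9), -24931800), ((8, 7, 4), -2346975), ((9, 3, 7), -5263380), ((9, 8, 2), -74385),
    ((10, 4, 5), -3587409), ((10, 9, 0), -5263), ((11, 0, 8), 831060), ((11, 5, 3), -969570),
    ((12, 1, 6), -969570), ((12, 6, 1), 17955), ((14, 3, 2), -107730), ((15, 4, 0), -3591)],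
    [((0, 1, 18), 7479540), ((0, 6, 13), -26178390), ((0, 11, 8), 831060), ((1, 2, 16), 22438620),
    ((1, 7, 11), 14959080), ((1, 12, 6), -969570), ((2, 3, 14), 18698850),
    ((2, 8, 9), -24931800), ((3, 4, 12), 23269680), ((3, 9, 7), -5263380),
    ((3, 14, 2), -107730), ((4, 0, 15), 20194758), ((4, 5, 10), -31123197),
    ((4, 10, 5), -3587409), ((4, 15, 0), -3591), ((5, 1, 13), 52356780), ((5, 6, 8), 2423925),
    ((5, 11, 3), -969570), ((6, 7, 6), -3986010), ((6, 12, 1), 17955), ((7, 3, 9), 43630650),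
    ((7, 8, 4), -2346975), ((8, 4, 7), -28117530), ((8, 9, 2), -74385), ((9, 0, 10), 9598743),
    ((9, 5, 5), 10277442), ((9, 10, 0), -5263), ((10, 1, 8), 4363065), ((10, 6, 3), 1292760),
    ((11, 2, 6), -1939140), ((11, 7, 1), 10260), ((12, 3, 4), -807975), ((13, 4, 2), 161595),
    ((14, 0, 5), 13851), ((14, 5, 0), 9747), ((15, 1, 3), -46170), ((16, 2, 1), -7695),
    ((19, 0, 0), -81)],
    [((0, 0, 19), -1023516), ((0, 5, 14), 6357609), ((0, 10, 9), -2036097), ((0, 15, 4), 4617),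
    ((1, 1, 17), -4487724), ((1, 6, 12), -2617839), ((1, 11, 7), 2520882), ((1, 16, 2), 3078),
    ((2, 2, 15), -5983632), ((2, 7, 10), 5235678), ((2, 12, 5), 290871), ((2, 17, 0), -1026),
    ((3, 3, 13), -2908710), ((3, 8, 8), 19876185), ((3, 13, 3), 215460), ((4, 4, 11), 37813230),
    ((4, 9, 6), -1454355), ((4, 14, 1), -5130), ((5, 0, 14), 6357609), ((5, 5, 9), 5623506),
    ((5, 10, 4), 937251), ((6, 1, 12), -2617839), ((6, 6, 7), 8812314), ((6, 11, 2), -272916),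
    ((7, 2, 10), 5235678), ((7, 7, 5), 4813992), ((7, 12, 0), -3078), ((8, 3, 8), 19876185),
    ((8, 8, 3), 687420), ((9, 4, 6), -1454355), ((9, 9, 1), 113240), ((10, 0, 9), -2036097),
    ((10, 5, 4), 937251), ((11, 1, 7), 2520882), ((11, 6, 2), -272916), ((12, 2, 5), 290871),
    ((12, 7, 0), -3078), ((13, 3, 3), 215460), ((14, 4, 1), -5130), ((15, 0, 4), 4617),
    ((16, 1, 2), 3078), ((17, 2, 0), -1026)]]

theorem hExplicit_eq (i : Fin 3) : hExplicit i = poly (lH i) := by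
  fin_cases i
  · exact (ofTerms_eq _).trans (poly_eq_of_same (by decide +kernel))
  · exact (ofTerms_eq _).trans (poly_eq_of_same (by decide +kernel))
  · exact (ofTerms_eq _).trans (poly_eq_of_same (by decide +kernel))

/-- The coordinates, as sparse polynomials. -/
def lY : Fin 3 → SP ℤ := ![[((1, 0, 0), 1)], [((0, 1, 0), 1)], [((0, 0, 1), 1)]]

theorem lY_eq (i : Fin 3) : poly (lY i) = MvPolynomial.X i := by
  fin_cases i <;> simp [lY, toPoly, mon]

/-- The components of `f₁₉ = h₁₉ - 1620 F³ y`. -/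
def lf19 (i : Fin 3) : SP ℤ := sub (scale 810 (lH i)) (scale 1620 (mul (lY i) (pow lF 3)))

/-- The coefficient of `ψ` in the map of degree 64. -/
def lCoeff : SP ℤ :=
  add (scale 10 (mul lΦ (pow lF 6))) <| add (scale 100 (mul (pow lF 4) (pow lΦ 2))) <|
  add (scale 454 (mul (pow lF 2) (pow lΦ 3))) <| add (scale 156 (pow lΦ 4)) <|
  add (scale 39 (mul (pow lF 3) lΨ)) (scale 51 (mul lF (mul lΦ lΨ)))

/-- The components of the map of degree 64. -/
def lf64 (i : Fin 3) : SP ℤ :=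
  add (sub (mul (cross (gradient lF) (gradient lΦ) i) lCoeff)
      (scale 27 (mul (cross (gradient lF) (gradient lΨ) i) lΨ)))
    (scale 54 (mul (pow lΦ 2) (cross (gradient lΦ) (gradient lΨ) i)))

theorem poly_pow (p : SP ℤ) (n : ℕ) : poly (pow p n) = poly p ^ n := ev_pow _ _ p n

theorem f64_eq (i : Fin 3) : f64 i = poly (lf64 i) := by
  have hc (p q : SP ℤ) : poly (cross (gradient p) (gradient q) i) =
      crossProduct (grad (poly p)) (grad (poly q)) i := by
    rw [poly_grad, poly_grad, ← poly_cross]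
  simp only [f64, ψ16, φ34, f40, lf64, lCoeff, poly_add, poly_sub, poly_mul, poly_scale, poly_pow,
    hc, ← F_eq, ← Φ_eq, ← Ψ_eq]
  simp only [Int.cast_ofNat, map_ofNat]
  ring

theorem isHom_sub_lf64 (i : Fin 3) : IsHom 64 (sub (mul (lf19 i) lX) (lf64 i)) := by
  have hF : IsHom 6 lF := by decide +kernel
  have hΦ : IsHom 12 lΦ := by decide +kernel
  have hΨ : IsHom 30 lΨ := by decide +kernel
  have hX : IsHom 45 lX := by decide +kernel
  have hH : ∀ i, IsHom 19 (lH i) := by decide +kernel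
  have hY : ∀ i, IsHom 1 (lY i) := by decide +kernel
  have gF : ∀ i, IsHom 5 (gradient lF i) := by decide +kernel
  have gΦ : ∀ i, IsHom 11 (gradient lΦ i) := by decide +kernel
  have gΨ : ∀ i, IsHom 29 (gradient lΨ i) := by decide +kernel
  have hc : IsHom 48 lCoeff :=
    ((hΦ.mul (hF.pow 6)).scale _).add <| (((hF.pow 4).mul (hΦ.pow 2)).scale _).add <|
    (((hF.pow 2).mul (hΦ.pow 3)).scale _).add <| ((hΦ.pow 4).scale _).add <|
    (((hF.pow 3).mul hΨ).scale _).add ((hF.mul (hΦ.mul hΨ)).scale _)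
  exact ((((hH i).scale _).sub (((hY i).mul (hF.pow 3)).scale _)).mul hX).sub
    ((((IsHom.cross gF gΦ i).mul hc).sub (((IsHom.cross gF gΨ i).mul hΨ).scale _)).add
      (((hΦ.pow 2).mul (IsHom.cross gΦ gΨ i)).scale _))

/-- A crude bound, from the coefficients of the five forms: an evaluation at powers of `2 ^ 256`
determines the coefficients. -/
theorem l1_sub_lf64 (i : Fin 3) : l1 (sub (mul (lf19 i) lX) (lf64 i)) < 2 ^ 256 := by
  have hF : l1 lF ≤ 10 ^ 3 := by decide +kernel
  have hΦ : l1 lΦ ≤ 10 ^ 5 := by decide +kernel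
  have hΨ : l1 lΨ ≤ 10 ^ 12 := by decide +kernel
  have hX : l1 lX ≤ 10 ^ 18 := by decide +kernel
  have hH : ∀ i, l1 (lH i) ≤ 10 ^ 10 := by decide +kernel
  have hY : ∀ i, l1 (lY i) ≤ 1 := by decide +kernel
  have gF : ∀ i, l1 (gradient lF i) ≤ 10 ^ 4 := by decide +kernel
  have gΦ : ∀ i, l1 (gradient lΦ i) ≤ 10 ^ 6 := by decide +kernel
  have gΨ : ∀ i, l1 (gradient lΨ i) ≤ 10 ^ 13 := by decide +kernel
  have hc := (l1_add (l1_scale 10 (l1_mul hΦ (l1_pow hF 6))) <|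
    l1_add (l1_scale 100 (l1_mul (l1_pow hF 4) (l1_pow hΦ 2))) <|
    l1_add (l1_scale 454 (l1_mul (l1_pow hF 2) (l1_pow hΦ 3))) <|
    l1_add (l1_scale 156 (l1_pow hΦ 4)) <|
    l1_add (l1_scale 39 (l1_mul (l1_pow hF 3) hΨ)) (l1_scale 51 (l1_mul hF (l1_mul hΦ hΨ))))
  refine (l1_sub (l1_mul (l1_sub (l1_scale 810 (hH i))
    (l1_scale 1620 (l1_mul (hY i) (l1_pow hF 3)))) hX)
    (l1_add (l1_sub (l1_mul (l1_cross gF gΦ i) hc) (l1_scale 27 (l1_mul (l1_cross gF gΨ i) hΨ)))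
      (l1_scale 54 (l1_mul (l1_pow hΦ 2) (l1_cross gΦ gΨ i))))).trans_lt ?_
  norm_num

theorem ev_cross {S : Type} [CommRing S] (φ : ℤ →+* S) (x : Fin 3 → S) (u v : Fin 3 → SP ℤ)
    (i : Fin 3) : ev φ x (cross u v i) =
      ![ev φ x (u 1) * ev φ x (v 2) - ev φ x (u 2) * ev φ x (v 1),
        ev φ x (u 2) * ev φ x (v 0) - ev φ x (u 0) * ev φ x (v 2),
        ev φ x (u 0) * ev φ x (v 1) - ev φ x (u 1) * ev φ x (v 0)] i := by
  fin_cases i <;> simp [cross, sub, ev_add, ev_scale, ev_mul, sub_eq_add_neg]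

/-- The form of degree 45 divides the map of degree 64, with the explicit quotient. -/
theorem X45_mul_lf19 (i : Fin 3) : X45 * poly (lf19 i) = f64 i := by
  rw [X45_eq, f64_eq, mul_comm, ← poly_mul, ← sub_eq_zero, ← poly_sub]
  refine poly_eq_zero_of_ev_eq_zero (isHom_sub_lf64 i) (l1_sub_lf64 i) ?_
  simp only [sub, ev_add, ev_scale, ev_mul, ev_pow, lf19, lf64, lCoeff, ev_cross]
  revert i
  decide +kernel

theorem lf19_eq (i : Fin 3) : poly (lf19 i) =
    MvPolynomial.C 810 * hExplicit i - MvPolynomial.C 1620 * F ^ 3 * MvPolynomial.X i := by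
  rw [lf19, poly_sub, poly_scale, poly_scale, poly_mul, poly_pow, lY_eq, ← hExplicit_eq, ← F_eq]
  simp only [Int.cast_ofNat]
  ring

theorem X45_ne_zero : X45 ≠ 0 := by
  intro h
  have h1 := congrArg (MvPolynomial.eval ![1, 0, 0]) h
  rw [X45_eq, eval_toPoly, map_zero] at h1
  have h2 : ev (Int.castRingHom ℂ) ![1, 0, 0] lX =
      Int.castRingHom ℂ (ev (RingHom.id ℤ) ![1, 0, 0] lX) := by
    rw [map_ev]
    congr 1
    ext i
    fin_cases i <;> simp
  rw [h2, show ev (RingHom.id ℤ) ![1, 0, 0] lX = 1 by decide +kernel] at h1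
  simp at h1

theorem trace_adjugate_mul {R : Type*} [CommRing R] (M N : Matrix (Fin 3) (Fin 3) R) :
    (M.adjugate * N).trace = ∑ i, crossProduct (M (i + 1)) (M (i + 2)) ⬝ᵥ N i := by
  have h21 : (2 : Fin 3) + 1 = 0 := rfl
  have h22 : (2 : Fin 3) + 2 = 1 := rfl
  have h12 : (1 : Fin 3) + 2 = 0 := rfl
  have h11 : (1 : Fin 3) + 1 = 2 := rfl
  simp only [Matrix.trace_fin_three, Matrix.adjugate_fin_three, Fin.sum_univ_three,
    Matrix.mul_apply, cross_apply, dotProduct, h21, h22, h12, h11, zero_add, Matrix.of_apply,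
    Matrix.cons_val', Matrix.cons_val_zero, Matrix.cons_val_one, Matrix.cons_val]
  ring

/-- A covariant of degree 18 that mixes two different weights: it shows that a linear substitution
that preserves `F` has determinant `±1`. -/
theorem trace_adjugate_hess : ((hess F).adjugate * hess Φ).trace =
    -(MvPolynomial.C 14850 * F ^ 3 + MvPolynomial.C 25650 * F * Φ) := by
  have hc : ∀ i, (fun j => poly (cofactor lF i j)) =
      crossProduct ((Matrix.of fun i j => poly (deriv i (deriv j lF))) (i + 1))
        ((Matrix.of fun i j => poly (deriv i (deriv j lF))) (i + 2)) := fun i => poly_cross _ _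
  have h : poly (add (dot (cofactor lF 0) fun j => deriv 0 (deriv j lΦ))
      (add (dot (cofactor lF 1) fun j => deriv 1 (deriv j lΦ))
        (dot (cofactor lF 2) fun j => deriv 2 (deriv j lΦ)))) =
      poly (add (scale (-14850) (pow lF 3)) (scale (-25650) (mul lF lΦ))) :=
    poly_eq_of_same (by decide +kernel)
  simp only [poly_add, poly_dot, poly_scale, poly_mul, poly_pow, hc, ← F_eq, ← Φ_eq] at h
  rw [trace_adjugate_mul, Fin.sum_univ_three, F_eq, Φ_eq, hess_poly, hess_poly, ← F_eq, ← Φ_eq,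
    ← add_assoc] at *
  refine h.trans ?_
  simp only [Int.cast_neg, Int.cast_ofNat, map_neg]
  ring

/-! ### Linear substitutions and the covariance of the constructions from `F` -/

/-- The substitution `q ↦ q ∘ M` for a matrix `M`, as an algebra homomorphism. -/
noncomputable def lin (M : Matrix (Fin 3) (Fin 3) ℂ) : Poly →ₐ[ℂ] Poly :=
  MvPolynomial.aeval fun i => ∑ j, MvPolynomial.C (M i j) * MvPolynomial.X j

theorem precompPoly_eq_lin (g : GL (Fin 3) ℂ) (q : Poly) : precompPoly g q = lin g q := rfl

theorem eval_lin (M : Matrix (Fin 3) (Fin 3) ℂ) (q : Poly) (v : Fin 3 → ℂ) :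
    MvPolynomial.eval v (lin M q) = MvPolynomial.eval (M.mulVec v) q := by
  have : (MvPolynomial.eval v).comp (lin M : Poly →+* Poly) =
      MvPolynomial.eval (M.mulVec v) := by
    apply MvPolynomial.ringHom_ext
    · intro c
      simp [lin]
    · intro i
      simp [lin, Matrix.mulVec, dotProduct]
  exact congrArg (fun f => f q) this

theorem lin_mul (M N : Matrix (Fin 3) (Fin 3) ℂ) (q : Poly) : lin N (lin M q) = lin (M * N) q :=
  MvPolynomial.funext fun v => by simp only [eval_lin, Matrix.mulVec_mulVec]

theorem lin_one (q : Poly) : lin 1 q = q :=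
  MvPolynomial.funext fun v => by simp only [eval_lin, Matrix.one_mulVec]

theorem lin_C (M : Matrix (Fin 3) (Fin 3) ℂ) (c : ℂ) :
    lin M (MvPolynomial.C c) = MvPolynomial.C c := by simp [lin]

theorem eval_smul_of_isHomogeneous {n : ℕ} {q : Poly} (hq : q.IsHomogeneous n) (t : ℂ)
    (v : Fin 3 → ℂ) : MvPolynomial.eval (t • v) q = t ^ n * MvPolynomial.eval v q := by
  rw [MvPolynomial.eval_eq, MvPolynomial.eval_eq, Finset.mul_sum]
  refine Finset.sum_congr rfl fun d hd => ?_
  simp only [Pi.smul_apply, smul_eq_mul, mul_pow, Finset.prod_mul_distrib,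
    Finset.prod_pow_eq_pow_sum]
  have : d.degree = n := by
    rw [Finsupp.degree_eq_weight_one]
    exact hq (MvPolynomial.mem_support_iff.1 hd)
  rw [Finsupp.degree_apply] at this
  rw [this]
  ring

theorem lin_smul {n : ℕ} {q : Poly} (hq : q.IsHomogeneous n) (t : ℂ)
    (M : Matrix (Fin 3) (Fin 3) ℂ) : lin (t • M) q = MvPolynomial.C (t ^ n) * lin M q :=
  MvPolynomial.funext fun v => by
    rw [eval_lin, map_mul, MvPolynomial.eval_C, eval_lin, Matrix.smul_mulVec,
      eval_smul_of_isHomogeneous hq]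

theorem pderiv_lin (M : Matrix (Fin 3) (Fin 3) ℂ) (i : Fin 3) (q : Poly) :
    MvPolynomial.pderiv i (lin M q) =
      ∑ j, MvPolynomial.C (M j i) * lin M (MvPolynomial.pderiv j q) := by
  induction q using MvPolynomial.induction_on with
  | C a => simp
  | add p q hp hq => simp [hp, hq, mul_add, Finset.sum_add_distrib]
  | mul_X p k hp =>
    have hX : MvPolynomial.pderiv i (lin M (MvPolynomial.X k)) = MvPolynomial.C (M k i) := by
      have h : ∀ c : ℂ, MvPolynomial.pderiv i (MvPolynomial.C c : Poly) = 0 :=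
        fun c => MvPolynomial.pderiv_C
      simp only [lin, MvPolynomial.aeval_X, map_sum, Derivation.leibniz, MvPolynomial.pderiv_X, h,
        smul_eq_mul, mul_zero, add_zero, Pi.single_apply, mul_ite, mul_one]
      simp
    have hj : ∀ j, MvPolynomial.C (M j i) * lin M (MvPolynomial.pderiv j (p * MvPolynomial.X k)) =
        (if k = j then MvPolynomial.C (M j i) * lin M p else 0) +
          lin M (MvPolynomial.X k) *
            (MvPolynomial.C (M j i) * lin M (MvPolynomial.pderiv j p)) := by
      intro j
      rw [Derivation.leibniz, MvPolynomial.pderiv_X, Pi.single_apply, map_add, smul_eq_mul,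
        smul_eq_mul, map_mul, map_mul]
      split_ifs with h
      · rw [map_one]
        ring
      · rw [map_zero]
        ring
    rw [map_mul, Derivation.leibniz, hp, hX, Finset.sum_congr rfl fun j _ => hj j,
      Finset.sum_add_distrib, ← Finset.mul_sum]
    simp only [Finset.sum_ite_eq, Finset.mem_univ, if_true, smul_eq_mul]
    ring

/-- A complex matrix as a matrix of constant polynomials. -/
noncomputable abbrev cmat (M : Matrix (Fin 3) (Fin 3) ℂ) : Matrix (Fin 3) (Fin 3) Poly :=
  M.map MvPolynomial.C

theorem det_cmat (M : Matrix (Fin 3) (Fin 3) ℂ) : (cmat M).det = MvPolynomial.C M.det :=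
  (RingHom.map_det MvPolynomial.C M).symm

theorem grad_lin (M : Matrix (Fin 3) (Fin 3) ℂ) (q : Poly) :
    grad (lin M q) = (cmat M)ᵀ.mulVec fun i => lin M (grad q i) := by
  ext1 i
  simp only [grad, pderiv_lin, Matrix.mulVec, dotProduct, Matrix.transpose_apply, Matrix.map_apply]

theorem hess_lin (M : Matrix (Fin 3) (Fin 3) ℂ) (q : Poly) :
    hess (lin M q) = (cmat M)ᵀ * (hess q).map (lin M) * cmat M := by
  ext1 i j
  simp only [hess, Matrix.of_apply, pderiv_lin, Matrix.mul_apply, Matrix.transpose_apply,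
    Matrix.map_apply, map_sum, MvPolynomial.pderiv_C_mul, Finset.sum_mul]
  refine Finset.sum_congr rfl fun k _ => ?_
  rw [Finset.mul_sum]
  refine Finset.sum_congr rfl fun l _ => ?_
  ring

theorem crossProduct_mulVec {R : Type*} [CommRing R] (M : Matrix (Fin 3) (Fin 3) R)
    (u v : Fin 3 → R) :
    crossProduct (Mᵀ.mulVec u) (Mᵀ.mulVec v) = M.adjugate.mulVec (crossProduct u v) := by
  ext1 i
  rw [Matrix.adjugate_fin_three]
  fin_cases i <;>
  · simp [cross_apply, Matrix.mulVec, dotProduct, Fin.sum_univ_three]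
    ring

theorem det_bordered_adjugate {R : Type*} [CommRing R] (M : Matrix (Fin 3) (Fin 3) R)
    (v : Fin 3 → R) :
    (Matrix.fromBlocks M (Matrix.replicateCol Unit v) (Matrix.replicateRow Unit v) 0).det =
      -(v ⬝ᵥ M.adjugate.mulVec v) := by
  have h21 : (2 : Fin 3) + 1 = 0 := rfl
  have h22 : (2 : Fin 3) + 2 = 1 := rfl
  have h12 : (1 : Fin 3) + 2 = 0 := rfl
  have h11 : (1 : Fin 3) + 1 = 2 := rfl
  rw [det_bordered, Matrix.adjugate_fin_three]
  simp only [Fin.sum_univ_three, Matrix.mulVec,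
    cross_apply, dotProduct, h21, h22, h12, h11, zero_add, Matrix.of_apply,
    Matrix.cons_val', Matrix.cons_val_zero, Matrix.cons_val_one, Matrix.cons_val]
  ring

theorem dotProduct_adjugate_congr {R : Type*} [CommRing R] (N H : Matrix (Fin 3) (Fin 3) R)
    (w : Fin 3 → R) :
    Nᵀ.mulVec w ⬝ᵥ (Nᵀ * H * N).adjugate.mulVec (Nᵀ.mulVec w) =
      N.det ^ 2 * (w ⬝ᵥ H.adjugate.mulVec w) := by
  have h : N * ((Nᵀ * H * N).adjugate * Nᵀ) = N.det ^ 2 • H.adjugate := by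
    rw [Matrix.adjugate_mul_distrib, Matrix.adjugate_mul_distrib]
    calc N * (N.adjugate * (H.adjugate * Nᵀ.adjugate) * Nᵀ)
        = (N * N.adjugate) * H.adjugate * (Nᵀ.adjugate * Nᵀ) := by simp only [mul_assoc]
      _ = _ := by
        rw [Matrix.mul_adjugate, Matrix.adjugate_mul, Matrix.det_transpose]
        simp [smul_smul, pow_two]
  rw [Matrix.mulVec_mulVec, Matrix.mulVec_transpose, ← Matrix.dotProduct_mulVec,
    Matrix.mulVec_mulVec, h, Matrix.smul_mulVec, dotProduct_smul, smul_eq_mul]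

theorem lin_adjugate (M : Matrix (Fin 3) (Fin 3) ℂ) (H : Matrix (Fin 3) (Fin 3) Poly) :
    (H.map (lin M)).adjugate = H.adjugate.map (lin M) :=
  (RingHom.map_adjugate (lin M : Poly →+* Poly) H).symm

theorem lin_crossProduct (M : Matrix (Fin 3) (Fin 3) ℂ) (u v : Fin 3 → Poly) (i : Fin 3) :
    lin M (crossProduct u v i) = crossProduct (fun j => lin M (u j)) (fun j => lin M (v j)) i := by
  fin_cases i <;> simp [cross_apply]

theorem eval_poly_intCast (l : SP ℤ) (v : Fin 3 → ℤ) :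
    MvPolynomial.eval (fun i => (v i : ℂ)) (poly l) = (ev (RingHom.id ℤ) v l : ℤ) := by
  rw [eval_toPoly, ← eq_intCast (Int.castRingHom ℂ), map_ev]
  rfl

section Covariance

variable {M : Matrix (Fin 3) (Fin 3) ℂ}

theorem Φ_covariant (h : lin M F = F) : Φ = MvPolynomial.C (M.det ^ 2) * lin M Φ := by
  have h1 : (hess F).det = MvPolynomial.C (M.det ^ 2) * lin M (hess F).det := by
    conv_lhs => rw [← h, hess_lin, Matrix.det_mul, Matrix.det_mul, Matrix.det_transpose, det_cmat]
    rw [map_pow, ← AlgHom.mapMatrix_apply, ← AlgHom.map_det]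
    ring
  conv_lhs => rw [Φ, h1]
  rw [Φ, map_mul, lin_C]
  ring

/-- A linear substitution that preserves `F` has determinant `±1`: otherwise the two terms of the
covariant of degree 18 would be scaled differently. -/
theorem det_sq_eq_one (h : lin M F = F) : M.det ^ 2 = 1 := by
  have hN := det_cmat M
  obtain ⟨u, hu⟩ : ∃ u, u = M.det ^ 2 := ⟨_, rfl⟩
  have hΦ := Φ_covariant h
  rw [← hu] at hΦ ⊢
  have hHΦ : hess Φ = (MvPolynomial.C u : Poly) • ((cmat M)ᵀ * (hess Φ).map (lin M) * cmat M) := by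
    conv_lhs => rw [hΦ]
    rw [← hess_lin]
    ext1 i j
    simp only [hess, Matrix.of_apply, Matrix.smul_apply, MvPolynomial.pderiv_C_mul, smul_eq_mul]
  have hT : ((hess F).adjugate * hess Φ).trace =
      MvPolynomial.C (u ^ 2) * lin M ((hess F).adjugate * hess Φ).trace := by
    have h2 : (hess F).adjugate = (cmat M).adjugate *
        ((hess F).adjugate.map (lin M)) * (cmat M)ᵀ.adjugate := by
      conv_lhs => rw [← h, hess_lin, Matrix.adjugate_mul_distrib, Matrix.adjugate_mul_distrib]
      rw [lin_adjugate, mul_assoc]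
    conv_lhs => rw [h2, hHΦ]
    rw [Matrix.mul_smul, Matrix.trace_smul]
    have h3 : (cmat M).adjugate * (hess F).adjugate.map (lin M) * (cmat M)ᵀ.adjugate *
        ((cmat M)ᵀ * (hess Φ).map (lin M) * cmat M) =
        (cmat M).adjugate * ((hess F).adjugate.map (lin M) * ((cmat M)ᵀ.adjugate *
        (cmat M)ᵀ) * (hess Φ).map (lin M)) * cmat M := by
      simp only [mul_assoc]
    rw [h3, Matrix.adjugate_mul, Matrix.det_transpose, hN, Matrix.mul_smul, Matrix.mul_one,
      Matrix.smul_mul, Matrix.mul_smul, Matrix.smul_mul, Matrix.trace_smul, Matrix.trace_mul_comm,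
      ← mul_assoc, Matrix.mul_adjugate, hN, Matrix.smul_mul, Matrix.one_mul, Matrix.trace_smul]
    have h4 : ((hess F).adjugate.map (lin M) * (hess Φ).map (lin M)).trace =
        lin M ((hess F).adjugate * hess Φ).trace := by
      rw [← AlgHom.mapMatrix_apply, ← AlgHom.mapMatrix_apply, ← map_mul, AlgHom.mapMatrix_apply,
        ← AddMonoidHom.map_trace]
    rw [h4, hu]
    simp only [smul_eq_mul, map_pow]
    ring
  rw [trace_adjugate_hess] at hT
  simp only [map_neg, map_add, map_mul, map_pow, lin_C, h] at hT
  have key : MvPolynomial.C (1 - u) * F * (MvPolynomial.C (14850 * (1 + u)) * F ^ 2 +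
      MvPolynomial.C 25650 * Φ) = 0 := by
    simp only [map_sub, map_mul, map_add, map_one]
    linear_combination (-1 : Poly) * hT - MvPolynomial.C 25650 * MvPolynomial.C u * F * hΦ
  by_contra hne
  have hne' : (1 : ℂ) - u ≠ 0 := sub_ne_zero.2 (Ne.symm hne)
  have e1 := congrArg (MvPolynomial.eval fun i => (((![0, 0, 1] : Fin 3 → ℤ) i : ℤ) : ℂ)) key
  have e2 := congrArg (MvPolynomial.eval fun i => (((![1, 1, 0] : Fin 3 → ℤ) i : ℤ) : ℂ)) key
  simp only [map_mul, map_add, map_pow, MvPolynomial.eval_C, map_zero, F_eq, Φ_eq,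
    eval_poly_intCast] at e1 e2
  rw [show ev (RingHom.id ℤ) ![0, 0, 1] lF = 27 by decide +kernel,
    show ev (RingHom.id ℤ) ![0, 0, 1] lΦ = 729 by decide +kernel] at e1
  rw [show ev (RingHom.id ℤ) ![1, 1, 0] lF = 10 by decide +kernel,
    show ev (RingHom.id ℤ) ![1, 1, 0] lΦ = -26 by decide +kernel] at e2
  push_cast at e1 e2
  have f1 := (mul_eq_zero.1 e1).resolve_left (mul_ne_zero hne' (by norm_num))
  have f2 := (mul_eq_zero.1 e2).resolve_left (mul_ne_zero hne' (by norm_num))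
  have : (0 : ℂ) = 1 := by linear_combination (-100 / 729 * f1 + f2) / (25650 * 126)
  exact zero_ne_one this

theorem lin_Φ (h : lin M F = F) : lin M Φ = Φ := by
  have := Φ_covariant h
  rw [det_sq_eq_one h, map_one, one_mul] at this
  exact this.symm

theorem lin_Ψ (h : lin M F = F) : lin M Ψ = Ψ := by
  have hv : grad Φ ⬝ᵥ (hess F).adjugate.mulVec (grad Φ) =
      lin M (grad Φ ⬝ᵥ (hess F).adjugate.mulVec (grad Φ)) := by
    conv_lhs => rw [← h, ← lin_Φ h, hess_lin, grad_lin, dotProduct_adjugate_congr, det_cmat,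
      ← map_pow, det_sq_eq_one h, map_one, one_mul, lin_adjugate]
    simp only [dotProduct, Matrix.mulVec, Matrix.map_apply, map_sum, map_mul]
  rw [Ψ, det_bordered_adjugate, map_mul, lin_C, map_neg, ← hv]

theorem X45_covariant (h : lin M F = F) : X45 = MvPolynomial.C M.det * lin M X45 := by
  have h1 : Matrix.of ![grad F, grad Φ, grad Ψ] =
      (Matrix.of ![grad F, grad Φ, grad Ψ]).map (lin M) * cmat M := by
    have hg : ∀ q, lin M q = q → ∀ j, grad q j = ∑ k, lin M (grad q k) * cmat M k j := by
      intro q hq j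
      conv_lhs => rw [← hq, grad_lin]
      simp only [Matrix.mulVec, dotProduct, Matrix.transpose_apply, mul_comm]
    ext1 i j
    rw [Matrix.mul_apply]
    fin_cases i
    · exact hg F h j
    · exact hg Φ (lin_Φ h) j
    · exact hg Ψ (lin_Ψ h) j
  rw [X45, map_mul, lin_C]
  conv_lhs => rw [h1, Matrix.det_mul, det_cmat, ← AlgHom.mapMatrix_apply, ← AlgHom.map_det]
  ring

theorem cross_grad_covariant {p q : Poly} (hp : lin M p = p) (hq : lin M q = q) :
    (cmat M).mulVec (crossProduct (grad p) (grad q)) =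
      fun i => MvPolynomial.C M.det * lin M (crossProduct (grad p) (grad q) i) := by
  conv_lhs => rw [← hp, ← hq, grad_lin, grad_lin, crossProduct_mulVec, Matrix.mulVec_mulVec,
    Matrix.mul_adjugate, det_cmat, Matrix.smul_mulVec, Matrix.one_mulVec]
  ext1 i
  rw [lin_crossProduct]
  rfl

theorem f64_covariant (h : lin M F = F) :
    (cmat M).mulVec f64 = fun i => MvPolynomial.C M.det * lin M (f64 i) := by
  have hΦ := lin_Φ h
  have hΨ := lin_Ψ h
  ext1 i
  have h1 := congrFun (cross_grad_covariant h hΦ) i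
  have h2 := congrFun (cross_grad_covariant h hΨ) i
  have h3 := congrFun (cross_grad_covariant hΦ hΨ) i
  simp only [Matrix.mulVec, dotProduct, Fin.sum_univ_three] at h1 h2 h3 ⊢
  simp only [f64, ψ16, φ34, f40, map_add, map_sub, map_mul, map_pow, h, hΦ, hΨ, map_ofNat]
  linear_combination (10 * F ^ 6 * Φ + 100 * F ^ 4 * Φ ^ 2 + 454 * F ^ 2 * Φ ^ 3 + 156 * Φ ^ 4
      + 39 * F ^ 3 * Ψ + 51 * F * Φ * Ψ) * h1 - 27 * Ψ * h2 + 54 * Φ ^ 2 * h3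

/-- The quotient of degree 19 commutes with each linear map that preserves `F`. -/
theorem lin_lf19 (h : lin M F = F) (i : Fin 3) :
    lin M (poly (lf19 i)) = (cmat M).mulVec (fun j => poly (lf19 j)) i := by
  have h1 := congrFun (f64_covariant h) i
  have h2 : f64 = X45 • fun j => poly (lf19 j) := funext fun j => (X45_mul_lf19 j).symm
  rw [h2, Matrix.mulVec_smul, Pi.smul_apply, Pi.smul_apply, smul_eq_mul, smul_eq_mul, map_mul,
    ← mul_assoc, ← X45_covariant h] at h1
  exact (mul_left_cancel₀ X45_ne_zero h1).symm

theorem lin_X (M : Matrix (Fin 3) (Fin 3) ℂ) (i : Fin 3) :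
    lin M (MvPolynomial.X i) = (cmat M).mulVec MvPolynomial.X i := by
  simp [lin, Matrix.mulVec, dotProduct]

/-- The explicit map of degree 19 commutes with each linear map that preserves `F`. -/
theorem lin_hExplicit (h : lin M F = F) (i : Fin 3) :
    lin M (hExplicit i) = (cmat M).mulVec hExplicit i := by
  have h1 : ∀ j, MvPolynomial.C 810 * hExplicit j =
      poly (lf19 j) + MvPolynomial.C 1620 * F ^ 3 * MvPolynomial.X j := by
    intro j
    rw [lf19_eq]
    ring
  have h2 : (MvPolynomial.C (810 : ℂ) : Poly) ≠ 0 := by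
    rw [Ne, MvPolynomial.C_eq_zero]
    norm_num
  apply mul_left_cancel₀ h2
  have h3 := lin_lf19 h i
  have h4 := lin_X M i
  rw [← lin_C M, ← map_mul, h1, map_add, map_mul, map_mul, map_pow, lin_C, lin_C, h, h3, h4]
  simp only [Matrix.mulVec, dotProduct, Fin.sum_univ_three]
  linear_combination -(cmat M i 0) * h1 0 - (cmat M i 1) * h1 1 - (cmat M i 2) * h1 2

end Covariance

/-! ### Exact arithmetic in `ℤ[τ, ρ]` -/

/-- The ring `ℤ[τ, ρ]`, with decidable equality: `τ² = τ + 1` and `ρ² = -ρ - 1`. -/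
abbrev E : Type := QuadraticAlgebra (QuadraticAlgebra ℤ 1 1) (-1) (-1)

/-- The element `a + b τ + (c + d τ) ρ`. -/
abbrev e (a b c d : ℤ) : E := ⟨⟨a, b⟩, ⟨c, d⟩⟩

/-- Twice the generators of the group. -/
def eG : Fin 3 → Matrix (Fin 3) (Fin 3) E :=
  ![!![-2, 0, 0;
        0, 2, 0;
        0, 0, -2],
      !![1, e (-1) 1 0 0, e 0 (-1) 0 0;
        e (-1) 1 0 0, e 0 1 0 0, 1;
        e 0 1 0 0, -1, e (-1) 1 0 0],
      !![2, 0, 0;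
        0, 0, e (-2) 0 (-2) 0;
        0, e 0 0 (-2) 0, 0]]

/-- The two families of six quadratic forms (four times their Gram matrices) that the group
permutes up to scalars. -/
def eM : Fin 2 → Fin 6 → Matrix (Fin 3) (Fin 3) E :=
  ![![!![4, 0, 0;
        0, 4, 0;
        0, 0, 4],
      !![4, 0, 0;
        0, e (-4) 0 (-4) 0, 0;
        0, 0, e 0 0 4 0],
      !![e (-1) 1 (-1) 2, e (-2) 1 (-1) (-1), e 1 (-2) 2 (-1);
        e (-2) 1 (-1) (-1), e 1 (-2) 0 (-1), e (-1) (-1) 1 (-2);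
        e 1 (-2) 2 (-1), e (-1) (-1) 1 (-2), e 0 1 1 (-1)],
      !![e (-1) 1 (-1) 2, e 2 (-1) 1 1, e 1 (-2) 2 (-1);
        e 2 (-1) 1 1, e 1 (-2) 0 (-1), e 1 1 (-1) 2;
        e 1 (-2) 2 (-1), e 1 1 (-1) 2, e 0 1 1 (-1)],
      !![e (-1) 1 (-1) 2, e 2 (-1) 1 1, e (-1) 2 (-2) 1;
        e 2 (-1) 1 1, e 1 (-2) 0 (-1), e (-1) (-1) 1 (-2);
        e (-1) 2 (-2) 1, e (-1) (-1) 1 (-2), e 0 1 1 (-1)],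
      !![e (-1) 1 (-1) 2, e (-2) 1 (-1) (-1), e (-1) 2 (-2) 1;
        e (-2) 1 (-1) (-1), e 1 (-2) 0 (-1), e 1 1 (-1) 2;
        e (-1) 2 (-2) 1, e 1 1 (-1) 2, e 0 1 1 (-1)]],
    ![!![e (-1) 2 (-1) 1, e 2 (-3) 1 0, 0;
        e 2 (-3) 1 0, e 1 (-1) 0 1, 0;
        0, 0, 4],
      !![e (-1) 2 (-1) 1, e (-2) 3 (-1) 0, 0;
        e (-2) 3 (-1) 0, e 1 (-1) 0 1, 0;
        0, 0, 4],
      !![4, 0, 0;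
        0, e (-1) 2 (-1) 1, e (-2) 3 (-1) 0;
        0, e (-2) 3 (-1) 0, e 1 (-1) 0 1],
      !![e (-1) 2 (-1) 1, 0, e 1 (-3) 2 (-3);
        0, e (-4) 0 (-4) 0, 0;
        e 1 (-3) 2 (-3), 0, e 0 (-1) 1 (-2)],
      !![e (-1) 2 (-1) 1, 0, e (-1) 3 (-2) 3;
        0, e (-4) 0 (-4) 0, 0;
        e (-1) 3 (-2) 3, 0, e 0 (-1) 1 (-2)],
      !![4, 0, 0;
        0, e (-1) 2 (-1) 1, e 2 (-3) 1 0;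
        0, e 2 (-3) 1 0, e 1 (-1) 0 1]]]

/-- Twice the matrix `B` such that `x ↦ B (conj x)` is complex conjugation in the coordinates `y`,
up to a scalar. -/
def eB : Matrix (Fin 3) (Fin 3) E :=
  !![e 0 1 (-1) 1, e 1 (-1) 1 0, 0;
     e 1 (-1) 1 0, e 1 0 0 1, 0;
     0, 0, -2]

/-- The permutation with the given values and the given values of the inverse. -/
def permOf (f g : Fin 6 → Fin 6) (h : (∀ i, g (f i) = i) ∧ ∀ i, f (g i) = i) :
    Equiv.Perm (Fin 6) := ⟨f, g, h.1, h.2⟩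

/-- The permutations by which the generators act on the two families. -/
def gen : Fin 3 → Fin 2 → Equiv.Perm (Fin 6) :=
  ![![permOf ![0, 1, 3, 2, 5, 4] ![0, 1, 3, 2, 5, 4] (by decide),
      permOf ![1, 0, 5, 3, 4, 2] ![1, 0, 5, 3, 4, 2] (by decide)],
    ![permOf ![0, 5, 1, 2, 3, 4] ![0, 2, 3, 4, 5, 1] (by decide),
      permOf ![0, 2, 3, 4, 5, 1] ![0, 5, 1, 2, 3, 4] (by decide)],
    ![permOf ![1, 0, 5, 2, 3, 4] ![1, 0, 3, 4, 5, 2] (by decide),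
      permOf ![3, 4, 5, 1, 0, 2] ![4, 3, 5, 0, 1, 2] (by decide)]]

/-- The generators permute the quadratic forms of each family up to cube roots of unity. -/
theorem eM_eG (a : Fin 3) (k : Fin 2) (i : Fin 6) :
    ∃ j : Fin 3, (eG a)ᵀ * eM k (gen a k i) * eG a = (4 * (e 0 0 1 0) ^ (j : ℕ)) • eM k i := by
  revert a k i
  decide +kernel

/-- The ring homomorphism from a quadratic algebra that extends `f` and sends the generator to
`u`. -/
def liftQ {R S : Type*} [CommRing R] [CommRing S] {a b : R} (f : R →+* S) (u : S)
    (h : u * u = f a + f b * u) : QuadraticAlgebra R a b →+* S where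
  toFun z := f z.re + f z.im * u
  map_one' := by
    change f 1 + f 0 * u = 1
    simp
  map_zero' := by
    change f 0 + f 0 * u = 0
    simp
  map_add' x y := by simp; ring
  map_mul' x y := by
    simp only [QuadraticAlgebra.re_mul, QuadraticAlgebra.im_mul, map_add, map_mul]
    linear_combination (-(f x.im) * f y.im) * h

/-- The ring homomorphism from `ℤ[τ, ρ]` with given images of `τ` and `ρ`. -/
def liftE {S : Type*} [CommRing S] (t r : S) (ht : t * t = t + 1) (hr : r * r = -r - 1) : E →+* S :=
  liftQ (liftQ (Int.castRingHom S) t (by simp [ht, add_comm])) r (by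
    rw [hr, map_neg, map_one]; ring)

theorem liftE_apply {S : Type*} [CommRing S] (t r : S) (ht : t * t = t + 1)
    (hr : r * r = -r - 1) (z : E) :
    liftE t r ht hr z = z.re.re + z.re.im * t + (z.im.re + z.im.im * t) * r := rfl

theorem rho_ne_one : ρ ≠ 1 := by
  intro h
  rw [ρ, Complex.exp_eq_one_iff] at h
  obtain ⟨n, hn⟩ := h
  have h2 : (2 * Real.pi * Complex.I : ℂ) ≠ 0 := Complex.two_pi_I_ne_zero
  have h3 : (1 : ℂ) = 3 * n := by
    apply mul_left_cancel₀ h2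
    linear_combination 3 * hn
  have h4 : (1 : ℤ) = 3 * n := by exact_mod_cast h3
  omega

theorem rho_mul_self : ρ * ρ = -ρ - 1 := by
  have h : (ρ - 1) * (ρ * ρ + ρ + 1) = 0 := by linear_combination rho_cube
  linear_combination (mul_eq_zero.1 h).resolve_left (sub_ne_zero.2 rho_ne_one)

theorem tau_mul_self : τ * τ = τ + 1 := by rw [← pow_two, tau_sq]

theorem conj_tau : conj τ = τ := Complex.conj_ofReal _

theorem conj_rho : conj ρ = -1 - ρ := by
  have h : conj ρ * ρ = 1 := by
    rw [ρ, ← Complex.exp_conj, ← Complex.exp_add, Complex.exp_eq_one_iff]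
    refine ⟨0, ?_⟩
    simp only [map_div₀, map_mul, Complex.conj_ofNat, Complex.conj_ofReal, Complex.conj_I]
    push_cast
    ring
  have h2 := rho_cube
  have h3 := rho_mul_self
  linear_combination ρ ^ 2 * h - conj ρ * h2 + h3

/-- The inclusion of `ℤ[τ, ρ]` into the complex numbers. -/
noncomputable def toC : E →+* ℂ := liftE τ ρ tau_mul_self rho_mul_self

theorem toC_e (a b c d : ℤ) : toC (e a b c d) = a + b * τ + (c + d * τ) * ρ := rfl

/-- Complex conjugation on `ℤ[τ, ρ]`. -/
def conjE : E →+* E := liftE (e 0 1 0 0) (e (-1) 0 (-1) 0) (by decide) (by decide)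

theorem conj_toC (z : E) : conj (toC z) = toC (conjE z) := by
  obtain ⟨⟨a, b⟩, ⟨c, d⟩⟩ := z
  have h : conjE (e a b c d) = e (a - c) (b - d) (-c) (-d) := by
    rw [conjE, liftE_apply]
    ext <;> simp <;> ring
  rw [h, toC_e, toC_e]
  simp only [map_add, map_mul, conj_tau, conj_rho, map_intCast]
  push_cast
  ring

theorem goldenRatio_combination {a b : ℤ} (h : (a : ℂ) + b * τ = 0) : a = 0 ∧ b = 0 := by
  have h1 : (a : ℝ) + b * Real.goldenRatio = 0 := by
    unfold τ at h
    exact_mod_cast h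
  have hb : b = 0 := by
    by_contra hb
    apply Real.goldenRatio_irrational
    refine ⟨-a / b, ?_⟩
    have : (b : ℝ) ≠ 0 := Int.cast_ne_zero.2 hb
    push_cast
    rw [div_eq_iff this]
    linear_combination -h1
  subst hb
  simpa using h1

theorem toC_injective : Function.Injective toC := by
  rw [injective_iff_map_eq_zero]
  rintro ⟨⟨a, b⟩, ⟨c, d⟩⟩ h
  have h2 := congrArg conj h
  rw [toC_e] at h
  change conj (toC (e a b c d)) = _ at h2
  rw [toC_e] at h2
  simp only [map_add, map_mul, conj_tau, conj_rho, map_intCast, map_zero] at h2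
  have h3 : ((c : ℂ) + d * τ) * (2 * ρ + 1) = 0 := by linear_combination h - h2
  have h4 : 2 * ρ + 1 ≠ 0 := by
    intro h4
    have : (3 : ℂ) = 0 := by linear_combination (4 : ℂ) * rho_mul_self - (2 * ρ + 1) * h4
    norm_num at this
  have h5 := (mul_eq_zero.1 h3).resolve_right h4
  rw [h5, zero_mul, add_zero] at h
  obtain ⟨rfl, rfl⟩ := goldenRatio_combination h
  obtain ⟨rfl, rfl⟩ := goldenRatio_combination h5
  rfl

theorem toC_ne_zero {z : E} (h : z ≠ 0) : toC z ≠ 0 := (map_ne_zero_iff _ toC_injective).2 h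

/-- The Gram matrices of the two families. -/
noncomputable def fam (k : Fin 2) (i : Fin 6) : Matrix (Fin 3) (Fin 3) ℂ := (eM k i).map toC

/-- The generators of the group, as matrices. -/
noncomputable def matG : Fin 3 → Matrix (Fin 3) (Fin 3) ℂ := ![matZ, matP, matQ]

@[simp] theorem toC_two : toC 2 = 2 := map_ofNat toC 2

theorem eG_map (a : Fin 3) : (eG a).map toC = (2 : ℂ) • matG a := by
  have h := tau_inv
  have hr := rho_mul_self
  fin_cases a
  · ext i j
    fin_cases i <;> fin_cases j <;> simp [eG, matG, matZ]
  · ext i j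
    fin_cases i <;> fin_cases j <;> simp [eG, matG, matP, h, toC_e] <;> ring
  · ext i j
    fin_cases i <;> fin_cases j <;> simp [eG, matG, matQ, toC_e, pow_two, hr] <;> ring

/-! ### The change of coordinates -/

/-- The number `(-3 - √-15) / 2`. -/
noncomputable def β : ℂ := toC (e (-1) (-1) 1 (-2))

/-- A square root of `-(τ + 2)`. -/
noncomputable def σ : ℂ := Complex.I * (Real.sqrt (Real.goldenRatio + 2) : ℂ)

theorem beta_ne_zero : β ≠ 0 := toC_ne_zero (by decide)

theorem conj_beta : conj β = -3 - β := by
  rw [β, conj_toC, ← map_ofNat toC 3, ← map_neg, ← map_sub]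
  exact congrArg toC (by decide)

theorem goldenRatio_add_two_pos : 0 < Real.goldenRatio + 2 := by
  linarith [Real.goldenRatio_pos]

theorem sigma_sq : σ ^ 2 = -(τ + 2) := by
  have h : ((Real.sqrt (Real.goldenRatio + 2) : ℂ)) ^ 2 = τ + 2 := by
    unfold τ
    exact_mod_cast Real.sq_sqrt goldenRatio_add_two_pos.le
  rw [σ, mul_pow, h, Complex.I_sq]
  ring

theorem tau_add_two_ne_zero : τ + 2 ≠ 0 := by
  unfold τ
  exact_mod_cast goldenRatio_add_two_pos.ne'

theorem sigma_ne_zero : σ ≠ 0 := by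
  intro h
  have := sigma_sq
  rw [h] at this
  exact tau_add_two_ne_zero (by linear_combination this)

theorem conj_sigma : conj σ = -σ := by
  simp [σ]

/-- The matrix of a change of coordinates `x = A y` to bub-coordinates. -/
noncomputable def matA : Matrix (Fin 3) (Fin 3) ℂ :=
  !![-τ, -τ, β; 1, 1, β * τ; σ, -σ, 0]

theorem det_matA : matA.det = -(2 * σ * β * (τ + 2)) := by
  rw [matA, Matrix.det_fin_three]
  simp only [Matrix.of_apply, Matrix.cons_val', Matrix.cons_val_zero, Matrix.cons_val_one,
    Matrix.cons_val]
  linear_combination -2 * σ * β * tau_sq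

/-- The change of coordinates `x = A y` to bub-coordinates. -/
noncomputable def glA : GL (Fin 3) ℂ := Matrix.GeneralLinearGroup.mkOfDetNeZero matA (by
  rw [det_matA]
  exact neg_ne_zero.2 (mul_ne_zero
    (mul_ne_zero (mul_ne_zero two_ne_zero sigma_ne_zero) beta_ne_zero) tau_add_two_ne_zero))

@[simp] theorem coe_glA : (glA : Matrix (Fin 3) (Fin 3) ℂ) = matA := rfl

/-- In the new coordinates, the first conic is `4 y₁ y₂ + β² y₃² = 0`. -/
theorem matA_transpose_mul_self :
    matAᵀ * matA = (τ + 2) • !![0, 2, 0; 2, 0, 0; 0, 0, β ^ 2] := by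
  ext i j
  fin_cases i <;> fin_cases j <;>
    simp [matA, Matrix.mul_apply, Fin.sum_univ_three]
  · linear_combination tau_sq + sigma_sq
  · linear_combination tau_sq - sigma_sq
  · ring
  · linear_combination tau_sq - sigma_sq
  · linear_combination tau_sq + sigma_sq
  · ring
  · linear_combination β ^ 2 * tau_sq

theorem eB_mul_conj_matA :
    eB.map toC * matA.map conj = (2 : ℂ) • matA := by
  have ht := tau_mul_self
  have hr := rho_mul_self
  have ht' : τ = toC (e 0 1 0 0) := by simp [toC_e]
  have h1 : toC (e 0 1 (-1) 1) * conj β + toC (e 1 (-1) 1 0) * (conj β * τ) = toC 2 * β := by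
    rw [β, conj_toC, ht']
    simp only [← map_mul, ← map_add]
    exact congrArg toC (by decide)
  have h2 : toC (e 1 (-1) 1 0) * conj β + toC (e 1 0 0 1) * (conj β * τ) = toC 2 * (β * τ) := by
    rw [β, conj_toC, ht']
    simp only [← map_mul, ← map_add]
    exact congrArg toC (by decide)
  simp only [toC_e, conj_beta] at h1 h2
  ext i j
  fin_cases i <;> fin_cases j <;>
    simp [matA, eB, Matrix.mul_apply, Fin.sum_univ_three, toC_e, conj_tau, conj_beta,
      conj_sigma] at h1 h2 ⊢
  · linear_combination (-1 - ρ) * ht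
  · linear_combination (-1 - ρ) * ht
  · linear_combination h1
  · linear_combination ht
  · linear_combination ht
  · linear_combination h2

/-! ### The action on the twelve quadratic forms -/

/-- The matrix `g` carries the forms with the Gram matrices `N i` to each other, up to scalars,
along the permutation `s`. -/
def Scales (N : Fin 6 → Matrix (Fin 3) (Fin 3) ℂ) (g : Matrix (Fin 3) (Fin 3) ℂ)
    (s : Equiv.Perm (Fin 6)) : Prop :=
  ∀ i, ∃ c : ℂ, c ≠ 0 ∧ gᵀ * N (s i) * g = c • N i

section Scales

variable {N : Fin 6 → Matrix (Fin 3) (Fin 3) ℂ} {g h : Matrix (Fin 3) (Fin 3) ℂ}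
  {s t : Equiv.Perm (Fin 6)}

theorem Scales.one : Scales N 1 1 := fun i => ⟨1, one_ne_zero, by simp⟩

theorem Scales.mul (hg : Scales N g s) (hh : Scales N h t) : Scales N (g * h) (s * t) := by
  intro i
  obtain ⟨c, hc, h1⟩ := hg (t i)
  obtain ⟨d, hd, h2⟩ := hh i
  refine ⟨c * d, mul_ne_zero hc hd, ?_⟩
  calc (g * h)ᵀ * N ((s * t) i) * (g * h) = hᵀ * (gᵀ * N (s (t i)) * g) * h := by
        simp only [Matrix.transpose_mul, Matrix.mul_assoc, Equiv.Perm.mul_apply]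
    _ = (c * d) • N i := by
        rw [h1, Matrix.mul_smul, Matrix.smul_mul, h2, smul_smul]

theorem Scales.of_mul_eq_smul_one {c : ℂ} (hc : c ≠ 0) (hh : h * g = c • 1) (hg : Scales N h s) :
    Scales N g s⁻¹ := by
  intro i
  obtain ⟨d, hd, h1⟩ := hg (s⁻¹ i)
  rw [Equiv.Perm.coe_inv, Equiv.apply_symm_apply, ← Equiv.Perm.coe_inv] at h1
  refine ⟨d⁻¹ * c ^ 2, mul_ne_zero (inv_ne_zero hd) (pow_ne_zero 2 hc), ?_⟩
  have hh' : gᵀ * hᵀ = c • 1 := by rw [← Matrix.transpose_mul, hh]; simp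
  calc gᵀ * N (s⁻¹ i) * g = d⁻¹ • (gᵀ * (d • N (s⁻¹ i)) * g) := by
        rw [Matrix.mul_smul, Matrix.smul_mul, smul_smul, inv_mul_cancel₀ hd, one_smul]
    _ = d⁻¹ • ((gᵀ * hᵀ) * N i * (h * g)) := by
        rw [← h1]; simp only [Matrix.mul_assoc]
    _ = (d⁻¹ * c ^ 2) • N i := by
        rw [hh, hh']
        simp only [Matrix.smul_mul, Matrix.mul_smul, Matrix.one_mul, Matrix.mul_one, smul_smul]
        ring_nf

theorem Scales.smul {c : ℂ} (hc : c ≠ 0) (hg : Scales N g s) : Scales N (c • g) s := by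
  intro i
  obtain ⟨d, hd, h1⟩ := hg i
  refine ⟨c * (c * d), mul_ne_zero hc (mul_ne_zero hc hd), ?_⟩
  rw [Matrix.transpose_smul, Matrix.smul_mul, Matrix.smul_mul, Matrix.mul_smul, h1, smul_smul,
    smul_smul, mul_assoc]

end Scales

theorem eM_not_proportional (k l : Fin 2) (i j : Fin 6) (h : (k, i) ≠ (l, j)) :
    ∃ p q p' q' : Fin 3, eM k i p q * eM l j p' q' - eM k i p' q' * eM l j p q ≠ 0 := by
  revert k l i j
  decide +kernel

/-- The twelve forms are pairwise not proportional. -/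
theorem fam_eq_of_eq_smul {k l : Fin 2} {i j : Fin 6} {c : ℂ} (h : fam k i = c • fam l j) :
    (k, i) = (l, j) := by
  by_contra hij
  obtain ⟨p, q, p', q', h1⟩ := eM_not_proportional k l i j hij
  apply toC_ne_zero h1
  have h2 := fun p q => congrFun (congrFun h p) q
  simp only [fam, Matrix.map_apply, Matrix.smul_apply, smul_eq_mul] at h2
  rw [map_sub, map_mul, map_mul, h2 p q, h2 p' q']
  ring

/-- The permutation along which an invertible matrix moves the forms of a family is unique. -/
theorem Scales.perm_unique {k : Fin 2} {g : Matrix (Fin 3) (Fin 3) ℂ} (hu : IsUnit g)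
    {s t : Equiv.Perm (Fin 6)} (hs : Scales (fam k) g s) (ht : Scales (fam k) g t) : s = t := by
  ext i : 1
  obtain ⟨c, hc, h1⟩ := hs i
  obtain ⟨d, hd, h2⟩ := ht i
  suffices h : fam k (s i) = (c * d⁻¹) • fam k (t i) from congrArg Prod.snd (fam_eq_of_eq_smul h)
  have hu' : IsUnit gᵀ := (Matrix.isUnit_transpose g).2 hu
  apply hu.mul_right_cancel
  apply hu'.mul_left_cancel
  rw [← Matrix.mul_assoc, h1, Matrix.smul_mul, Matrix.mul_smul, ← Matrix.mul_assoc, h2, smul_smul,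
    mul_assoc, inv_mul_cancel₀ hd, mul_one]

theorem map_toC_mul (M N : Matrix (Fin 3) (Fin 3) E) :
    (M * N).map toC = M.map toC * N.map toC := Matrix.map_mul

theorem map_toC_smul (c : E) (M : Matrix (Fin 3) (Fin 3) E) :
    (c • M).map toC = toC c • M.map toC := by
  ext i j
  simp

theorem scales_matG (a : Fin 3) (k : Fin 2) : Scales (fam k) (matG a) (gen a k) := by
  intro i
  obtain ⟨j, hj⟩ := eM_eG a k i
  have h1 := congrArg (fun M => M.map toC) hj
  simp only [map_toC_mul, map_toC_smul, Matrix.transpose_map, eG_map] at h1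
  refine ⟨toC (e 0 0 1 0 ^ (j : ℕ)), ?_, ?_⟩
  · rw [map_pow]
    exact pow_ne_zero _ (toC_ne_zero (by decide))
  · have h4 : (4 : ℂ) ≠ 0 := by norm_num
    rw [Matrix.transpose_smul, Matrix.smul_mul, Matrix.smul_mul, Matrix.mul_smul, smul_smul,
      map_mul, show toC 4 = 4 from map_ofNat toC 4, show (2 : ℂ) * 2 = 4 by norm_num,
      mul_smul] at h1
    exact smul_right_injective _ h4 h1

/-- A matrix that scales each of the six forms of the first family is a scalar matrix. -/
theorem Scales.eq_smul_one {g : Matrix (Fin 3) (Fin 3) ℂ} (h : Scales (fam 0) g 1) :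
    ∃ c : ℂ, g = c • 1 := by
  choose c hc h using h
  simp only [Equiv.Perm.one_apply] at h
  have h0 : gᵀ * g = c 0 • 1 := by
    have := h 0
    have h1 : fam 0 0 = (4 : ℂ) • 1 := by
      ext i j
      fin_cases i <;> fin_cases j <;> simp [fam, eM, show toC 4 = 4 from map_ofNat toC 4]
    rw [h1, Matrix.mul_smul, Matrix.smul_mul, Matrix.mul_one, smul_comm] at this
    exact smul_right_injective _ (by norm_num : (4 : ℂ) ≠ 0) this
  have hg : g * gᵀ = c 0 • 1 := by
    have h1 : ((c 0)⁻¹ • gᵀ) * g = 1 := by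
      rw [Matrix.smul_mul, h0, smul_smul, inv_mul_cancel₀ (hc 0), one_smul]
    have h2 := mul_eq_one_comm.1 h1
    rw [Matrix.mul_smul] at h2
    rw [← h2, smul_smul, mul_inv_cancel₀ (hc 0), one_smul]
  have hN (i) : c 0 • (fam 0 i * g) = c i • (g * fam 0 i) := by
    rw [← Matrix.mul_smul g, ← h i, ← Matrix.mul_assoc, ← Matrix.mul_assoc, hg]
    simp
  -- The trace of the product of two forms and the determinant show that the ratios are trivial.
  have htr (i j) (hij : (eM 0 i * eM 0 j).trace ≠ 0) : c 0 ^ 2 = c i * c j := by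
    have h1 : gᵀ * fam 0 i * g * (gᵀ * fam 0 j * g) = (c i * c j) • (fam 0 i * fam 0 j) := by
      rw [h, h, Matrix.smul_mul, Matrix.mul_smul, smul_smul]
    have h2 : (gᵀ * fam 0 i * g * (gᵀ * fam 0 j * g)).trace =
        c 0 ^ 2 * (fam 0 i * fam 0 j).trace := by
      have : gᵀ * fam 0 i * g * (gᵀ * fam 0 j * g) =
          gᵀ * (fam 0 i * (g * gᵀ) * fam 0 j * g) := by simp only [Matrix.mul_assoc]
      rw [this, Matrix.trace_mul_comm, hg]
      simp only [Matrix.mul_assoc, hg, Matrix.mul_smul, Matrix.smul_mul, Matrix.mul_one,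
        Matrix.trace_smul, smul_eq_mul]
      ring
    rw [h1, Matrix.trace_smul, smul_eq_mul] at h2
    have h3 : (fam 0 i * fam 0 j).trace ≠ 0 := by
      have := toC_ne_zero hij
      rwa [fam, fam, ← map_toC_mul, show ((eM 0 i * eM 0 j).map toC).trace = _ from
        (AddMonoidHom.map_trace toC.toAddMonoidHom _).symm]
    exact (mul_right_cancel₀ h3 h2).symm
  have hdet (i) (hi : (eM 0 i).det ≠ 0) : c i ^ 3 = c 0 ^ 3 := by
    have h1 := congrArg Matrix.det (h i)
    have h2 := congrArg Matrix.det h0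
    simp only [Matrix.det_mul, Matrix.det_transpose, Matrix.det_smul, Fintype.card_fin,
      Matrix.det_one] at h1 h2
    have h3 : (fam 0 i).det ≠ 0 := by
      have := toC_ne_zero hi
      rwa [RingHom.map_det] at this
    apply mul_right_cancel₀ h3
    linear_combination -h1 + (fam 0 i).det * h2
  have h12 := htr 1 2 (by decide +kernel)
  have h13 := htr 1 3 (by decide +kernel)
  have h23 := htr 2 3 (by decide +kernel)
  have e12 : c 1 = c 2 := mul_right_cancel₀ (hc 3) (h13.symm.trans h23)
  have e1 : c 1 = c 0 := by
    have h3 := hdet 1 (by decide +kernel)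
    rw [← e12] at h12
    apply mul_left_cancel₀ (pow_ne_zero 2 (hc 0))
    linear_combination c 1 * h12 + h3
  have comm1 : fam 0 1 * g = g * fam 0 1 := by
    have := hN 1
    rw [e1] at this
    exact smul_right_injective _ (hc 0) this
  have comm2 : fam 0 2 * g = g * fam 0 2 := by
    have := hN 2
    rw [← e12, e1] at this
    exact smul_right_injective _ (hc 0) this
  have hdiag : ∀ i j : Fin 3, i ≠ j → g i j = 0 := by
    intro i j hij
    have h1 := congrFun (congrFun comm1 i) j
    have h2 : ∀ i j : Fin 3, i ≠ j → eM 0 1 i i - eM 0 1 j j ≠ 0 := by decide +kernel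
    have h3 := toC_ne_zero (h2 i j hij)
    have h4 : fam 0 1 = Matrix.diagonal fun i => toC (eM 0 1 i i) := by
      ext i j
      fin_cases i <;> fin_cases j <;> simp [fam, eM]
    rw [h4, Matrix.diagonal_mul, Matrix.mul_diagonal] at h1
    rw [map_sub] at h3
    apply mul_left_cancel₀ h3
    linear_combination h1
  have hscal : ∀ j : Fin 3, g j j = g 0 0 := by
    intro j
    have h1 := congrFun (congrFun comm2 0) j
    have h2 : ∀ j : Fin 3, eM 0 2 0 j ≠ 0 := by decide +kernel
    have h3 : fam 0 2 0 j ≠ 0 := toC_ne_zero (h2 j)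
    have h4 : g = Matrix.diagonal fun i => g i i := by
      ext i j
      by_cases hij : i = j
      · subst hij; simp
      · rw [Matrix.diagonal_apply_ne _ hij, hdiag i j hij]
    rw [h4, Matrix.diagonal_mul, Matrix.mul_diagonal] at h1
    apply mul_left_cancel₀ h3
    linear_combination h1
  refine ⟨g 0 0, ?_⟩
  ext i j
  by_cases hij : i = j
  · subst hij; simp [hscal]
  · simp [hij, hdiag i j hij]

/-! ### The generators act as the alternating group -/

theorem gen_sign (a : Fin 3) (k : Fin 2) : Equiv.Perm.sign (gen a k) = 1 := by
  revert a k
  decide +kernel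

/-- Powers of the five-cycle together with one element that moves its fixed point act
doubly transitively on the pairs that begin with this fixed point. -/
theorem exists_word_gen (k : Fin 2) (c d : Fin 6) (h : c ≠ d) :
    ∃ i m : Fin 5, ∃ n : Fin 2,
      (gen 1 k ^ (i : ℕ) * gen 2 k ^ (n : ℕ) * gen 1 k ^ (m : ℕ)) 0 = c ∧
      (gen 1 k ^ (i : ℕ) * gen 2 k ^ (n : ℕ) * gen 1 k ^ (m : ℕ)) 1 = d := by
  revert k c d
  decide +kernel

theorem closure_gen (k : Fin 2) :
    Subgroup.closure (Set.range fun a => gen a k) = alternatingGroup (Fin 6) := by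
  set G := Subgroup.closure (Set.range fun a => gen a k) with hG
  have hmem (a) : gen a k ∈ G := Subgroup.subset_closure ⟨a, rfl⟩
  apply le_antisymm
  · rw [hG, Subgroup.closure_le]
    rintro _ ⟨a, rfl⟩
    exact gen_sign a k
  have h2 : MulAction.IsMultiplyPretransitive G (Fin 6) 2 := by
    rw [MulAction.is_two_pretransitive_iff]
    have key (c d : Fin 6) (h : c ≠ d) : ∃ g : G, g • (0 : Fin 6) = c ∧ g • (1 : Fin 6) = d := by
      obtain ⟨i, m, n, h1, h2⟩ := exists_word_gen k c d h
      exact ⟨⟨_, G.mul_mem (G.mul_mem (G.pow_mem (hmem 1) i) (G.pow_mem (hmem 2) n))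
        (G.pow_mem (hmem 1) m)⟩, h1, h2⟩
    intro a b c d hab hcd
    obtain ⟨g, rfl, rfl⟩ := key a b hab
    obtain ⟨h, rfl, rfl⟩ := key c d hcd
    exact ⟨h * g⁻¹, by simp [mul_smul], by simp [mul_smul]⟩
  have h3 : (gen 0 k * gen 1 k).support.card = 3 ∨
      (gen 1 k * gen 1 k * gen 2 k).support.card = 3 := by
    clear_value G
    clear hG hmem h2 G
    revert k
    decide +kernel
  have hp := MulAction.isPreprimitive_of_is_two_pretransitive h2
  rcases h3 with h3 | h3
  · exact Equiv.Perm.alternatingGroup_le_of_isPreprimitive_of_isThreeCycle_mem hp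
      (card_support_eq_three_iff.1 h3) (G.mul_mem (hmem 0) (hmem 1))
  · exact Equiv.Perm.alternatingGroup_le_of_isPreprimitive_of_isThreeCycle_mem hp
      (card_support_eq_three_iff.1 h3)
      (G.mul_mem (G.mul_mem (hmem 1) (hmem 1)) (hmem 2))

/-! ### The isomorphisms with the alternating group -/

theorem det_matG (a : Fin 3) : (matG a).det = 1 := by
  fin_cases a
  · exact det_matZ
  · exact det_matP
  · exact det_matQ

/-- The generators of the group, as elements of the general linear group. -/
noncomputable def glG (a : Fin 3) : GL (Fin 3) ℂ :=
  Matrix.GeneralLinearGroup.mkOfDetNeZero (matG a) (by rw [det_matG]; exact one_ne_zero)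

@[simp] theorem coe_glG (a : Fin 3) : (glG a : Matrix (Fin 3) (Fin 3) ℂ) = matG a := rfl

theorem V_eq_closure : V = Subgroup.closure (Set.range fun a => mk (glG a)) := by
  unfold V
  congr 1
  ext p
  simp only [Set.mem_insert_iff, Set.mem_singleton_iff, Set.mem_range]
  constructor
  · rintro (rfl | rfl | rfl)
    · exact ⟨0, rfl⟩
    · exact ⟨1, rfl⟩
    · exact ⟨2, rfl⟩
  · rintro ⟨a, rfl⟩
    fin_cases a
    · exact Or.inl rfl
    · exact Or.inr (Or.inl rfl)
    · exact Or.inr (Or.inr rfl)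

theorem mk_glG_mem (a : Fin 3) : mk (glG a) ∈ V := by
  rw [V_eq_closure]
  exact Subgroup.subset_closure ⟨a, rfl⟩

theorem mk_eq_mk_iff_smul {g h : GL (Fin 3) ℂ} :
    mk g = mk h ↔ ∃ c : ℂ, c ≠ 0 ∧ (h : Matrix (Fin 3) (Fin 3) ℂ) = c • (g : Matrix _ _ ℂ) := by
  rw [Matrix.ProjGenLinGroup.mk_eq_mk_iff]
  constructor
  · rintro ⟨u, rfl⟩
    refine ⟨u, u.ne_zero, ?_⟩
    simp [Matrix.GeneralLinearGroup.coe_scalar, ← Matrix.smul_eq_mul_diagonal]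
  · rintro ⟨c, hc, h⟩
    refine ⟨Units.mk0 c hc, ?_⟩
    ext i j
    simp [h, mul_comm]

theorem exists_scales (k : Fin 2) (p : PGL(3, ℂ)) (hp : p ∈ V) :
    ∃ s : Equiv.Perm (Fin 6), ∀ g : GL (Fin 3) ℂ, mk g = p → Scales (fam k) g s := by
  have scal {g h : GL (Fin 3) ℂ} {s} (hg : Scales (fam k) g s) (hgh : mk g = mk h) :
      Scales (fam k) h s := by
    obtain ⟨c, hc, h1⟩ := mk_eq_mk_iff_smul.1 hgh
    rw [h1]
    exact hg.smul hc
  rw [V_eq_closure] at hp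
  induction hp using Subgroup.closure_induction with
  | mem p hp =>
    obtain ⟨a, rfl⟩ := hp
    exact ⟨gen a k, fun g hg => scal (g := glG a) (scales_matG a k) hg.symm⟩
  | one => exact ⟨1, fun g hg => scal (g := 1) Scales.one (by rw [hg]; rfl)⟩
  | mul p q _ _ hp hq =>
    obtain ⟨s, hs⟩ := hp
    obtain ⟨t, ht⟩ := hq
    refine ⟨s * t, fun g hg => ?_⟩
    obtain ⟨p', rfl⟩ := Matrix.ProjGenLinGroup.mk_surjective p
    obtain ⟨q', rfl⟩ := Matrix.ProjGenLinGroup.mk_surjective q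
    exact scal (g := p' * q') ((hs p' rfl).mul (ht q' rfl)) (by rw [hg, map_mul])
  | inv p _ hp =>
    obtain ⟨s, hs⟩ := hp
    refine ⟨s⁻¹, fun g hg => ?_⟩
    refine (hs g⁻¹ (by rw [map_inv, hg, inv_inv])).of_mul_eq_smul_one one_ne_zero ?_
    rw [one_smul, ← Units.val_mul, inv_mul_cancel, Units.val_one]

/-- The permutation of the six forms of a family that an element of the group induces. -/
noncomputable def permHom (k : Fin 2) : V →* Equiv.Perm (Fin 6) :=
  MonoidHom.mk' (fun p => (exists_scales k p p.2).choose) (by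
    rintro ⟨p, hp⟩ ⟨q, hq⟩
    obtain ⟨g, rfl⟩ := Matrix.ProjGenLinGroup.mk_surjective p
    obtain ⟨h, rfl⟩ := Matrix.ProjGenLinGroup.mk_surjective q
    refine Scales.perm_unique (k := k) (g * h).isUnit ?_ ?_
    · exact (exists_scales k _ (V.mul_mem hp hq)).choose_spec (g * h) (map_mul _ _ _)
    · exact ((exists_scales k _ hp).choose_spec g rfl).mul
        ((exists_scales k _ hq).choose_spec h rfl))

theorem scales_permHom (k : Fin 2) {g : GL (Fin 3) ℂ} (hg : mk g ∈ V) :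
    Scales (fam k) g (permHom k ⟨mk g, hg⟩) :=
  (exists_scales k _ hg).choose_spec g rfl

theorem permHom_eq {k : Fin 2} {g : GL (Fin 3) ℂ} (hg : mk g ∈ V) {s : Equiv.Perm (Fin 6)}
    (h : Scales (fam k) g s) : permHom k ⟨mk g, hg⟩ = s :=
  (scales_permHom k hg).perm_unique g.isUnit h

theorem permHom_glG (k : Fin 2) (a : Fin 3) : permHom k ⟨mk (glG a), mk_glG_mem a⟩ = gen a k :=
  permHom_eq _ (scales_matG a k)

theorem permHom_zero_injective : Function.Injective (permHom 0) := by
  rw [injective_iff_map_eq_one]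
  rintro ⟨p, hp⟩ h
  obtain ⟨g, rfl⟩ := Matrix.ProjGenLinGroup.mk_surjective p
  have h1 := scales_permHom 0 hp
  rw [h] at h1
  obtain ⟨c, hc⟩ := h1.eq_smul_one
  have hc0 : c ≠ 0 := by
    rintro rfl
    rw [zero_smul] at hc
    exact not_isUnit_zero (hc ▸ g.isUnit)
  have : mk 1 = mk g := mk_eq_mk_iff_smul.2 ⟨c, hc0, hc⟩
  ext1
  exact this.symm

theorem range_permHom (k : Fin 2) : (permHom k).range = alternatingGroup (Fin 6) := by
  rw [← closure_gen k, MonoidHom.range_eq_map]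
  have h1 : (⊤ : Subgroup V) =
      Subgroup.closure (Set.range fun a => ⟨mk (glG a), mk_glG_mem a⟩) := by
    have h2 : ∀ (W : Subgroup PGL(3, ℂ)) (s : Fin 3 → PGL(3, ℂ))
        (hW : W = Subgroup.closure (Set.range s)) (hs : ∀ a, s a ∈ W),
        (⊤ : Subgroup W) = Subgroup.closure (Set.range fun a => ⟨s a, hs a⟩) := by
      rintro W s rfl hs
      rw [← Subgroup.closure_closure_coe_preimage]
      congr 1
      ext ⟨x, hx⟩
      simp [Subtype.ext_iff]
    exact h2 V _ V_eq_closure mk_glG_mem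
  rw [h1, MonoidHom.map_closure, ← Set.range_comp]
  congr 2
  funext a
  exact permHom_glG k a

theorem natCard_V : Nat.card V = Nat.card (alternatingGroup (Fin 6)) := by
  rw [← range_permHom 0]
  exact Nat.card_congr (MonoidHom.ofInjective permHom_zero_injective).toEquiv

instance : Finite V := Finite.of_injective _ permHom_zero_injective

theorem permHom_injective (k : Fin 2) : Function.Injective (permHom k) := by
  have h : Function.Bijective (permHom k).rangeRestrict :=
    (Nat.bijective_iff_surjective_and_card _).2
      ⟨(permHom k).rangeRestrict_surjective, by rw [natCard_V, range_permHom]⟩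
  exact MonoidHom.rangeRestrict_injective_iff.1 h.1

/-- The isomorphism of the group with the alternating group, by the action on the six forms of a
family. -/
noncomputable def altEquiv (k : Fin 2) : V ≃* alternatingGroup (Fin 6) :=
  (MonoidHom.ofInjective (permHom_injective k)).trans (MulEquiv.subgroupCongr (range_permHom k))

@[simp] theorem coe_altEquiv (k : Fin 2) (p : V) :
    (altEquiv k p : Equiv.Perm (Fin 6)) = permHom k p := rfl

/-! ### Complex conjugation -/

theorem eB_eM (k : Fin 2) (i : Fin 6) :
    ∃ j : Fin 3, eBᵀ * eM (1 - k) i * eB = (4 * (e 0 0 1 0) ^ (j : ℕ)) • (eM k i).map conjE := by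
  revert k i
  decide +kernel

theorem eB_mul_conj : eB * eB.map conjE = (4 : E) • 1 := by
  decide +kernel

/-- Twice the matrix `B` such that `x ↦ B (conj x)` is complex conjugation in the coordinates
`y`. -/
noncomputable def matB : Matrix (Fin 3) (Fin 3) ℂ := eB.map toC

theorem map_conj_map_toC (M : Matrix (Fin 3) (Fin 3) E) :
    (M.map toC).map conj = (M.map conjE).map toC := by
  ext i j
  simp [conj_toC]

theorem map_conj_mul (M N : Matrix (Fin 3) (Fin 3) ℂ) :
    (M * N).map conj = M.map conj * N.map conj := Matrix.map_mul

theorem map_conj_smul (c : ℂ) (M : Matrix (Fin 3) (Fin 3) ℂ) :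
    (c • M).map conj = conj c • M.map conj := by
  ext i j
  simp

theorem map_conj_conj (M : Matrix (Fin 3) (Fin 3) ℂ) : (M.map conj).map conj = M := by
  ext i j
  simp

theorem toC_four : toC 4 = 4 := map_ofNat toC 4

theorem matB_mul_conj : matB * matB.map conj = (4 : ℂ) • 1 := by
  have h := congrArg (fun M => M.map toC) eB_mul_conj
  simp only [map_toC_mul, map_toC_smul, toC_four] at h
  rw [matB, map_conj_map_toC, h, Matrix.map_one _ (map_zero _) (map_one _)]

theorem isUnit_matB : IsUnit matB := by
  have h : matB * ((4 : ℂ)⁻¹ • matB.map conj) = 1 := by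
    rw [Matrix.mul_smul, matB_mul_conj, smul_smul, inv_mul_cancel₀ (by norm_num), one_smul]
  exact (Matrix.isUnit_iff_isUnit_det _).2 (Matrix.isUnit_det_of_right_inverse h)

/-- The matrix `matB` as an element of the general linear group. -/
noncomputable def glB : GL (Fin 3) ℂ := isUnit_matB.unit

@[simp] theorem coe_glB : (glB : Matrix (Fin 3) (Fin 3) ℂ) = matB := rfl

theorem coe_glB_inv :
    ((glB⁻¹ : GL (Fin 3) ℂ) : Matrix (Fin 3) (Fin 3) ℂ) = (4 : ℂ)⁻¹ • matB.map conj := by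
  apply isUnit_matB.mul_left_cancel
  rw [← coe_glB, ← Units.val_mul, mul_inv_cancel, Matrix.mul_smul, coe_glB, matB_mul_conj,
    smul_smul, inv_mul_cancel₀ (by norm_num), one_smul, Units.val_one]

theorem matB_fam (k : Fin 2) (i : Fin 6) :
    ∃ c : ℂ, c ≠ 0 ∧ matBᵀ * fam (1 - k) i * matB = c • (fam k i).map conj := by
  obtain ⟨j, hj⟩ := eB_eM k i
  refine ⟨toC (4 * (e 0 0 1 0) ^ (j : ℕ)), toC_ne_zero ?_, ?_⟩
  · clear hj
    revert j
    decide +kernel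
  · have h := congrArg (fun M => M.map toC) hj
    simp only [map_toC_mul, map_toC_smul, ← map_conj_map_toC] at h
    exact h

/-- The conjugate of `g` under the complex conjugation of the coordinates `y`. -/
noncomputable def conjGL (g : GL (Fin 3) ℂ) : GL (Fin 3) ℂ :=
  glB * Matrix.GeneralLinearGroup.map (starRingEnd ℂ) g * glB⁻¹

theorem coe_conjGL (g : GL (Fin 3) ℂ) : (conjGL g : Matrix (Fin 3) (Fin 3) ℂ) =
    (4 : ℂ)⁻¹ • (matB * (g : Matrix _ _ ℂ).map conj * matB.map conj) := by
  rw [conjGL, Units.val_mul, Units.val_mul, coe_glB_inv, Matrix.mul_smul]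
  rfl

theorem Scales.conj {k : Fin 2} {g : GL (Fin 3) ℂ} {s : Equiv.Perm (Fin 6)}
    (h : Scales (fam k) g s) : Scales (fam (1 - k)) (conjGL g) s := by
  rw [coe_conjGL]
  refine Scales.smul (by norm_num) ?_
  intro i
  obtain ⟨c, hc, h1⟩ := matB_fam k (s i)
  obtain ⟨d, hd, h2⟩ := h i
  obtain ⟨c', hc', h3⟩ := matB_fam (1 - k) i
  rw [sub_sub_cancel] at h3
  set G := (g : Matrix (Fin 3) (Fin 3) ℂ)
  have h2' := congrArg (fun M => M.map conj) h2
  have h3' := congrArg (fun M => M.map conj) h3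
  simp only [map_conj_mul, map_conj_smul, map_conj_conj] at h2' h3'
  refine ⟨c * (starRingEnd ℂ d * starRingEnd ℂ c'), mul_ne_zero hc (mul_ne_zero
    ((map_ne_zero _).2 hd) ((map_ne_zero _).2 hc')), ?_⟩
  calc (matB * G.map (starRingEnd ℂ) * matB.map (starRingEnd ℂ))ᵀ * fam (1 - k) (s i) *
        (matB * G.map (starRingEnd ℂ) * matB.map (starRingEnd ℂ))
      = (matB.map (starRingEnd ℂ))ᵀ * ((G.map (starRingEnd ℂ))ᵀ *
        (matBᵀ * fam (1 - k) (s i) * matB) * G.map (starRingEnd ℂ)) * matB.map (starRingEnd ℂ) := by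
        simp only [Matrix.transpose_mul, Matrix.mul_assoc]
    _ = _ := by
        rw [h1, Matrix.mul_smul, Matrix.smul_mul, ← Matrix.transpose_map, ← Matrix.transpose_map,
          h2', Matrix.mul_smul, Matrix.mul_smul, Matrix.smul_mul, Matrix.smul_mul, h3', smul_smul,
          smul_smul, mul_assoc]

theorem permHom_mem (k : Fin 2) (p : V) : permHom k p ∈ alternatingGroup (Fin 6) := by
  rw [← range_permHom k]
  exact ⟨p, rfl⟩

theorem exists_permHom_eq (k : Fin 2) {s : Equiv.Perm (Fin 6)} (hs : s ∈ alternatingGroup (Fin 6)) :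
    ∃ (g : GL (Fin 3) ℂ) (hg : mk g ∈ V), permHom k ⟨mk g, hg⟩ = s := by
  rw [← range_permHom k] at hs
  obtain ⟨⟨p, hp⟩, rfl⟩ := hs
  obtain ⟨g, rfl⟩ := Matrix.ProjGenLinGroup.mk_surjective p
  exact ⟨g, hp, rfl⟩

/-- The group is normalized by complex conjugation in the coordinates `y`. -/
theorem conjGL_mem {g : GL (Fin 3) ℂ} (hg : mk g ∈ V) : mk (conjGL g) ∈ V := by
  have h1 := (scales_permHom 1 hg).conj
  obtain ⟨g', hg', h2⟩ := exists_permHom_eq 0 (permHom_mem 1 ⟨mk g, hg⟩)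
  have h3 := scales_permHom 0 hg'
  rw [h2] at h3
  have h4 := (h3.of_mul_eq_smul_one (g := ((g'⁻¹ : GL (Fin 3) ℂ) : Matrix _ _ ℂ)) one_ne_zero
    (by rw [one_smul, ← Units.val_mul, mul_inv_cancel, Units.val_one])).mul h1
  rw [inv_mul_cancel] at h4
  obtain ⟨c, hc⟩ := h4.eq_smul_one
  have h5 : (conjGL g : Matrix (Fin 3) (Fin 3) ℂ) = c • (g' : Matrix _ _ ℂ) := by
    apply (g'⁻¹).isUnit.mul_left_cancel
    rw [hc, Matrix.mul_smul, ← Units.val_mul, inv_mul_cancel, Units.val_one]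
  have hc0 : c ≠ 0 := by
    rintro rfl
    rw [zero_smul] at h5
    exact not_isUnit_zero (h5 ▸ (conjGL g).isUnit)
  rw [← mk_eq_mk_iff_smul.2 ⟨c, hc0, h5⟩]
  exact hg'

theorem permHom_conjGL (k : Fin 2) {g : GL (Fin 3) ℂ} (hg : mk g ∈ V) :
    permHom (1 - k) ⟨mk (conjGL g), conjGL_mem hg⟩ = permHom k ⟨mk g, hg⟩ :=
  permHom_eq _ (scales_permHom k hg).conj

/-! ### Quadratic forms and Gram matrices -/

open MvPolynomial in
/-- The quadratic form with the given Gram matrix. -/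
noncomputable def quad (M : Matrix (Fin 3) (Fin 3) ℂ) : Poly :=
  ∑ i, ∑ j, C (M i j) * X i * X j

theorem eval_quad (M : Matrix (Fin 3) (Fin 3) ℂ) (v : Fin 3 → ℂ) :
    MvPolynomial.eval v (quad M) = v ⬝ᵥ (M *ᵥ v) := by
  simp only [quad, map_sum, map_mul, MvPolynomial.eval_C, MvPolynomial.eval_X, dotProduct,
    Matrix.mulVec, Finset.mul_sum]
  refine Finset.sum_congr rfl fun i _ => Finset.sum_congr rfl fun j _ => by ring

theorem quad_smul (c : ℂ) (M : Matrix (Fin 3) (Fin 3) ℂ) :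
    quad (c • M) = MvPolynomial.C c * quad M := by
  simp only [quad, Finset.mul_sum, Matrix.smul_apply, smul_eq_mul, map_mul, mul_assoc]

theorem quad_isHomogeneous (M : Matrix (Fin 3) (Fin 3) ℂ) : (quad M).IsHomogeneous 2 := by
  refine MvPolynomial.IsHomogeneous.sum _ _ _ fun i _ =>
    MvPolynomial.IsHomogeneous.sum _ _ _ fun j _ => ?_
  have := ((MvPolynomial.isHomogeneous_C (Fin 3) (M i j)).mul
    (MvPolynomial.isHomogeneous_X ℂ i)).mul (MvPolynomial.isHomogeneous_X ℂ j)
  simpa using this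

theorem eval_precompPoly (g : GL (Fin 3) ℂ) (q : Poly) (v : Fin 3 → ℂ) :
    MvPolynomial.eval v (precompPoly g q) =
      MvPolynomial.eval ((g : Matrix (Fin 3) (Fin 3) ℂ) *ᵥ v) q := by
  rw [precompPoly_eq_lin, eval_lin]

theorem precompPoly_quad (g : GL (Fin 3) ℂ) (M : Matrix (Fin 3) (Fin 3) ℂ) :
    precompPoly g (quad M) =
      quad ((g : Matrix (Fin 3) (Fin 3) ℂ)ᵀ * M * (g : Matrix (Fin 3) (Fin 3) ℂ)) := by
  apply MvPolynomial.funext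
  intro v
  rw [eval_precompPoly, eval_quad, eval_quad, ← Matrix.mulVec_mulVec, ← Matrix.mulVec_mulVec,
    Matrix.dotProduct_mulVec v, Matrix.vecMul_transpose]

/-- Each quadratic form has a symmetric Gram matrix: half of its Hessian matrix. -/
theorem exists_quad_eq {q : Poly} (hq : q.IsHomogeneous 2) :
    ∃ M : Matrix (Fin 3) (Fin 3) ℂ, Mᵀ = M ∧ quad M = q := by
  have h2 (i j : Fin 3) : MvPolynomial.pderiv i (MvPolynomial.pderiv j q) =
      MvPolynomial.C (MvPolynomial.coeff 0 (MvPolynomial.pderiv i (MvPolynomial.pderiv j q))) :=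
    MvPolynomial.totalDegree_eq_zero_iff_eq_C.1
      (Nat.le_zero.1 (((hq.pderiv (i := j)).pderiv (i := i)).totalDegree_le))
  set M : Matrix (Fin 3) (Fin 3) ℂ :=
    Matrix.of fun j i => MvPolynomial.coeff 0
      (MvPolynomial.pderiv i (MvPolynomial.pderiv j q)) with hM
  refine ⟨(4 : ℂ)⁻¹ • (M + Mᵀ), ?_, ?_⟩
  · rw [Matrix.transpose_smul, Matrix.transpose_add, Matrix.transpose_transpose, add_comm]
  · have h3 : quad M = 2 * q := by
      have e1 := hq.sum_X_mul_pderiv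
      have e2 (j) := (hq.pderiv (i := j)).sum_X_mul_pderiv
      simp only [Nat.add_one_sub_one, one_smul, nsmul_eq_mul, Nat.cast_ofNat] at e1 e2
      rw [← e1, quad]
      refine Finset.sum_congr rfl fun j _ => ?_
      rw [← e2 j, Finset.mul_sum]
      refine Finset.sum_congr rfl fun i _ => ?_
      conv_rhs => rw [h2 i j]
      simp only [hM, Matrix.of_apply]
      ring
    apply MvPolynomial.funext
    intro v
    have h4 := congrArg (MvPolynomial.eval v) h3
    rw [eval_quad, map_mul, map_ofNat] at h4
    rw [quad_smul, map_mul, MvPolynomial.eval_C, eval_quad, Matrix.add_mulVec, dotProduct_add,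
      Matrix.mulVec_transpose, dotProduct_comm v (v ᵥ* M), ← Matrix.dotProduct_mulVec, h4]
    ring

theorem symm_eq_zero {M : Matrix (Fin 3) (Fin 3) ℂ} (hM : Mᵀ = M) (h : quad M = 0) : M = 0 := by
  have hs (i j) : M j i = M i j := congrFun (congrFun hM i) j
  have he (v) : v ⬝ᵥ (M *ᵥ v) = 0 := by rw [← eval_quad, h, map_zero]
  have a0 := he ![1, 0, 0]
  have a1 := he ![0, 1, 0]
  have a2 := he ![0, 0, 1]
  have a01 := he ![1, 1, 0]
  have a02 := he ![1, 0, 1]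
  have a12 := he ![0, 1, 1]
  simp [dotProduct, Matrix.mulVec, Fin.sum_univ_three] at a0 a1 a2 a01 a02 a12
  have h10 := hs 0 1
  have h20 := hs 0 2
  have h21 := hs 1 2
  ext i j
  fin_cases i <;> fin_cases j <;>
    simp only [Fin.mk_zero, Fin.mk_one, Fin.reduceFinMk, Matrix.zero_apply]
  · exact a0
  · linear_combination (a01 - a0 - a1 - h10) / 2
  · linear_combination (a02 - a0 - a2 - h20) / 2
  · linear_combination (a01 - a0 - a1 + h10) / 2
  · exact a1
  · linear_combination (a12 - a1 - a2 - h21) / 2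
  · linear_combination (a02 - a0 - a2 + h20) / 2
  · linear_combination (a12 - a1 - a2 + h21) / 2
  · exact a2

theorem quad_injective {M N : Matrix (Fin 3) (Fin 3) ℂ} (hM : Mᵀ = M) (hN : Nᵀ = N)
    (h : quad M = quad N) : M = N := by
  have h1 : quad (M - N) = 0 := by
    apply MvPolynomial.funext
    intro v
    have := congrArg (MvPolynomial.eval v) h
    rw [eval_quad, eval_quad] at this
    rw [eval_quad, Matrix.sub_mulVec, dotProduct_sub, this, sub_self, map_zero]
  exact sub_eq_zero.1 (symm_eq_zero (by rw [Matrix.transpose_sub, hM, hN]) h1)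

theorem fam_transpose (k : Fin 2) (i : Fin 6) : (fam k i)ᵀ = fam k i := by
  have h : (eM k i)ᵀ = eM k i := by
    revert k i
    decide +kernel
  rw [fam, ← Matrix.transpose_map, h]

theorem fam_ne_zero (k : Fin 2) (i : Fin 6) : fam k i ≠ 0 := by
  intro h
  have h1 := fam_eq_of_eq_smul (k := k) (i := i) (l := 1 - k) (j := i) (c := 0)
    (by rw [h, zero_smul])
  clear h
  revert k i
  decide

theorem quad_fam_ne_zero (k : Fin 2) (i : Fin 6) : quad (fam k i) ≠ 0 :=
  fun h => fam_ne_zero k i (symm_eq_zero (fam_transpose k i) h)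

/-! ### The icosahedral subgroups -/

/-- The embedding of the alternating group of degree 5 into the group, with image the stabilizer of
the form `i` of the family `k`. -/
noncomputable def icosaHom (k : Fin 2) (i : Fin 6) : alternatingGroup (Fin 5) →* PGL(3, ℂ) :=
  (V.subtype.comp (altEquiv k).symm.toMonoidHom).comp
    ((alternatingGroup.ofSubtype ({i}ᶜ : Finset (Fin 6))).comp
      (Equiv.altCongrHom ((finSuccAboveEquiv i).trans
        (Equiv.subtypeEquivRight fun x => by simp))).toMonoidHom)

theorem icosaHom_injective (k : Fin 2) (i : Fin 6) : Function.Injective (icosaHom k i) := by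
  exact (V.subtype_injective.comp (altEquiv k).symm.injective).comp
    (alternatingGroup.ofSubtype_injective.comp (Equiv.altCongrHom _).injective)

/-- The subgroup of the elements that fix the form `i` of the family `k`. -/
noncomputable def icosa (k : Fin 2) (i : Fin 6) : Subgroup PGL(3, ℂ) := (icosaHom k i).range

theorem mem_icosa {k : Fin 2} {i : Fin 6} {p : PGL(3, ℂ)} :
    p ∈ icosa k i ↔ ∃ hp : p ∈ V, permHom k ⟨p, hp⟩ i = i := by
  have h1 (s : alternatingGroup (Fin 6)) :
      (s ∈ (alternatingGroup.ofSubtype ({i}ᶜ : Finset _)).range) ↔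
      (s : Equiv.Perm (Fin 6)) i = i := by
    rw [alternatingGroup.mem_range_ofSubtype_iff, Finset.subset_compl_singleton,
      Equiv.Perm.notMem_support]
  constructor
  · rintro ⟨x, rfl⟩
    refine ⟨((altEquiv k).symm _).2, ?_⟩
    change ((altEquiv k ((altEquiv k).symm _) : alternatingGroup (Fin 6)) :
      Equiv.Perm (Fin 6)) i = i
    rw [MulEquiv.apply_symm_apply]
    exact (h1 _).1 ⟨_, rfl⟩
  · rintro ⟨hp, h⟩
    rw [← coe_altEquiv, ← h1] at h
    obtain ⟨y, hy⟩ := h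
    refine ⟨(Equiv.altCongrHom ((finSuccAboveEquiv i).trans
        (Equiv.subtypeEquivRight fun x => by simp))).symm y, ?_⟩
    change (((altEquiv k).symm (alternatingGroup.ofSubtype _ (Equiv.altCongrHom _
      ((Equiv.altCongrHom _).symm y))) : V) : PGL(3, ℂ)) = p
    rw [MulEquiv.apply_symm_apply, hy, MulEquiv.symm_apply_apply]

theorem icosa_le (k : Fin 2) (i : Fin 6) : icosa k i ≤ V := fun _ h => (mem_icosa.1 h).1

theorem icosa_equiv (k : Fin 2) (i : Fin 6) : Nonempty (icosa k i ≃* alternatingGroup (Fin 5)) :=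
  ⟨(MonoidHom.ofInjective (icosaHom_injective k i)).symm⟩

/-- An involution and a three-cycle whose product has order five generate the alternating group of
degree 5. -/
theorem eq_top_of_mem {T : Subgroup (alternatingGroup (Fin 5))}
    {a b : alternatingGroup (Fin 5)}
    (ha : (a : Equiv.Perm (Fin 5)) = Equiv.swap 1 3 * Equiv.swap 2 4)
    (hb : (b : Equiv.Perm (Fin 5)) = Equiv.swap 0 1 * Equiv.swap 1 2)
    (haT : a ∈ T) (hbT : b ∈ T) : T = ⊤ := by
  set G := T.map (alternatingGroup (Fin 5)).subtype with hG
  have haG : Equiv.swap 1 3 * Equiv.swap 2 4 ∈ G := ⟨a, haT, ha⟩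
  have hbG : Equiv.swap 0 1 * Equiv.swap 1 2 ∈ G := ⟨b, hbT, hb⟩
  have h1 : MulAction.IsPretransitive G (Fin 5) := by
    have key : ∀ x y : Fin 5, ∃ n : Fin 5,
      ((Equiv.swap 1 3 * Equiv.swap 2 4 * (Equiv.swap 0 1 * Equiv.swap 1 2)) ^ (n : ℕ) :
        Equiv.Perm (Fin 5)) x = y := by decide +kernel
    refine ⟨fun x y => ?_⟩
    obtain ⟨n, hn⟩ := key x y
    exact ⟨⟨_, G.pow_mem (G.mul_mem haG hbG) n⟩, hn⟩
  have h2 : MulAction.IsPreprimitive G (Fin 5) :=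
    MulAction.IsPreprimitive.of_prime_card (by rw [Nat.card_fin]; exact Nat.prime_five)
  have h3 := Equiv.Perm.alternatingGroup_le_of_isPreprimitive_of_isThreeCycle_mem h2
    (card_support_eq_three_iff.1 (by decide +kernel)) hbG
  rw [eq_top_iff]
  rintro ⟨x, hx⟩ -
  obtain ⟨y, hy, hxy⟩ := h3 hx
  have : y = ⟨x, hx⟩ := Subtype.ext hxy
  rwa [← this]

/-- The combinatorial form of the fact that an icosahedral group of permutations of six points in
which the elements of order three are three-cycles has a fixed point. -/
theorem exists_fixed_of_isThreeCycle {a b : Equiv.Perm (Fin 6)} (ha : a * a = 1)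
    (hb : b.IsThreeCycle) (hab : (a * b) ^ 5 = 1) : ∃ i, a i = i ∧ b i = i := by
  have key : ∀ a : Equiv.Perm (Fin 6), a * a = 1 →
      (a * (Equiv.swap 0 1 * Equiv.swap 1 2)) ^ 5 = 1 →
      ∃ i : Fin 6, a i = i ∧ (Equiv.swap 0 1 * Equiv.swap 1 2 : Equiv.Perm (Fin 6)) i = i := by
    decide +kernel
  have h3 : (Equiv.swap 0 1 * Equiv.swap 1 2 : Equiv.Perm (Fin 6)).IsThreeCycle :=
    card_support_eq_three_iff.1 (by decide +kernel)
  obtain ⟨π, hπ⟩ := isConj_iff.1 (Equiv.Perm.isConj_iff_cycleType_eq.2 (hb.trans h3.symm))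
  obtain ⟨i, h1, h2⟩ := key (π * a * π⁻¹) (by
    calc π * a * π⁻¹ * (π * a * π⁻¹) = π * (a * a) * π⁻¹ := by group
      _ = 1 := by rw [ha]; group) (by
    rw [← hπ, show π * a * π⁻¹ * (π * b * π⁻¹) = π * (a * b) * π⁻¹ by group, conj_pow, hab]
    group)
  rw [← hπ] at h2
  refine ⟨π⁻¹ i, ?_, ?_⟩
  · exact (Equiv.Perm.eq_inv_iff_eq.2 h1)
  · exact (Equiv.Perm.eq_inv_iff_eq.2 h2)

/-- The cycle type of a permutation of six points of order three that is not a three-cycle. -/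
theorem cycleType_of_pow_three {s : Equiv.Perm (Fin 6)} (h : s ^ 3 = 1) (h1 : s ≠ 1)
    (h3 : ¬ s.IsThreeCycle) : s.cycleType = {3, 3} := by
  have : Fact (Nat.Prime 3) := ⟨Nat.prime_three⟩
  have h2 := Equiv.Perm.cycleType_of_pow_prime_eq_one h
  have h4 : s.cycleType.sum ≤ 6 := by
    rw [Equiv.Perm.sum_cycleType]
    exact (Finset.card_le_univ _).trans (by simp)
  have h5 : s.cycleType.card ≠ 0 := by
    rwa [Ne, Multiset.card_eq_zero, Equiv.Perm.cycleType_eq_zero]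
  have h6 : s.cycleType.card ≠ 1 := by
    intro h6
    rw [h6] at h2
    exact h3 h2
  rw [h2, Multiset.sum_replicate, smul_eq_mul] at h4
  have h7 : s.cycleType.card = 2 := by omega
  rw [h2, h7]
  rfl

/-- An element of order three is a three-cycle in one of the two actions on six forms. -/
theorem exists_isThreeCycle {p : V} (hp : p ^ 3 = 1) (hp1 : p ≠ 1) :
    ∃ k, (permHom k p).IsThreeCycle := by
  by_cases h0 : (permHom 0 p).IsThreeCycle
  · exact ⟨0, h0⟩
  refine ⟨1, ?_⟩
  have h1 := cycleType_of_pow_three (by rw [← map_pow, hp, map_one])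
    (fun h => hp1 (permHom_injective 0 (h.trans (map_one _).symm))) h0
  set t : V := ⟨mk (glG 1), mk_glG_mem 1⟩ * ⟨mk (glG 1), mk_glG_mem 1⟩ * ⟨mk (glG 2), mk_glG_mem 2⟩
  have ht (k) : permHom k t = gen 1 k * gen 1 k * gen 2 k := by
    rw [map_mul, map_mul, permHom_glG, permHom_glG]
  have h2 : (permHom 0 t).cycleType = {3, 3} := by
    rw [ht]
    refine cycleType_of_pow_three (by decide +kernel) (by decide +kernel) ?_
    rw [← card_support_eq_three_iff]
    decide +kernel
  have h3 : (permHom 1 t).IsThreeCycle := by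
    rw [ht, ← card_support_eq_three_iff]
    decide +kernel
  obtain ⟨π, hπ⟩ := isConj_iff.1 (Equiv.Perm.isConj_iff_cycleType_eq.2 (h2.trans h1.symm))
  -- An odd permutation centralizes the reference element, so the conjugating one may be taken even.
  obtain ⟨π', hπ', he⟩ : ∃ π', π' * permHom 0 t * π'⁻¹ = permHom 0 p ∧
      π' ∈ alternatingGroup (Fin 6) := by
    rcases Int.units_eq_one_or (Equiv.Perm.sign π) with h | h
    · exact ⟨π, hπ, h⟩
    · obtain ⟨u, hu, hs⟩ : ∃ u, u * permHom 0 t * u⁻¹ = permHom 0 t ∧ Equiv.Perm.sign u = -1 := by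
        rw [ht]
        exact ⟨Equiv.swap 0 2 * Equiv.swap 1 5 * Equiv.swap 3 4, by decide +kernel,
          by decide +kernel⟩
      refine ⟨π * u, ?_, ?_⟩
      · rw [show π * u * permHom 0 t * (π * u)⁻¹ = π * (u * permHom 0 t * u⁻¹) * π⁻¹ by group, hu,
          hπ]
      · rw [Equiv.Perm.mem_alternatingGroup, map_mul, h, hs]
        rfl
  obtain ⟨g, hg, rfl⟩ := exists_permHom_eq 0 he
  have h4 : ⟨mk g, hg⟩ * t * ⟨mk g, hg⟩⁻¹ = p := permHom_injective 0 (by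
    rw [map_mul, map_mul, map_inv, hπ'])
  rw [← h4, map_mul, map_mul, map_inv]
  unfold Equiv.Perm.IsThreeCycle
  rw [Equiv.Perm.cycleType_conj]
  exact h3

/-- Each subgroup that is isomorphic to the alternating group of degree 5 is the stabilizer of one
of the twelve forms. -/
theorem exists_eq_icosa {H : Subgroup PGL(3, ℂ)} (hH : H ≤ V)
    (hA : Nonempty (H ≃* alternatingGroup (Fin 5))) : ∃ k i, H = icosa k i := by
  obtain ⟨e⟩ := hA
  let θ : alternatingGroup (Fin 5) →* V := (Subgroup.inclusion hH).comp e.symm.toMonoidHom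
  have hθ : Function.Injective θ := (Subgroup.inclusion_injective hH).comp e.symm.injective
  set a : alternatingGroup (Fin 5) := ⟨Equiv.swap 1 3 * Equiv.swap 2 4, by
    rw [Equiv.Perm.mem_alternatingGroup]; decide +kernel⟩ with ha
  set b : alternatingGroup (Fin 5) := ⟨Equiv.swap 0 1 * Equiv.swap 1 2, by
    rw [Equiv.Perm.mem_alternatingGroup]; decide +kernel⟩ with hb
  have ha2 : a * a = 1 := Subtype.ext (by decide +kernel)
  have hb3 : b ^ 3 = 1 := Subtype.ext (by decide +kernel)
  have hab : (a * b) ^ 5 = 1 := Subtype.ext (by decide +kernel)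
  have hb1 : b ≠ 1 := by
    intro h
    have := congrArg Subtype.val h
    revert this
    decide +kernel
  obtain ⟨k, hk⟩ := exists_isThreeCycle (p := θ b) (by rw [← map_pow, hb3, map_one])
    (fun h => hb1 (hθ (h.trans (map_one _).symm)))
  obtain ⟨i, hi, hi'⟩ := exists_fixed_of_isThreeCycle (a := permHom k (θ a))
    (by rw [← map_mul, ← map_mul, ha2, map_one, map_one]) hk
    (by rw [← map_mul, ← map_mul, ← map_pow, ← map_pow, hab, map_one, map_one])
  refine ⟨k, i, ?_⟩
  have hT : ((MulAction.stabilizer (Equiv.Perm (Fin 6)) i).comap ((permHom k).comp θ)) = ⊤ :=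
    eq_top_of_mem (a := a) (b := b) rfl rfl hi hi'
  have hle : H ≤ icosa k i := by
    intro p hp
    rw [mem_icosa]
    refine ⟨hH hp, ?_⟩
    have h1 : e ⟨p, hp⟩ ∈
        (MulAction.stabilizer (Equiv.Perm (Fin 6)) i).comap ((permHom k).comp θ) := by
      rw [hT]; trivial
    have h2 : θ (e ⟨p, hp⟩) = ⟨p, hH hp⟩ := by
      change Subgroup.inclusion hH (e.symm (e ⟨p, hp⟩)) = _
      rw [e.symm_apply_apply]
      rfl
    rw [← h2]
    exact h1
  have : Finite (icosa k i) := Finite.of_equiv _ (icosa_equiv k i).some.symm.toEquiv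
  refine Subgroup.eq_of_le_of_card_ge hle (le_of_eq ?_)
  rw [Nat.card_congr (icosa_equiv k i).some.toEquiv, Nat.card_congr e.toEquiv]

/-! ### The forms that an icosahedral subgroup preserves -/

/-- A relation between the generators holds over the complex numbers if it holds over `ℤ[τ, ρ]`. -/
theorem map_toC_eq_smul_one {M : Matrix (Fin 3) (Fin 3) E} {n : ℕ} (h : M = (n : E) • 1) :
    M.map toC = (n : ℂ) • 1 := by
  rw [h, map_toC_smul, map_natCast, Matrix.map_one _ (map_zero _) (map_one _)]

theorem matZ_eq : matZ = (2 : ℂ)⁻¹ • (eG 0).map toC := by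
  rw [eG_map, smul_smul, inv_mul_cancel₀ two_ne_zero, one_smul]; rfl

theorem matP_eq : matP = (2 : ℂ)⁻¹ • (eG 1).map toC := by
  rw [eG_map, smul_smul, inv_mul_cancel₀ two_ne_zero, one_smul]; rfl

theorem matQ_eq : matQ = (2 : ℂ)⁻¹ • (eG 2).map toC := by
  rw [eG_map, smul_smul, inv_mul_cancel₀ two_ne_zero, one_smul]; rfl

theorem map_toC_pow (M : Matrix (Fin 3) (Fin 3) E) (n : ℕ) : (M ^ n).map toC = M.map toC ^ n :=
  map_pow toC.mapMatrix M n

theorem matZ_sq : matZ ^ 2 = 1 := by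
  have h := map_toC_eq_smul_one (M := eG 0 ^ 2) (n := 4) (by decide +kernel)
  rw [map_toC_pow] at h
  rw [matZ_eq, smul_pow, h, smul_smul]
  norm_num

theorem matP_pow_five : matP ^ 5 = 1 := by
  have h := map_toC_eq_smul_one (M := eG 1 ^ 5) (n := 32) (by decide +kernel)
  rw [map_toC_pow] at h
  rw [matP_eq, smul_pow, h, smul_smul]
  norm_num

theorem matZ_mul_matP_pow_three : (matZ * matP) ^ 3 = 1 := by
  have h := map_toC_eq_smul_one (M := (eG 0 * eG 1) ^ 3) (n := 64) (by decide +kernel)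
  rw [map_toC_pow, map_toC_mul] at h
  rw [matZ_eq, matP_eq, Matrix.smul_mul, Matrix.mul_smul, smul_smul, smul_pow, h, smul_smul]
  norm_num

theorem matZ_mul_transpose : matZ * matZᵀ = 1 := by
  have h := map_toC_eq_smul_one (M := eG 0 * (eG 0)ᵀ) (n := 4) (by decide +kernel)
  rw [map_toC_mul, Matrix.transpose_map] at h
  rw [matZ_eq, Matrix.transpose_smul, Matrix.smul_mul, Matrix.mul_smul, smul_smul, h, smul_smul]
  norm_num

theorem matP_mul_transpose : matP * matPᵀ = 1 := by
  have h := map_toC_eq_smul_one (M := eG 1 * (eG 1)ᵀ) (n := 4) (by decide +kernel)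
  rw [map_toC_mul, Matrix.transpose_map] at h
  rw [matP_eq, Matrix.transpose_smul, Matrix.smul_mul, Matrix.mul_smul, smul_smul, h, smul_smul]
  norm_num

/-- A scalar by which a matrix of finite order commutes with a nonzero matrix is a root of unity. -/
theorem pow_eq_one_of_mul_eq {M G : Matrix (Fin 3) (Fin 3) ℂ} (hM : M ≠ 0) {c : ℂ} {n : ℕ}
    (h : M * G = c • (G * M)) (hG : G ^ n = 1) : c ^ n = 1 := by
  have h1 : ∀ m : ℕ, M * G ^ m = c ^ m • (G ^ m * M) := by
    intro m
    induction m with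
    | zero => simp
    | succ m ih =>
      rw [pow_succ, ← Matrix.mul_assoc, ih, Matrix.smul_mul, Matrix.mul_assoc, h, Matrix.mul_smul,
        smul_smul, Matrix.mul_assoc, pow_succ]
  have h2 := h1 n
  rw [hG, Matrix.mul_one, Matrix.one_mul] at h2
  have h3 : (c ^ n - 1) • M = 0 := by rw [sub_smul, one_smul, ← h2, sub_self]
  exact sub_eq_zero.1 ((smul_eq_zero.1 h3).resolve_right hM)

theorem eq_one_of_pow_eq_one {c d : ℂ} (hc : c ^ 2 = 1) (hd : d ^ 5 = 1) (hcd : (c * d) ^ 3 = 1) :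
    c = 1 ∧ d = 1 := by
  have h1 : d = 1 := by
    have : (c * d) ^ 6 = 1 := by rw [show 6 = 3 * 2 by norm_num, pow_mul, hcd, one_pow]
    calc d = d ^ 5 * d := by rw [hd, one_mul]
      _ = (c ^ 2) ^ 3 * (d ^ 5 * d) := by rw [hc, one_pow, one_mul]
      _ = (c * d) ^ 6 := by ring
      _ = 1 := this
  subst h1
  refine ⟨?_, rfl⟩
  rw [mul_one] at hcd
  calc c = c ^ 2 * c := by rw [hc, one_mul]
    _ = c ^ 3 := by ring
    _ = 1 := hcd

/-- A Gram matrix that is preserved by the first two generators up to scalars is a scalar matrix. -/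
theorem eq_smul_one_of_semi_invariant {M : Matrix (Fin 3) (Fin 3) ℂ} (hM : Mᵀ = M) (hM0 : M ≠ 0)
    {c d : ℂ} (hZ : matZᵀ * M * matZ = c • M) (hP : matPᵀ * M * matP = d • M) :
    ∃ x : ℂ, M = x • 1 := by
  have h1 : M * matZ = c • (matZ * M) := by
    rw [← Matrix.mul_smul, ← hZ, ← Matrix.mul_assoc, ← Matrix.mul_assoc, matZ_mul_transpose,
      Matrix.one_mul]
  have h2 : M * matP = d • (matP * M) := by
    rw [← Matrix.mul_smul, ← hP, ← Matrix.mul_assoc, ← Matrix.mul_assoc, matP_mul_transpose,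
      Matrix.one_mul]
  have h3 : M * (matZ * matP) = (c * d) • (matZ * matP * M) := by
    rw [← Matrix.mul_assoc, h1, Matrix.smul_mul, Matrix.mul_assoc, h2, Matrix.mul_smul, smul_smul,
      Matrix.mul_assoc]
  obtain ⟨rfl, rfl⟩ := eq_one_of_pow_eq_one (pow_eq_one_of_mul_eq hM0 h1 matZ_sq)
    (pow_eq_one_of_mul_eq hM0 h2 matP_pow_five)
    (pow_eq_one_of_mul_eq hM0 h3 matZ_mul_matP_pow_three)
  rw [one_smul] at h1 h2
  have z (i j) := congrFun (congrFun h1 i) j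
  have p (i j) := congrFun (congrFun h2 i) j
  have s (i j) : M j i = M i j := congrFun (congrFun hM i) j
  have z01 := z 0 1
  have z12 := z 1 2
  have p01 := p 0 1
  have p10 := p 1 0
  have p12 := p 1 2
  simp [matZ, matP, tau_inv, Matrix.mul_apply, Fin.sum_univ_three] at z01 z12 p01 p10 p12
  have m01 : M 0 1 = 0 := by linear_combination z01 / 2
  have m12 : M 1 2 = 0 := by linear_combination -z12 / 2
  rw [s 0 1, m01] at p10
  rw [m01] at p01
  rw [s 1 2] at p01
  rw [s 0 1, m01, m12] at p12
  rw [m12] at p01 p10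
  have m02 : M 0 2 = 0 := by linear_combination -p01 - p10 - s 0 2 / 2
  rw [m02] at p01 p12
  have m11 : M 1 1 = M 0 0 := by
    linear_combination -2 * τ * p01 + (M 0 0 - M 1 1) * tau_sq
  have m22 : M 2 2 = M 0 0 := by linear_combination -2 * p12 + m11
  refine ⟨M 0 0, ?_⟩
  ext i j
  fin_cases i <;> fin_cases j <;> simp [s 0 1, s 0 2, s 1 2, m01, m02, m12, m11, m22]

theorem fam_zero_zero : fam 0 0 = (4 : ℂ) • 1 := by
  have h : eM 0 0 = ((4 : ℕ) : E) • 1 := by decide +kernel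
  exact map_toC_eq_smul_one h

theorem eq_smul_of_congruent {T M N : Matrix (Fin 3) (Fin 3) ℂ} (hT : IsUnit T) {x : ℂ}
    (h : Tᵀ * M * T = x • (Tᵀ * N * T)) : M = x • N := by
  apply hT.mul_right_cancel
  apply ((Matrix.isUnit_transpose T).2 hT).mul_left_cancel
  rw [← Matrix.mul_assoc, h, Matrix.smul_mul, Matrix.mul_smul, Matrix.mul_assoc]

/-- The group acts transitively on each family. -/
theorem exists_permHom_apply_eq (k : Fin 2) (i : Fin 6) :
    ∃ (g : GL (Fin 3) ℂ) (hg : mk g ∈ V), permHom k ⟨mk g, hg⟩ 0 = i := by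
  have : MulAction.IsPretransitive (alternatingGroup (Fin 6)) (Fin 6) :=
    alternatingGroup.isPretransitive_of_three_le_card (Fin 6) (by simp)
  obtain ⟨s, hs⟩ := MulAction.exists_smul_eq (alternatingGroup (Fin 6)) (0 : Fin 6) i
  obtain ⟨g, hg, h⟩ := exists_permHom_eq k s.2
  exact ⟨g, hg, by rw [h]; exact hs⟩

/-- A symmetric Gram matrix that an icosahedral subgroup preserves up to scalars is a multiple of
the corresponding form. -/
def OnlyInvariant (k : Fin 2) (i : Fin 6) : Prop :=
  ∀ M : Matrix (Fin 3) (Fin 3) ℂ, Mᵀ = M →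
    (∀ g : GL (Fin 3) ℂ, mk g ∈ icosa k i →
      ∃ c : ℂ, (g : Matrix _ _ ℂ)ᵀ * M * (g : Matrix _ _ ℂ) = c • M) →
    ∃ x : ℂ, M = x • fam k i

theorem onlyInvariant_zero_zero : OnlyInvariant 0 0 := by
  intro M hM hg
  rcases eq_or_ne M 0 with rfl | hM0
  · exact ⟨0, by simp⟩
  obtain ⟨c, hc⟩ := hg (glG 0) (mem_icosa.2 ⟨mk_glG_mem 0, by rw [permHom_glG]; decide +kernel⟩)
  obtain ⟨d, hd⟩ := hg (glG 1) (mem_icosa.2 ⟨mk_glG_mem 1, by rw [permHom_glG]; decide +kernel⟩)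
  obtain ⟨x, hx⟩ := eq_smul_one_of_semi_invariant hM hM0 hc hd
  exact ⟨x / 4, by rw [fam_zero_zero, smul_smul, div_mul_cancel₀ _ (by norm_num), hx]⟩

theorem conjGL_mul_glB (g : GL (Fin 3) ℂ) :
    (conjGL g : Matrix (Fin 3) (Fin 3) ℂ) * matB = matB * (g : Matrix _ _ ℂ).map conj := by
  rw [← coe_glB, ← Units.val_mul, conjGL, inv_mul_cancel_right]
  rfl

theorem OnlyInvariant.conj {k : Fin 2} {i : Fin 6} (h : OnlyInvariant k i) :
    OnlyInvariant (1 - k) i := by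
  intro M hM hg
  obtain ⟨x, hx⟩ := h ((matBᵀ * M * matB).map conj)
    (by rw [← Matrix.transpose_map]; simp [Matrix.transpose_mul, hM, Matrix.mul_assoc]) (by
    intro g hgk
    obtain ⟨hgV, hgi⟩ := mem_icosa.1 hgk
    obtain ⟨c, hc⟩ := hg (conjGL g)
      (mem_icosa.2 ⟨conjGL_mem hgV, by rw [permHom_conjGL k hgV, hgi]⟩)
    refine ⟨starRingEnd ℂ c, ?_⟩
    set G := (g : Matrix (Fin 3) (Fin 3) ℂ)
    have h1 : (G.map (starRingEnd ℂ))ᵀ * (matBᵀ * M * matB) * G.map (starRingEnd ℂ) =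
        c • (matBᵀ * M * matB) := by
      calc _ = (matB * G.map (starRingEnd ℂ))ᵀ * M * (matB * G.map (starRingEnd ℂ)) := by
            simp only [Matrix.transpose_mul, Matrix.mul_assoc]
        _ = matBᵀ * ((conjGL g : Matrix _ _ ℂ)ᵀ * M * (conjGL g : Matrix _ _ ℂ)) * matB := by
            rw [← conjGL_mul_glB]
            simp only [Matrix.transpose_mul, Matrix.mul_assoc]
        _ = _ := by rw [hc, Matrix.mul_smul, Matrix.smul_mul]
    have h2 := congrArg (fun N => N.map (starRingEnd ℂ)) h1
    rwa [map_conj_smul, map_conj_mul, map_conj_mul, Matrix.transpose_map, map_conj_conj] at h2)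
  obtain ⟨c, hc, h1⟩ := matB_fam k i
  refine ⟨starRingEnd ℂ x * c⁻¹, eq_smul_of_congruent isUnit_matB ?_⟩
  have h2 := congrArg (fun N => N.map (starRingEnd ℂ)) hx
  simp only [map_conj_conj, map_conj_smul] at h2
  rw [h2, h1, smul_smul, mul_assoc, inv_mul_cancel₀ hc, mul_one]

theorem onlyInvariant (k : Fin 2) (i : Fin 6) : OnlyInvariant k i := by
  have h0 : OnlyInvariant k 0 := by
    fin_cases k
    · exact onlyInvariant_zero_zero
    · exact onlyInvariant_zero_zero.conj
  intro M hM hg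
  obtain ⟨g₀, hg₀, hi⟩ := exists_permHom_apply_eq k i
  obtain ⟨d, hd, h1⟩ := scales_permHom k hg₀ 0
  rw [hi] at h1
  set T := (g₀ : Matrix (Fin 3) (Fin 3) ℂ) with hT
  obtain ⟨x, hx⟩ := h0 (Tᵀ * M * T) (by simp [Matrix.transpose_mul, hM, Matrix.mul_assoc]) (by
    intro g hgk
    obtain ⟨hgV, hgi⟩ := mem_icosa.1 hgk
    obtain ⟨c, hc⟩ := hg (g₀ * g * g₀⁻¹) (mem_icosa.2 ⟨by
      rw [map_mul, map_mul, map_inv]; exact V.mul_mem (V.mul_mem hg₀ hgV) (V.inv_mem hg₀), by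
      have h2 : (⟨mk (g₀ * g * g₀⁻¹), by
          rw [map_mul, map_mul, map_inv]
          exact V.mul_mem (V.mul_mem hg₀ hgV) (V.inv_mem hg₀)⟩ : V) =
          ⟨mk g₀, hg₀⟩ * ⟨mk g, hgV⟩ * ⟨mk g₀, hg₀⟩⁻¹ := rfl
      rw [h2, map_mul, map_mul, map_inv, ← hi]
      simp [hgi]⟩)
    refine ⟨c, ?_⟩
    have h3 : ((g₀ * g * g₀⁻¹ : GL (Fin 3) ℂ) : Matrix (Fin 3) (Fin 3) ℂ) * T =
        T * (g : Matrix _ _ ℂ) := by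
      rw [hT, ← Units.val_mul, inv_mul_cancel_right, Units.val_mul]
    calc _ = (T * (g : Matrix _ _ ℂ))ᵀ * M * (T * (g : Matrix _ _ ℂ)) := by
          simp only [Matrix.transpose_mul, Matrix.mul_assoc]
      _ = Tᵀ * (((g₀ * g * g₀⁻¹ : GL (Fin 3) ℂ) : Matrix (Fin 3) (Fin 3) ℂ)ᵀ * M *
            ((g₀ * g * g₀⁻¹ : GL (Fin 3) ℂ) : Matrix (Fin 3) (Fin 3) ℂ)) * T := by
          rw [← h3]
          simp only [Matrix.transpose_mul, Matrix.mul_assoc]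
      _ = _ := by rw [hc, Matrix.mul_smul, Matrix.smul_mul])
  exact ⟨x * d⁻¹, eq_smul_of_congruent g₀.isUnit (by
    rw [hx, h1, smul_smul, mul_assoc, inv_mul_cancel₀ hd, mul_one])⟩

/-! ### The twelve conics -/

/-- A change of coordinates that carries a given form of the two families to a multiple of the
sum of squares. -/
theorem exists_frame (k : Fin 2) (i : Fin 6) : ∃ (T : GL (Fin 3) ℂ) (c : ℂ), c ≠ 0 ∧
    (T : Matrix (Fin 3) (Fin 3) ℂ)ᵀ * fam k i * (T : Matrix _ _ ℂ) = c • 1 := by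
  obtain ⟨g, hg, hi⟩ := exists_permHom_apply_eq 0 i
  obtain ⟨d, hd, h1⟩ := scales_permHom 0 hg 0
  rw [hi, fam_zero_zero, smul_smul] at h1
  have hd4 : d * 4 ≠ 0 := mul_ne_zero hd (by norm_num)
  have hk : k = 0 ∨ k = 1 := by revert k; decide
  rcases hk with rfl | rfl
  · exact ⟨g, d * 4, hd4, h1⟩
  · obtain ⟨c, hc, h2⟩ := matB_fam 0 i
    refine ⟨glB * Matrix.GeneralLinearGroup.map (starRingEnd ℂ) g, c * conj (d * 4),
      mul_ne_zero hc ((map_ne_zero _).2 hd4), ?_⟩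
    have h3 := congrArg (fun N => N.map (starRingEnd ℂ)) h1
    simp only [map_conj_mul, map_conj_smul, Matrix.map_one (starRingEnd ℂ) (map_zero _) (map_one _),
      Matrix.transpose_map] at h3
    set G := (g : Matrix (Fin 3) (Fin 3) ℂ)
    calc (matB * G.map (starRingEnd ℂ))ᵀ * fam 1 i * (matB * G.map (starRingEnd ℂ)) =
          (G.map (starRingEnd ℂ))ᵀ * (matBᵀ * fam (1 - 0) i * matB) * G.map (starRingEnd ℂ) := by
          simp only [Matrix.transpose_mul, Matrix.mul_assoc, sub_zero]
      _ = _ := by rw [h2, Matrix.mul_smul, Matrix.smul_mul, h3, smul_smul]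

theorem mem_zeroLocus_mk {q : Poly} {d : ℕ} (hq : q.IsHomogeneous d) {v : Fin 3 → ℂ} (hv : v ≠ 0) :
    Projectivization.mk ℂ v hv ∈ zeroLocus q ↔ MvPolynomial.eval v q = 0 := by
  obtain ⟨a, ha⟩ := Projectivization.exists_smul_eq_mk_rep ℂ v hv
  change MvPolynomial.eval (Projectivization.mk ℂ v hv).rep q = 0 ↔ _
  rw [← ha]
  change MvPolynomial.eval ((a : ℂ) • v) q = 0 ↔ _
  rw [eval_smul_of_isHomogeneous hq]
  simp

/-- A symmetric matrix whose quadratic form vanishes on the conic of a form of the two families is a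
multiple of the Gram matrix of this form. -/
theorem eq_smul_fam_of_vanish {k : Fin 2} {i : Fin 6} {M : Matrix (Fin 3) (Fin 3) ℂ} (hM : Mᵀ = M)
    (h : ∀ v : Fin 3 → ℂ, v ⬝ᵥ (fam k i *ᵥ v) = 0 → v ⬝ᵥ (M *ᵥ v) = 0) :
    ∃ x : ℂ, M = x • fam k i := by
  obtain ⟨T, c, hc, hT⟩ := exists_frame k i
  set G := (T : Matrix (Fin 3) (Fin 3) ℂ)
  have tr (N : Matrix (Fin 3) (Fin 3) ℂ) (w : Fin 3 → ℂ) :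
      (G *ᵥ w) ⬝ᵥ (N *ᵥ (G *ᵥ w)) = w ⬝ᵥ ((Gᵀ * N * G) *ᵥ w) := by
    rw [← Matrix.mulVec_mulVec, ← Matrix.mulVec_mulVec, Matrix.dotProduct_mulVec w,
      Matrix.vecMul_transpose]
  set L := Gᵀ * M * G with hL
  have hLs : Lᵀ = L := by simp [hL, Matrix.transpose_mul, hM, Matrix.mul_assoc]
  have h1 (w : Fin 3 → ℂ) (hw : w ⬝ᵥ w = 0) : w ⬝ᵥ (L *ᵥ w) = 0 := by
    rw [← tr]
    apply h
    rw [tr, hT, Matrix.smul_mulVec, Matrix.one_mulVec, dotProduct_smul, hw, smul_zero]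
  have I2 : Complex.I * Complex.I = -1 := Complex.I_mul_I
  have a1 := h1 ![1, Complex.I, 0] (by simp [dotProduct, Fin.sum_univ_three])
  have a2 := h1 ![1, -Complex.I, 0] (by simp [dotProduct, Fin.sum_univ_three])
  have a3 := h1 ![0, 1, Complex.I] (by simp [dotProduct, Fin.sum_univ_three])
  have a4 := h1 ![0, 1, -Complex.I] (by simp [dotProduct, Fin.sum_univ_three])
  have a5 := h1 ![1, 0, Complex.I] (by simp [dotProduct, Fin.sum_univ_three])
  simp [dotProduct, Matrix.mulVec, Fin.sum_univ_three] at a1 a2 a3 a4 a5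
  have s (i j) : L j i = L i j := congrFun (congrFun hLs i) j
  have hI : (2 : ℂ) * Complex.I ≠ 0 := mul_ne_zero two_ne_zero Complex.I_ne_zero
  rw [s 0 1] at a1 a2
  rw [s 1 2] at a3 a4
  rw [s 0 2] at a5
  have l01 : L 0 1 = 0 := by
    apply mul_left_cancel₀ hI
    linear_combination (a1 - a2) / 2
  have l12 : L 1 2 = 0 := by
    apply mul_left_cancel₀ hI
    linear_combination (a3 - a4) / 2
  have l11 : L 1 1 = L 0 0 := by
    linear_combination -(a1 + a2) / 2 + L 1 1 * I2
  have l22 : L 2 2 = L 0 0 := by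
    linear_combination -(a3 + a4) / 2 + L 2 2 * I2 + l11
  have l02 : L 0 2 = 0 := by
    apply mul_left_cancel₀ hI
    linear_combination a5 - L 2 2 * I2 + l22
  refine ⟨L 0 0 * c⁻¹, eq_smul_of_congruent T.isUnit ?_⟩
  rw [hT, smul_smul, mul_assoc (L 0 0), inv_mul_cancel₀ hc, mul_one, ← hL]
  ext i j
  fin_cases i <;> fin_cases j <;> simp [s 0 1, s 0 2, s 1 2, l01, l02, l12, l11, l22]

theorem eq_smul_fam_of_zeroLocus_subset {k : Fin 2} {i : Fin 6} {M : Matrix (Fin 3) (Fin 3) ℂ}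
    (hM : Mᵀ = M) (h : zeroLocus (quad (fam k i)) ⊆ zeroLocus (quad M)) :
    ∃ x : ℂ, M = x • fam k i := by
  apply eq_smul_fam_of_vanish hM
  intro v hv
  rcases eq_or_ne v 0 with rfl | hv0
  · simp
  rw [← eval_quad] at hv ⊢
  rw [← mem_zeroLocus_mk (quad_isHomogeneous _) hv0] at hv ⊢
  exact h hv

/-- The conics of the twelve forms are distinct. -/
theorem zeroLocus_fam_injective :
    Function.Injective fun x : Fin 2 × Fin 6 => zeroLocus (quad (fam x.1 x.2)) := by
  rintro ⟨k, i⟩ ⟨k', i'⟩ h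
  obtain ⟨c, hc⟩ := eq_smul_fam_of_zeroLocus_subset (fam_transpose k i) h.ge
  exact fam_eq_of_eq_smul hc

theorem zeroLocus_C_mul {c : ℂ} (hc : c ≠ 0) (q : Poly) :
    zeroLocus (MvPolynomial.C c * q) = zeroLocus q := by
  ext p
  simp [zeroLocus, hc]

/-- The icosahedral conics are the conics of the forms of the two families. -/
theorem icosahedralConics_V :
    icosahedralConics V = Set.range fun x : Fin 2 × Fin 6 => zeroLocus (quad (fam x.1 x.2)) := by
  ext S
  constructor
  · rintro ⟨H, q, hH, hA, hq0, hq, hinv, rfl⟩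
    obtain ⟨k, i, rfl⟩ := exists_eq_icosa hH hA
    obtain ⟨M, hM, rfl⟩ := exists_quad_eq hq
    obtain ⟨x, rfl⟩ := onlyInvariant k i M hM (fun g hg => by
      obtain ⟨c, hc⟩ := hinv g hg
      refine ⟨c, quad_injective ?_ ?_ ?_⟩
      · simp [Matrix.transpose_mul, hM, Matrix.mul_assoc]
      · simp [hM]
      · rw [← precompPoly_quad, hc, quad_smul])
    have hx : x ≠ 0 := by
      rintro rfl
      apply hq0
      rw [quad_smul, map_zero, zero_mul]
    exact ⟨(k, i), by rw [quad_smul, zeroLocus_C_mul hx]⟩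
  · rintro ⟨⟨k, i⟩, rfl⟩
    refine ⟨icosa k i, quad (fam k i), icosa_le k i, icosa_equiv k i, quad_fam_ne_zero k i,
      quad_isHomogeneous _, ?_, rfl⟩
    intro g hg
    obtain ⟨hgV, hi⟩ := mem_icosa.1 hg
    obtain ⟨c, -, hc⟩ := scales_permHom k hgV i
    rw [hi] at hc
    exact ⟨c, by rw [precompPoly_quad, hc, quad_smul]⟩

theorem ncard_icosahedralConics : (icosahedralConics V).ncard = 12 := by
  rw [icosahedralConics_V, Set.ncard_range_of_injective zeroLocus_fam_injective]
  simp

/-! ### The restriction of the explicit map to a conic -/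

/-- A sparse polynomial with integer coefficients, with the coefficients read in `ℤ[τ, ρ]`. -/
def castE (l : SP ℤ) : SP E := l.map fun t => (t.1, (t.2 : E))

theorem ev_castE (v : Fin 3 → ℂ) (l : SP ℤ) :
    ev toC v (castE l) = ev (Int.castRingHom ℂ) v l := by
  induction l with
  | nil => rfl
  | cons t l ih =>
    simp only [castE, List.map_cons, ev_cons, map_intCast, eq_intCast] at ih ⊢
    rw [ih]

theorem evalMap_hExplicit (v : Fin 3 → ℂ) (i : Fin 3) :
    evalMap hExplicit v i = ev toC v (castE (lH i)) := by
  rw [evalMap, hExplicit_eq, eval_toPoly, ev_castE]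

/-- The parametrization of the conic `4 y₁ y₂ + β² y₃² = 0`. -/
noncomputable def conicN (s t : ℂ) : Fin 3 → ℂ := ![β * s ^ 2, -β * t ^ 2, 2 * s * t]

theorem conicN_eq_zero {s t : ℂ} (h : conicN s t = 0) : s = 0 ∧ t = 0 := by
  have h0 := congrFun h 0
  have h1 := congrFun h 1
  simp [conicN, beta_ne_zero] at h0 h1
  exact ⟨h0, h1⟩

theorem conicN_mul (c s t : ℂ) : conicN (c * s) (c * t) = c ^ 2 • conicN s t := by
  ext i
  fin_cases i <;> simp [conicN] <;> ring

/-- The quadratic form of the conic. -/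
noncomputable def conicQ (v : Fin 3 → ℂ) : ℂ := 4 * v 0 * v 1 + β ^ 2 * v 2 ^ 2

theorem conicQ_conicN (s t : ℂ) : conicQ (conicN s t) = 0 := by
  simp [conicQ, conicN]
  ring

theorem conicQ_smul (c : ℂ) (v : Fin 3 → ℂ) : conicQ (c • v) = c ^ 2 * conicQ v := by
  simp [conicQ]
  ring

theorem exists_eq_conicN {v : Fin 3 → ℂ} (h : conicQ v = 0) : ∃ s t, v = conicN s t := by
  have hβ := beta_ne_zero
  rw [conicQ] at h
  by_cases h0 : v 0 = 0
  · have h2 : v 2 = 0 := by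
      rw [h0] at h
      have : β ^ 2 * v 2 ^ 2 = 0 := by linear_combination h
      simpa [hβ] using this
    obtain ⟨t, ht⟩ := IsAlgClosed.exists_pow_nat_eq (-v 1 / β) (n := 2) two_pos
    refine ⟨0, t, ?_⟩
    ext i
    fin_cases i
    · simp [conicN, h0]
    · simp [conicN, ht]
      field_simp
    · simp [conicN, h2]
  · obtain ⟨s, hs⟩ := IsAlgClosed.exists_pow_nat_eq (v 0 / β) (n := 2) two_pos
    have hv0 : v 0 = β * s ^ 2 := by rw [hs]; field_simp
    have hs0 : s ≠ 0 := by
      rintro rfl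
      apply h0
      rw [hv0]
      ring
    refine ⟨s, v 2 / (2 * s), ?_⟩
    ext i
    fin_cases i
    · simp [conicN, hv0]
    · simp only [conicN, Fin.mk_one, Matrix.cons_val_one, Matrix.cons_val_zero]
      rw [hv0] at h
      have h4 : 4 * β * s ^ 2 ≠ 0 := by simp [hβ, hs0]
      field_simp
      apply mul_left_cancel₀ hβ
      linear_combination h
    · simp [conicN]
      field_simp

/-- The first component of the restriction of the map to the conic, as a binary form. -/
def lR1 : SP E := [((0, 19, 0), -1), ((5, 14, 0), -171), ((10, 9, 0), -247), ((15, 4, 0), 57)]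

/-- The second component of the restriction of the map to the conic, as a binary form. -/
def lR2 : SP E := [((4, 15, 0), 57), ((9, 10, 0), 247), ((14, 5, 0), -171), ((19, 0, 0), 1)]

/-- The binary form of `lR1` as a function. -/
noncomputable def R1 (s t : ℂ) : ℂ :=
  -t ^ 19 - 171 * s ^ 5 * t ^ 14 - 247 * s ^ 10 * t ^ 9 + 57 * s ^ 15 * t ^ 4

/-- The binary form of `lR2` as a function. -/
noncomputable def R2 (s t : ℂ) : ℂ :=
  57 * s ^ 4 * t ^ 15 + 247 * s ^ 9 * t ^ 10 - 171 * s ^ 14 * t ^ 5 + s ^ 19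

theorem ev_lR1 (s t : ℂ) : ev toC ![s, t, 0] lR1 = R1 s t := by
  have h (n : ℕ) [n.AtLeastTwo] : toC (OfNat.ofNat n : E) = OfNat.ofNat n := map_ofNat toC n
  simp [lR1, R1, mon, h]
  ring

theorem ev_lR2 (s t : ℂ) : ev toC ![s, t, 0] lR2 = R2 s t := by
  have h (n : ℕ) [n.AtLeastTwo] : toC (OfNat.ofNat n : E) = OfNat.ofNat n := map_ofNat toC n
  simp [lR2, R2, mon, h]
  ring

/-- The element `β`. -/
def eβ : E := e (-1) (-1) 1 (-2)

/-- The factor by which the restriction of the map to the conic differs from the pair of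
binary forms. -/
def eκ : E := e (-486268515) (-272629233) 272629233 (-545258466)

/-- The parametrization of the conic. -/
def lN : Fin 3 → SP E := ![[((2, 0, 0), eβ)], [((0, 2, 0), -eβ)], [((1, 1, 0), 2)]]

theorem subst_lN (i : Fin 3) : same (subst (castE (lH i)) (lN 0) (lN 1) (lN 2))
    (scale eκ (subst (lN i) lR1 lR2 [])) = true := by
  revert i
  decide +kernel

theorem ev_lN (s t w : ℂ) (i : Fin 3) : ev toC ![s, t, w] (lN i) = conicN s t i := by
  have h : toC eβ = β := rfl
  fin_cases i <;> simp [lN, conicN, mon, h]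
  ring

/-- The map carries the conic to itself, by a binary form of degree 19. -/
theorem evalMap_hExplicit_conicN (s t : ℂ) :
    evalMap hExplicit (conicN s t) = toC eκ • conicN (R1 s t) (R2 s t) := by
  ext i
  have h := ev_eq_of_same toC ![s, t, 0] (subst_lN i)
  rw [ev_subst, ev_scale, ev_subst, ev_lR1, ev_lR2, ev_nil, ev_lN, ev_lN, ev_lN, ev_lN,
    ← evalMap_hExplicit] at h
  rw [Pi.smul_apply, smul_eq_mul, ← h]
  congr 1

theorem R_eq_zero {s t : ℂ} (h1 : R1 s t = 0) (h2 : R2 s t = 0) : s = 0 ∧ t = 0 := by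
  have ht : t = 0 := by
    by_contra ht
    by_cases hs : s = 0
    · subst hs
      simp [R1, ht] at h1
    · have p : 57 * s ^ 15 - 247 * s ^ 10 * t ^ 5 - 171 * s ^ 5 * t ^ 10 - t ^ 15 = 0 := by
        apply mul_left_cancel₀ (pow_ne_zero 4 ht)
        rw [R1] at h1
        linear_combination h1
      have q : s ^ 15 - 171 * s ^ 10 * t ^ 5 + 247 * s ^ 5 * t ^ 10 + 57 * t ^ 15 = 0 := by
        apply mul_left_cancel₀ (pow_ne_zero 4 hs)
        rw [R2] at h2
        linear_combination h2
      -- The resultant of the two cubic forms in `s⁵` and `t⁵` does not vanish.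
      have : 937500 * t ^ 25 = 0 := by
        linear_combination (133 * s ^ 10 - 22762 * s ^ 5 * t ^ 5 + 36117 * t ^ 10) * p +
          (-7581 * s ^ 10 + 33934 * s ^ 5 * t ^ 5 + 17081 * t ^ 10) * q
      simp [ht] at this
  subst ht
  simp [R2] at h2
  exact ⟨h2, rfl⟩

theorem eκ_ne_zero : toC eκ ≠ 0 := toC_ne_zero (by decide)

open Polynomial in
/-- The binary form of degree 19 is surjective on the projective line. -/
theorem exists_R_eq (u v : ℂ) (huv : u ≠ 0 ∨ v ≠ 0) :
    ∃ s t c : ℂ, (s ≠ 0 ∨ t ≠ 0) ∧ c ≠ 0 ∧ R1 s t = c * u ∧ R2 s t = c * v := by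
  obtain ⟨s, t, hst, h⟩ : ∃ s t : ℂ, (s ≠ 0 ∨ t ≠ 0) ∧ v * R1 s t = u * R2 s t := by
    by_cases hu : u = 0
    · subst hu
      have hv := huv.resolve_left (fun h => h rfl)
      have hd : (C (-1) * X ^ 19 - C 171 * X ^ 14 - C 247 * X ^ 9 + C 57 * X ^ 4 : ℂ[X]).degree =
          19 := by compute_degree!
      obtain ⟨t, ht⟩ := IsAlgClosed.exists_root
        (C (-1) * X ^ 19 - C 171 * X ^ 14 - C 247 * X ^ 9 + C 57 * X ^ 4 : ℂ[X])
        (by rw [hd]; decide)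
      refine ⟨1, t, Or.inl one_ne_zero, ?_⟩
      simp [IsRoot] at ht
      rw [R1]
      linear_combination v * ht
    · have hd : (C u * (X ^ 19 + C 57 * X ^ 4 + C 247 * X ^ 9 - C 171 * X ^ 14) -
          C v * (C 57 * X ^ 15 - C 171 * X ^ 5 - C 247 * X ^ 10 - 1) : ℂ[X]).degree = 19 := by
        compute_degree!
      obtain ⟨s, hs⟩ := IsAlgClosed.exists_root
        (C u * (X ^ 19 + C 57 * X ^ 4 + C 247 * X ^ 9 - C 171 * X ^ 14) -
          C v * (C 57 * X ^ 15 - C 171 * X ^ 5 - C 247 * X ^ 10 - 1) : ℂ[X]) (by rw [hd]; decide)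
      refine ⟨s, 1, Or.inr one_ne_zero, ?_⟩
      simp [IsRoot] at hs
      rw [R1, R2]
      linear_combination -hs
  have hR : R1 s t ≠ 0 ∨ R2 s t ≠ 0 := by
    by_contra! hR
    obtain ⟨h1, h2⟩ := R_eq_zero hR.1 hR.2
    rcases hst with hst | hst
    · exact hst h1
    · exact hst h2
  by_cases hu : u = 0
  · subst hu
    have hv := huv.resolve_left (fun h => h rfl)
    have h1 : R1 s t = 0 := by
      rw [zero_mul] at h
      exact (mul_eq_zero.1 h).resolve_left hv
    exact ⟨s, t, R2 s t / v, hst, div_ne_zero (hR.resolve_left fun h => h h1) hv,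
      by rw [h1, mul_zero], by field_simp⟩
  · have h2 : R2 s t = R1 s t / u * v := by
      field_simp
      linear_combination -h
    refine ⟨s, t, R1 s t / u, hst, div_ne_zero ?_ hu, by field_simp, h2⟩
    intro h1
    rw [h1, zero_div, zero_mul] at h2
    rcases hR with hR | hR
    · exact hR h1
    · exact hR h2

/-- A polynomial map preserves the cone over a conic, without base points, and is surjective on
it. -/
def PreservesCone (q : (Fin 3 → ℂ) → ℂ) (h : (Fin 3 → ℂ) → Fin 3 → ℂ) : Prop :=
  (∀ v, v ≠ 0 → q v = 0 → h v ≠ 0 ∧ q (h v) = 0) ∧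
    ∀ w, w ≠ 0 → q w = 0 → ∃ v, v ≠ 0 ∧ q v = 0 ∧ ∃ c : ℂ, c ≠ 0 ∧ h v = c • w

theorem preservesCone_conicQ : PreservesCone conicQ (evalMap hExplicit) := by
  constructor
  · intro v hv hq
    obtain ⟨s, t, rfl⟩ := exists_eq_conicN hq
    rw [evalMap_hExplicit_conicN]
    refine ⟨smul_ne_zero eκ_ne_zero fun h => hv ?_, by rw [conicQ_smul, conicQ_conicN, mul_zero]⟩
    obtain ⟨h1, h2⟩ := conicN_eq_zero h
    obtain ⟨rfl, rfl⟩ := R_eq_zero h1 h2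
    ext i
    fin_cases i <;> simp [conicN]
  · intro w hw hq
    obtain ⟨u, v, rfl⟩ := exists_eq_conicN hq
    have huv : u ≠ 0 ∨ v ≠ 0 := by
      by_contra! huv
      obtain ⟨rfl, rfl⟩ := huv
      apply hw
      ext i
      fin_cases i <;> simp [conicN]
    obtain ⟨s, t, c, hst, hc, h1, h2⟩ := exists_R_eq u v huv
    refine ⟨conicN s t, fun h => ?_, conicQ_conicN s t, toC eκ * c ^ 2,
      mul_ne_zero eκ_ne_zero (pow_ne_zero 2 hc), ?_⟩
    · obtain ⟨rfl, rfl⟩ := conicN_eq_zero h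
      simp at hst
    · rw [evalMap_hExplicit_conicN, h1, h2, conicN_mul, smul_smul]

/-! ### No common factor -/

theorem eval_aeval_polynomial (p : Poly) (u : Fin 3 → Polynomial ℂ) (x : ℂ) :
    (MvPolynomial.aeval u p).eval x = MvPolynomial.eval (fun i => (u i).eval x) p := by
  induction p using MvPolynomial.induction_on with
  | C a => simp
  | add p q hp hq => simp [hp, hq]
  | mul_X p i hp => simp [hp]

/-- Along a polynomial curve on which it has no zero, a polynomial is constant. -/
theorem eval_eq_of_forall_ne_zero (p : Poly) (u : Fin 3 → Polynomial ℂ)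
    (h : ∀ x : ℂ, MvPolynomial.eval (fun i => (u i).eval x) p ≠ 0) (x y : ℂ) :
    MvPolynomial.eval (fun i => (u i).eval x) p = MvPolynomial.eval (fun i => (u i).eval y) p := by
  have h2 : (MvPolynomial.aeval u p).degree = 0 := by
    by_contra h2
    obtain ⟨x, hx⟩ := IsAlgClosed.exists_root _ h2
    exact h x ((eval_aeval_polynomial p u x).symm.trans hx)
  rw [← eval_aeval_polynomial, ← eval_aeval_polynomial, Polynomial.eq_C_of_degree_eq_zero h2,
    Polynomial.eval_C, Polynomial.eval_C]

theorem poly_isHomogeneous {d : ℕ} {l : SP ℤ} (h : IsHom d l) : (poly l).IsHomogeneous d := by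
  induction l with
  | nil => simpa [toPoly] using MvPolynomial.isHomogeneous_zero (Fin 3) ℂ d
  | cons t l ih =>
    obtain ⟨h1, h2⟩ := isHom_cons.1 h
    refine MvPolynomial.IsHomogeneous.add ?_ (ih h2)
    have := (MvPolynomial.isHomogeneous_C (Fin 3) (t.2 : ℂ)).mul
      ((((MvPolynomial.isHomogeneous_X ℂ (0 : Fin 3)).pow t.1.1).mul
      ((MvPolynomial.isHomogeneous_X ℂ (1 : Fin 3)).pow t.1.2.1)).mul
      ((MvPolynomial.isHomogeneous_X ℂ (2 : Fin 3)).pow t.1.2.2))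
    rw [zero_add, one_mul, one_mul, one_mul, h1] at this
    exact this

theorem hExplicit_isHomogeneous (i : Fin 3) : (hExplicit i).IsHomogeneous 19 := by
  rw [hExplicit_eq]
  exact poly_isHomogeneous (by revert i; decide +kernel)

theorem evalMap_smul {h : Fin 3 → Poly} {d : ℕ} (hh : ∀ i, (h i).IsHomogeneous d) (c : ℂ)
    (v : Fin 3 → ℂ) : evalMap h (c • v) = c ^ d • evalMap h v :=
  funext fun i => eval_smul_of_isHomogeneous (hh i) c v

/-- A common factor has no zero on the cone over the conic outside the origin, and this cone is
covered by an affine plane: hence it does not vanish at the origin. But then it is constant on each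
line on which the map is not zero. -/
theorem isUnit_of_dvd_hExplicit {p : Poly} (hp : ∀ i, p ∣ hExplicit i) : IsUnit p := by
  have hv (v : Fin 3 → ℂ) (hv : evalMap hExplicit v ≠ 0) : MvPolynomial.eval v p ≠ 0 := by
    intro h0
    apply hv
    ext i
    obtain ⟨r, hr⟩ := hp i
    rw [evalMap, hr, map_mul, h0, zero_mul, Pi.zero_apply]
  set P : ℂ → ℂ → ℂ := fun s t => MvPolynomial.eval (conicN s t) p with hP
  have hst (s t : ℂ) (h : s ≠ 0 ∨ t ≠ 0) : P s t ≠ 0 := by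
    apply hv
    refine (preservesCone_conicQ.1 _ (fun h0 => ?_) (conicQ_conicN s t)).1
    obtain ⟨rfl, rfl⟩ := conicN_eq_zero h0
    simp at h
  have h1 (s s' t : ℂ) (ht : t ≠ 0) : P s t = P s' t := by
    set u : Fin 3 → Polynomial ℂ := ![Polynomial.C β * Polynomial.X ^ 2, Polynomial.C (-β * t ^ 2),
      Polynomial.C (2 * t) * Polynomial.X] with hu
    have e (x : ℂ) : (fun i => (u i).eval x) = conicN x t := by
      ext i
      fin_cases i <;> simp [hu, conicN]
      ring
    have := eval_eq_of_forall_ne_zero p u (fun x => by rw [e]; exact hst x t (Or.inr ht)) s s'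
    rwa [e, e] at this
  have h2 (s t t' : ℂ) (hs : s ≠ 0) : P s t = P s t' := by
    set u : Fin 3 → Polynomial ℂ :=
      ![Polynomial.C (β * s ^ 2), Polynomial.C (-β) * Polynomial.X ^ 2,
        Polynomial.C (2 * s) * Polynomial.X] with hu
    have e (x : ℂ) : (fun i => (u i).eval x) = conicN s x := by
      ext i
      fin_cases i <;> simp [hu, conicN]
    have := eval_eq_of_forall_ne_zero p u (fun x => by rw [e]; exact hst s x (Or.inl hs)) t t'
    rwa [e, e] at this
  have h3 : MvPolynomial.eval 0 p ≠ 0 := by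
    set u : Fin 3 → Polynomial ℂ := ![0, Polynomial.C (-β) * Polynomial.X ^ 2, 0] with hu
    have e (x : ℂ) : (fun i => (u i).eval x) = conicN 0 x := by
      ext i
      fin_cases i <;> simp [hu, conicN]
    have h4 : (MvPolynomial.aeval u p - Polynomial.C (P 1 0)) * Polynomial.X = 0 := by
      apply Polynomial.funext
      intro x
      rcases eq_or_ne x 0 with rfl | hx
      · simp
      · have : P 0 x = P 1 0 := (h1 0 1 x hx).trans (h2 1 x 0 one_ne_zero)
        rw [Polynomial.eval_mul, Polynomial.eval_sub, eval_aeval_polynomial, e]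
        change (P 0 x - _) * _ = _
        simp [this]
    have h5 := (mul_eq_zero.1 h4).resolve_right Polynomial.X_ne_zero
    have h6 := congrArg (Polynomial.eval 0) h5
    rw [Polynomial.eval_sub, eval_aeval_polynomial, e, Polynomial.eval_C,
      Polynomial.eval_zero] at h6
    have h7 : conicN 0 0 = 0 := by
      ext i
      fin_cases i <;> simp [conicN]
    rw [h7] at h6
    rw [sub_eq_zero.1 h6]
    exact hst 1 0 (Or.inl one_ne_zero)
  have h4 (v : Fin 3 → ℂ) (h : evalMap hExplicit v ≠ 0) :
      MvPolynomial.eval v p = MvPolynomial.eval 0 p := by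
    set u : Fin 3 → Polynomial ℂ := fun i => Polynomial.C (v i) * Polynomial.X with hu
    have e (x : ℂ) : (fun i => (u i).eval x) = x • v := by
      ext i
      change (Polynomial.C (v i) * Polynomial.X).eval x = x * v i
      rw [Polynomial.eval_mul, Polynomial.eval_C, Polynomial.eval_X, mul_comm]
    have := eval_eq_of_forall_ne_zero p u (fun x => by
      rw [e]
      rcases eq_or_ne x 0 with rfl | hx
      · rwa [zero_smul]
      · apply hv
        rw [evalMap_smul hExplicit_isHomogeneous]
        exact smul_ne_zero (pow_ne_zero _ hx) h) 1 0
    rwa [e, e, one_smul, zero_smul] at this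
  obtain ⟨i, hi⟩ : ∃ i, hExplicit i ≠ 0 := by
    by_contra! h
    have h5 := (preservesCone_conicQ.1 (conicN 1 0) (fun h0 => one_ne_zero (conicN_eq_zero h0).1)
      (conicQ_conicN 1 0)).1
    apply h5
    ext i
    rw [evalMap, h i, map_zero, Pi.zero_apply]
  have h5 : (p - MvPolynomial.C (MvPolynomial.eval 0 p)) * hExplicit i = 0 := by
    apply MvPolynomial.funext
    intro v
    rw [map_mul, map_sub, MvPolynomial.eval_C, map_zero]
    by_cases h : evalMap hExplicit v = 0
    · have : MvPolynomial.eval v (hExplicit i) = 0 := congrFun h i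
      rw [this, mul_zero]
    · rw [h4 v h, sub_self, zero_mul]
  rw [sub_eq_zero.1 ((mul_eq_zero.1 h5).resolve_right hi)]
  exact (isUnit_iff_ne_zero.2 h3).map MvPolynomial.C

/-! ### The map in the original coordinates -/

/-- The explicit map, read in the coordinates `x`. -/
noncomputable def hX : Fin 3 → Poly := postcomp glA (precomp hExplicit glA⁻¹)

theorem evalMap_postcomp (g : GL (Fin 3) ℂ) (h : Fin 3 → Poly) (v : Fin 3 → ℂ) :
    evalMap (postcomp g h) v = (g : Matrix (Fin 3) (Fin 3) ℂ) *ᵥ evalMap h v := by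
  ext i
  simp [evalMap, postcomp, Matrix.mulVec, dotProduct]

theorem evalMap_precomp (g : GL (Fin 3) ℂ) (h : Fin 3 → Poly) (v : Fin 3 → ℂ) :
    evalMap (precomp h g) v = evalMap h ((g : Matrix (Fin 3) (Fin 3) ℂ) *ᵥ v) :=
  funext fun i => eval_precompPoly g (h i) v

theorem evalMap_injective {h h' : Fin 3 → Poly} (H : ∀ v, evalMap h v = evalMap h' v) : h = h' :=
  funext fun i => MvPolynomial.funext fun v => congrFun (H v) i

theorem inv_mulVec_mulVec (g : GL (Fin 3) ℂ) (v : Fin 3 → ℂ) :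
    ((g⁻¹ : GL (Fin 3) ℂ) : Matrix (Fin 3) (Fin 3) ℂ) *ᵥ
      ((g : Matrix (Fin 3) (Fin 3) ℂ) *ᵥ v) = v := by
  rw [Matrix.mulVec_mulVec, ← Units.val_mul, inv_mul_cancel, Units.val_one, Matrix.one_mulVec]

theorem mulVec_inv_mulVec (g : GL (Fin 3) ℂ) (v : Fin 3 → ℂ) :
    (g : Matrix (Fin 3) (Fin 3) ℂ) *ᵥ
      (((g⁻¹ : GL (Fin 3) ℂ) : Matrix (Fin 3) (Fin 3) ℂ) *ᵥ v) = v := by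
  rw [Matrix.mulVec_mulVec, ← Units.val_mul, mul_inv_cancel, Units.val_one, Matrix.one_mulVec]

theorem mulVec_eq_zero_iff (g : GL (Fin 3) ℂ) {v : Fin 3 → ℂ} :
    (g : Matrix (Fin 3) (Fin 3) ℂ) *ᵥ v = 0 ↔ v = 0 := by
  constructor
  · intro h
    rw [← inv_mulVec_mulVec g v, h, Matrix.mulVec_zero]
  · rintro rfl
    exact Matrix.mulVec_zero _

theorem evalMap_hX (v : Fin 3 → ℂ) : evalMap hX (matA *ᵥ v) = matA *ᵥ evalMap hExplicit v := by
  rw [hX, evalMap_postcomp, evalMap_precomp, ← coe_glA, inv_mulVec_mulVec]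

theorem precompPoly_isHomogeneous {d : ℕ} {q : Poly} (hq : q.IsHomogeneous d) (g : GL (Fin 3) ℂ) :
    (precompPoly g q).IsHomogeneous d := by
  rw [precompPoly]
  have := hq.aeval (fun i => ∑ j, MvPolynomial.C (g i j) * (MvPolynomial.X j : Poly)) (n := 1)
    fun i => MvPolynomial.IsHomogeneous.sum _ _ _ fun j _ => by
      have := (MvPolynomial.isHomogeneous_C (Fin 3) (g i j)).mul
        (MvPolynomial.isHomogeneous_X ℂ j)
      rwa [zero_add] at this
  rwa [one_mul] at this

theorem postcomp_isHomogeneous {d : ℕ} {h : Fin 3 → Poly} (hh : ∀ i, (h i).IsHomogeneous d)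
    (g : GL (Fin 3) ℂ) (i : Fin 3) : (postcomp g h i).IsHomogeneous d :=
  MvPolynomial.IsHomogeneous.sum _ _ _ fun j _ => by
    have := (MvPolynomial.isHomogeneous_C (Fin 3) (g i j)).mul (hh j)
    rwa [zero_add] at this

theorem isRationalMap_hX : IsRationalMap 19 hX := by
  constructor
  · exact postcomp_isHomogeneous
      (fun i => precompPoly_isHomogeneous (hExplicit_isHomogeneous i) _) _
  · intro p hp
    have h1 : hExplicit = postcomp glA⁻¹ (precomp hX glA) := evalMap_injective fun v => by
      rw [evalMap_postcomp, evalMap_precomp, coe_glA, evalMap_hX, ← coe_glA, inv_mulVec_mulVec]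
    have h2 : IsUnit (lin matA p) := by
      apply isUnit_of_dvd_hExplicit
      intro i
      rw [h1]
      exact Finset.dvd_sum fun j _ => Dvd.dvd.mul_left (map_dvd (lin matA) (hp j)) _
    have h3 := h2.map (lin ((glA⁻¹ : GL (Fin 3) ℂ) : Matrix (Fin 3) (Fin 3) ℂ))
    rwa [lin_mul, ← coe_glA, ← Units.val_mul, mul_inv_cancel, Units.val_one, lin_one] at h3

theorem evalMap_hExplicit_conj (v : Fin 3 → ℂ) :
    evalMap hExplicit (fun i => conj (v i)) = fun i => conj (evalMap hExplicit v i) := by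
  ext i
  rw [evalMap, evalMap, hExplicit_eq, eval_toPoly, eval_toPoly, map_ev]
  congr 1
  exact Subsingleton.elim _ _

theorem map_conj_mulVec (M : Matrix (Fin 3) (Fin 3) ℂ) (v : Fin 3 → ℂ) :
    (fun i => conj ((M *ᵥ v) i)) = M.map conj *ᵥ fun i => conj (v i) := by
  ext i
  simp [Matrix.mulVec, dotProduct]

theorem matB_mul_conj_matA : matB * matA.map conj = (2 : ℂ) • matA := eB_mul_conj_matA

/-- The map commutes with the complex conjugation of the coordinates `y`. -/
theorem evalMap_hX_conj (v : Fin 3 → ℂ) : evalMap hX (matB *ᵥ fun i => conj (v i)) =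
    (2 : ℂ) ^ 18 • (matB *ᵥ fun i => conj (evalMap hX v i)) := by
  obtain ⟨w, rfl⟩ : ∃ w, matA *ᵥ w = v := ⟨_, mulVec_inv_mulVec glA v⟩
  rw [evalMap_hX, map_conj_mulVec, map_conj_mulVec, Matrix.mulVec_mulVec, Matrix.mulVec_mulVec,
    matB_mul_conj_matA, Matrix.smul_mulVec, Matrix.smul_mulVec, ← Matrix.mulVec_smul, evalMap_hX,
    evalMap_smul hExplicit_isHomogeneous, evalMap_hExplicit_conj, smul_smul, Matrix.mulVec_smul]
  norm_num

/-- Transport of the preservation of a cone along a bijection that is linear or conjugate linear. -/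
theorem PreservesCone.transport {q q' : (Fin 3 → ℂ) → ℂ} {h h' : (Fin 3 → ℂ) → Fin 3 → ℂ}
    (H : PreservesCone q h) (T : (Fin 3 → ℂ) → Fin 3 → ℂ) (hT : Function.Surjective T)
    (hT0 : ∀ v, T v = 0 ↔ v = 0) (f : ℂ → ℂ) (hf : ∀ c, c ≠ 0 → f c ≠ 0)
    (hTs : ∀ c v, T (c • v) = f c • T v) (hq : ∀ v, q' (T v) = 0 ↔ q v = 0)
    (hq' : ∀ (c : ℂ) v, q' v = 0 → q' (c • v) = 0)
    (hh : ∀ v, ∃ c : ℂ, c ≠ 0 ∧ h' (T v) = c • T (h v)) : PreservesCone q' h' := by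
  constructor
  · intro v hv hqv
    obtain ⟨w, rfl⟩ := hT v
    obtain ⟨h1, h2⟩ := H.1 w (fun hw => hv ((hT0 w).2 hw)) ((hq w).1 hqv)
    obtain ⟨c, hc, h3⟩ := hh w
    rw [h3]
    exact ⟨smul_ne_zero hc fun h4 => h1 ((hT0 _).1 h4), hq' _ _ ((hq _).2 h2)⟩
  · intro w hw hqw
    obtain ⟨u, rfl⟩ := hT w
    obtain ⟨v, hv, hqv, c, hc, h1⟩ := H.2 u (fun hu => hw ((hT0 u).2 hu)) ((hq u).1 hqw)
    obtain ⟨d, hd, h2⟩ := hh v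
    refine ⟨T v, fun h3 => hv ((hT0 v).1 h3), (hq v).2 hqv, d * f c, mul_ne_zero hd (hf c hc), ?_⟩
    rw [h2, h1, hTs, smul_smul]

/-- The value of the quadratic form with a given Gram matrix. -/
noncomputable def qf (M : Matrix (Fin 3) (Fin 3) ℂ) (v : Fin 3 → ℂ) : ℂ := v ⬝ᵥ (M *ᵥ v)

theorem qf_smul (M : Matrix (Fin 3) (Fin 3) ℂ) (c : ℂ) (v : Fin 3 → ℂ) :
    qf M (c • v) = c ^ 2 * qf M v := by
  rw [qf, qf, Matrix.mulVec_smul, dotProduct_smul, smul_dotProduct, smul_smul, smul_eq_mul, pow_two]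

theorem qf_mulVec (M T : Matrix (Fin 3) (Fin 3) ℂ) (v : Fin 3 → ℂ) :
    qf M (T *ᵥ v) = qf (Tᵀ * M * T) v := by
  rw [qf, qf, ← Matrix.mulVec_mulVec, ← Matrix.mulVec_mulVec, Matrix.dotProduct_mulVec v,
    Matrix.vecMul_transpose]

theorem qf_matrix_smul (M : Matrix (Fin 3) (Fin 3) ℂ) (c : ℂ) (v : Fin 3 → ℂ) :
    qf (c • M) v = c * qf M v := by
  rw [qf, qf, Matrix.smul_mulVec, dotProduct_smul, smul_eq_mul]

theorem qf_conj (M : Matrix (Fin 3) (Fin 3) ℂ) (v : Fin 3 → ℂ) :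
    qf (M.map conj) (fun i => conj (v i)) = conj (qf M v) := by
  rw [qf, ← map_conj_mulVec, qf]
  simp [dotProduct]

theorem qf_fam_zero_zero_matA (v : Fin 3 → ℂ) :
    qf (fam 0 0) (matA *ᵥ v) = 4 * (τ + 2) * conicQ v := by
  rw [qf_mulVec, fam_zero_zero, Matrix.mul_smul, Matrix.smul_mul, Matrix.mul_one,
    matA_transpose_mul_self, qf_matrix_smul, qf_matrix_smul, mul_assoc]
  congr 2
  simp [qf, conicQ, dotProduct, Matrix.mulVec, Fin.sum_univ_three]
  ring

theorem mulVec_surjective (g : GL (Fin 3) ℂ) :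
    Function.Surjective fun v => (g : Matrix (Fin 3) (Fin 3) ℂ) *ᵥ v :=
  fun v => ⟨_, mulVec_inv_mulVec g v⟩

theorem preservesCone_fam_zero_zero : PreservesCone (qf (fam 0 0)) (evalMap hX) := by
  refine preservesCone_conicQ.transport (fun v => matA *ᵥ v) (mulVec_surjective glA)
    (fun v => mulVec_eq_zero_iff glA) id (fun c hc => hc) (fun c v => Matrix.mulVec_smul _ _ _)
    (fun v => ?_) (fun c v h => by rw [qf_smul, h, mul_zero])
    fun v => ⟨1, one_ne_zero, by rw [one_smul]; exact evalMap_hX v⟩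
  simp only [qf_fam_zero_zero_matA]
  simp [tau_add_two_ne_zero]

theorem preservesCone_fam_one_zero : PreservesCone (qf (fam 1 0)) (evalMap hX) := by
  refine preservesCone_fam_zero_zero.transport (fun v => matB *ᵥ fun i => conj (v i)) ?_ ?_ conj
    (fun c hc => (map_ne_zero _).2 hc) ?_ ?_ (fun c v h => by rw [qf_smul, h, mul_zero])
    fun v => ⟨2 ^ 18, by norm_num, evalMap_hX_conj v⟩
  · intro v
    obtain ⟨w, hw⟩ := mulVec_surjective glB v
    refine ⟨fun i => conj (w i), ?_⟩
    simpa using hw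
  · intro v
    rw [← coe_glB, mulVec_eq_zero_iff]
    constructor
    · intro h
      ext i
      simpa using congrFun h i
    · rintro rfl
      ext i
      simp
  · intro c v
    rw [← Matrix.mulVec_smul]
    congr 1
    ext i
    simp
  · intro v
    obtain ⟨c, hc, h⟩ := matB_fam 0 0
    rw [sub_zero] at h
    rw [qf_mulVec, h, qf_matrix_smul, qf_conj]
    simp [hc]

/-! ### Semi-invariant forms -/

/-- A form that the generators preserve up to scalars is preserved up to scalars by the group. -/
theorem semi_invariant_of_generators {q : Poly} {d : ℕ} (hq : q.IsHomogeneous d)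
    (h : ∀ a, ∃ c : ℂ, c ≠ 0 ∧ lin (matG a) q = MvPolynomial.C c * q) (g : GL (Fin 3) ℂ)
    (hg : mk g ∈ V) : ∃ c : ℂ, c ≠ 0 ∧ precompPoly g q = MvPolynomial.C c * q := by
  have scal {g h : GL (Fin 3) ℂ} (hgh : mk g = mk h)
      (hg : ∃ c : ℂ, c ≠ 0 ∧ precompPoly g q = MvPolynomial.C c * q) :
      ∃ c : ℂ, c ≠ 0 ∧ precompPoly h q = MvPolynomial.C c * q := by
    obtain ⟨c, hc, h1⟩ := mk_eq_mk_iff_smul.1 hgh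
    obtain ⟨b, hb, h2⟩ := hg
    refine ⟨c ^ d * b, mul_ne_zero (pow_ne_zero d hc) hb, ?_⟩
    rw [precompPoly_eq_lin, h1, lin_smul hq, ← precompPoly_eq_lin, h2, map_mul, mul_assoc]
  obtain ⟨p, hp⟩ : ∃ p, p = mk g := ⟨_, rfl⟩
  rw [← hp, V_eq_closure] at hg
  induction hg using Subgroup.closure_induction generalizing g with
  | mem p hp' =>
    obtain ⟨a, rfl⟩ := hp'
    exact scal (g := glG a) hp (h a)
  | one =>
    refine scal (g := 1) (by rw [← hp]; rfl) ⟨1, one_ne_zero, ?_⟩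
    rw [precompPoly_eq_lin, Units.val_one, lin_one, map_one, one_mul]
  | mul p r _ _ hp' hr =>
    obtain ⟨p', rfl⟩ := Matrix.ProjGenLinGroup.mk_surjective p
    obtain ⟨r', rfl⟩ := Matrix.ProjGenLinGroup.mk_surjective r
    obtain ⟨c, hc, h1⟩ := hp' p' rfl
    obtain ⟨b, hb, h2⟩ := hr r' rfl
    refine scal (g := p' * r') (by rw [← hp, map_mul]) ⟨c * b, mul_ne_zero hc hb, ?_⟩
    rw [precompPoly_eq_lin] at h1 h2 ⊢
    rw [Units.val_mul, ← lin_mul, h1, map_mul, lin_C, h2, map_mul, mul_assoc]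
  | inv p _ hp' =>
    obtain ⟨c, hc, h1⟩ := hp' g⁻¹ (by rw [map_inv, ← hp, inv_inv])
    refine ⟨c⁻¹, inv_ne_zero hc, ?_⟩
    rw [precompPoly_eq_lin] at h1 ⊢
    have h2 := congrArg (fun r => MvPolynomial.C c⁻¹ * lin g r) h1
    simp only [lin_mul, map_mul, lin_C] at h2
    rw [← Units.val_mul, inv_mul_cancel, Units.val_one, lin_one, ← mul_assoc, ← map_mul,
      inv_mul_cancel₀ hc, map_one, one_mul] at h2
    exact h2.symm

/-! ### The sextic in the original coordinates -/

/-- The linear form `x₂ - τ x₁`. -/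
def lP : SP E := [((0, 1, 0), 1), ((1, 0, 0), e 0 (-1) 0 0)]

/-- The linear form `x₁ + τ x₂`. -/
def lW : SP E := [((0, 1, 0), e 0 1 0 0), ((1, 0, 0), 1)]

/-- The quadratic form `(x₂ - τ x₁)² + (τ + 2) x₃²`. -/
def lE : SP E := add (mul lP lP) [((0, 0, 2), e 2 1 0 0)]

/-- A multiple of the sextic `F`, in the coordinates `x`. -/
def lFx : SP E :=
  add (scale (10 * eβ ^ 6) (pow lE 3)) (add
    (scale (9 * eβ ^ 5) (mul lW (add (scale 64 (pow lP 5)) (add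
      (scale (-80) (mul (pow lP 3) lE)) (scale 20 (mul lP (pow lE 2))))))) (add
    (scale (-180 * eβ ^ 4) (mul (pow lE 2) (pow lW 2))) (add
    (scale (-2160 * eβ ^ 2) (mul lE (pow lW 4))) (scale 1728 (pow lW 6)))))

theorem eval_F (y : Fin 3 → ℂ) : MvPolynomial.eval y F = 10 * y 0 ^ 3 * y 1 ^ 3 +
    9 * y 0 ^ 5 * y 2 + 9 * y 1 ^ 5 * y 2 - 45 * y 0 ^ 2 * y 1 ^ 2 * y 2 ^ 2 -
    135 * y 0 * y 1 * y 2 ^ 4 + 27 * y 2 ^ 6 := by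
  simp [F]

theorem ev_lFx (y : Fin 3 → ℂ) :
    ev toC (matA *ᵥ y) lFx = 64 * β ^ 6 * (τ + 2) ^ 6 * MvPolynomial.eval y F := by
  have hτ := tau_mul_self
  have hb : toC eβ = β := rfl
  have h0 : (matA *ᵥ y) 0 = -τ * y 0 - τ * y 1 + β * y 2 := by
    simp [matA, Matrix.mulVec, dotProduct, Fin.sum_univ_three]
    ring
  have h1 : (matA *ᵥ y) 1 = y 0 + y 1 + β * τ * y 2 := by
    simp [matA, Matrix.mulVec, dotProduct, Fin.sum_univ_three]
  have h2 : (matA *ᵥ y) 2 = σ * (y 0 - y 1) := by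
    simp [matA, Matrix.mulVec, dotProduct, Fin.sum_univ_three]
    ring
  have eP : ev toC (matA *ᵥ y) lP = (τ + 2) * (y 0 + y 1) := by
    simp [lP, mon, toC_e, h0, h1]
    linear_combination (y 0 + y 1) * hτ
  have eW : ev toC (matA *ᵥ y) lW = (τ + 2) * (β * y 2) := by
    simp [lW, mon, toC_e, h0, h1]
    linear_combination (β * y 2) * hτ
  have eE : ev toC (matA *ᵥ y) lE = (τ + 2) ^ 2 * (4 * y 0 * y 1) := by
    rw [lE, ev_add, ev_mul, eP]
    simp [mon, toC_e, h2]
    linear_combination (τ + 2) * (y 0 - y 1) ^ 2 * sigma_sq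
  rw [lFx]
  simp only [ev_add, ev_scale, ev_mul, ev_pow, eP, eW, eE, map_mul, map_pow, map_neg, hb, eval_F,
    show toC 10 = 10 from map_ofNat toC 10, show toC 9 = 9 from map_ofNat toC 9,
    show toC 64 = 64 from map_ofNat toC 64, show toC 80 = 80 from map_ofNat toC 80,
    show toC 20 = 20 from map_ofNat toC 20, show toC 180 = 180 from map_ofNat toC 180,
    show toC 2160 = 2160 from map_ofNat toC 2160, show toC 1728 = 1728 from map_ofNat toC 1728]
  ring

theorem lFx_invariant (a : Fin 3) :
    same (subst lFx [((1, 0, 0), eG a 0 0), ((0, 1, 0), eG a 0 1), ((0, 0, 1), eG a 0 2)]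
      [((1, 0, 0), eG a 1 0), ((0, 1, 0), eG a 1 1), ((0, 0, 1), eG a 1 2)]
      [((1, 0, 0), eG a 2 0), ((0, 1, 0), eG a 2 1), ((0, 0, 1), eG a 2 2)])
      (scale 64 lFx) = true := by
  revert a
  decide +kernel

theorem F_isHomogeneous : F.IsHomogeneous 6 := by
  rw [F_eq]
  exact poly_isHomogeneous (by decide +kernel)

/-- The sextic in the coordinates `x`. -/
noncomputable def FX : Poly := precompPoly glA⁻¹ F

theorem FX_isHomogeneous : FX.IsHomogeneous 6 := precompPoly_isHomogeneous F_isHomogeneous _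

theorem ev_lFx_eq (v : Fin 3 → ℂ) :
    ev toC v lFx = 64 * β ^ 6 * (τ + 2) ^ 6 * MvPolynomial.eval v FX := by
  rw [FX, eval_precompPoly, ← ev_lFx, ← coe_glA, mulVec_inv_mulVec]

theorem lin_matG_FX (a : Fin 3) : lin (matG a) FX = FX := by
  apply MvPolynomial.funext
  intro v
  have h1 := ev_eq_of_same toC v (lFx_invariant a)
  have h2 (i : Fin 3) :
      ev toC v [((1, 0, 0), eG a i 0), ((0, 1, 0), eG a i 1), ((0, 0, 1), eG a i 2)] =
      ((2 : ℂ) • (matG a *ᵥ v)) i := by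
    rw [← Matrix.smul_mulVec, ← eG_map]
    simp [mon, Matrix.mulVec, dotProduct, Fin.sum_univ_three, add_assoc]
  rw [ev_subst, ev_scale, h2, h2, h2] at h1
  have h3 : ![((2 : ℂ) • (matG a *ᵥ v)) 0, ((2 : ℂ) • (matG a *ᵥ v)) 1,
      ((2 : ℂ) • (matG a *ᵥ v)) 2] = (2 : ℂ) • (matG a *ᵥ v) := by
    ext i
    fin_cases i <;> rfl
  rw [h3, ev_lFx_eq, ev_lFx_eq, eval_smul_of_isHomogeneous FX_isHomogeneous,
    show toC 64 = 64 from map_ofNat toC 64] at h1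
  rw [eval_lin]
  have h4 : 64 * (64 * β ^ 6 * (τ + 2) ^ 6) ≠ 0 := by simp [beta_ne_zero, tau_add_two_ne_zero]
  apply mul_left_cancel₀ h4
  linear_combination h1

theorem FX_semi_invariant (g : GL (Fin 3) ℂ) (hg : mk g ∈ V) :
    ∃ c : ℂ, c ≠ 0 ∧ precompPoly g FX = MvPolynomial.C c * FX :=
  semi_invariant_of_generators FX_isHomogeneous
    (fun a => ⟨1, one_ne_zero, by rw [lin_matG_FX, map_one, one_mul]⟩) g hg

theorem F_semi_invariant (g : GL (Fin 3) ℂ) (hg : MemVIn glA g) :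
    ∃ c : ℂ, c ≠ 0 ∧ precompPoly g F = MvPolynomial.C c * F := by
  obtain ⟨c, hc, h⟩ := FX_semi_invariant _ hg
  refine ⟨c, hc, ?_⟩
  have h2 := congrArg (lin glA) h
  rw [FX, precompPoly_eq_lin, precompPoly_eq_lin, lin_mul, lin_mul, map_mul, lin_C, lin_mul,
    ← Units.val_mul, ← Units.val_mul, ← Units.val_mul] at h2
  have e1 : glA⁻¹ * (glA * g * glA⁻¹ * glA) = g := by group
  rwa [e1, inv_mul_cancel, Units.val_one, lin_one] at h2

/-! ### Equivariance -/

/-- The explicit map is a covariant of the sextic: after a rescaling of the linear map, it is the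
covariance of the classical constructions in terms of the sextic. -/
theorem evalMap_hExplicit_mulVec {k : GL (Fin 3) ℂ} {c : ℂ} (hc : c ≠ 0)
    (h : precompPoly k F = MvPolynomial.C c * F) : ∃ d : ℂ, d ≠ 0 ∧ ∀ v,
      evalMap hExplicit ((k : Matrix (Fin 3) (Fin 3) ℂ) *ᵥ v) =
        d • ((k : Matrix (Fin 3) (Fin 3) ℂ) *ᵥ evalMap hExplicit v) := by
  obtain ⟨l, hl⟩ := IsAlgClosed.exists_pow_nat_eq c⁻¹ (n := 6) (by norm_num)
  have hl0 : l ≠ 0 := by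
    rintro rfl
    rw [zero_pow (by norm_num)] at hl
    exact inv_ne_zero hc hl.symm
  have h1 : lin (l • (k : Matrix (Fin 3) (Fin 3) ℂ)) F = F := by
    rw [lin_smul F_isHomogeneous, hl, ← precompPoly_eq_lin, h, ← mul_assoc, ← map_mul,
      inv_mul_cancel₀ hc, map_one, one_mul]
  have h2 (v : Fin 3 → ℂ) : evalMap hExplicit ((l • (k : Matrix (Fin 3) (Fin 3) ℂ)) *ᵥ v) =
      (l • (k : Matrix (Fin 3) (Fin 3) ℂ)) *ᵥ evalMap hExplicit v := by
    ext i
    have h3 := congrArg (MvPolynomial.eval v) (lin_hExplicit h1 i)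
    rw [eval_lin] at h3
    rw [evalMap, h3]
    simp [Matrix.mulVec, dotProduct, cmat, evalMap]
  refine ⟨(l ^ 19)⁻¹ * l, mul_ne_zero (inv_ne_zero (pow_ne_zero _ hl0)) hl0, fun v => ?_⟩
  have h3 := h2 v
  rw [Matrix.smul_mulVec, Matrix.smul_mulVec, evalMap_smul hExplicit_isHomogeneous] at h3
  rw [mul_smul, ← h3, smul_smul, inv_mul_cancel₀ (pow_ne_zero _ hl0), one_smul]

theorem evalMap_hX_mulVec {g : GL (Fin 3) ℂ} (hg : mk g ∈ V) : ∃ d : ℂ, d ≠ 0 ∧ ∀ v,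
    evalMap hX ((g : Matrix (Fin 3) (Fin 3) ℂ) *ᵥ v) =
      d • ((g : Matrix (Fin 3) (Fin 3) ℂ) *ᵥ evalMap hX v) := by
  obtain ⟨c, hc, h⟩ := F_semi_invariant (glA⁻¹ * g * glA) (by
    rw [MemVIn]
    have e1 : glA * (glA⁻¹ * g * glA) * glA⁻¹ = g := by group
    rwa [e1])
  obtain ⟨d, hd, h1⟩ := evalMap_hExplicit_mulVec hc h
  refine ⟨d, hd, fun v => ?_⟩
  obtain ⟨w, rfl⟩ := mulVec_surjective glA v
  have h2 (w : Fin 3 → ℂ) : (g : Matrix (Fin 3) (Fin 3) ℂ) *ᵥ (matA *ᵥ w) =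
      matA *ᵥ (((glA⁻¹ * g * glA : GL (Fin 3) ℂ) : Matrix (Fin 3) (Fin 3) ℂ) *ᵥ w) := by
    rw [← coe_glA, Matrix.mulVec_mulVec, Matrix.mulVec_mulVec, ← Units.val_mul, ← Units.val_mul]
    congr 2
    group
  simp only [coe_glA]
  rw [h2, evalMap_hX, h1, Matrix.mulVec_smul, ← h2, evalMap_hX]

theorem isEquivariant_hX : IsEquivariant V hX := by
  intro g hg
  obtain ⟨d, hd, h⟩ := evalMap_hX_mulVec hg
  refine ⟨d, hd, evalMap_injective fun v => ?_⟩
  rw [evalMap_precomp, h, ← evalMap_postcomp]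
  ext i
  simp [evalMap]

/-! ### The map preserves the twelve conics -/

theorem preservesCone_fam (k : Fin 2) (i : Fin 6) : PreservesCone (qf (fam k i)) (evalMap hX) := by
  have h0 : PreservesCone (qf (fam k 0)) (evalMap hX) := by
    fin_cases k
    · exact preservesCone_fam_zero_zero
    · exact preservesCone_fam_one_zero
  obtain ⟨g, hg, hi⟩ := exists_permHom_apply_eq k i
  obtain ⟨c, hc, h1⟩ := scales_permHom k hg 0
  rw [hi] at h1
  obtain ⟨d, hd, h2⟩ := evalMap_hX_mulVec hg
  refine PreservesCone.transport h0 (fun v => (g : Matrix (Fin 3) (Fin 3) ℂ) *ᵥ v)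
    (mulVec_surjective g) (fun v => mulVec_eq_zero_iff g) id (fun c hc => hc)
    (fun c v => Matrix.mulVec_smul _ _ _) (fun v => ?_) (fun c v h => by rw [qf_smul, h, mul_zero])
    fun v => ⟨d, hd, h2 v⟩
  rw [qf_mulVec, h1, qf_matrix_smul]
  simp [hc]

theorem preserves_conic (k : Fin 2) (i : Fin 6) :
    (∀ p ∈ zeroLocus (quad (fam k i)), IsDefinedAt hX p) ∧
      ratImage hX (zeroLocus (quad (fam k i))) = zeroLocus (quad (fam k i)) := by
  obtain ⟨h1, h2⟩ := preservesCone_fam k i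
  have hz {v : Fin 3 → ℂ} (hv : v ≠ 0) :
      Projectivization.mk ℂ v hv ∈ zeroLocus (quad (fam k i)) ↔ qf (fam k i) v = 0 := by
    rw [mem_zeroLocus_mk (quad_isHomogeneous _), eval_quad, qf]
  constructor
  · intro p hp
    refine (h1 p.rep p.rep_nonzero ?_).1
    rw [← hz p.rep_nonzero, p.mk_rep]
    exact hp
  · ext p
    constructor
    · rintro ⟨v, hv, hw, hS, rfl⟩
      rw [hz] at hS ⊢
      exact (h1 v hv hS).2
    · intro hp
      obtain ⟨v, hv, hqv, c, hc, h3⟩ := h2 p.rep p.rep_nonzero (by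
        rw [← hz p.rep_nonzero, p.mk_rep]
        exact hp)
      have hw : evalMap hX v ≠ 0 := by
        rw [h3]
        exact smul_ne_zero hc p.rep_nonzero
      refine ⟨v, hv, hw, (hz hv).2 hqv, ?_⟩
      conv_lhs => rw [← p.mk_rep]
      rw [Projectivization.mk_eq_mk_iff']
      exact ⟨c⁻¹, by rw [h3, smul_smul, inv_mul_cancel₀ hc, one_smul]⟩

/-! ### Bub-coordinates -/

theorem isBub_glA : IsBub glA where
  conj_mem g hg := by
    have h1 := conjGL_mem hg
    rw [MemVIn]
    suffices h : mk (conjGL (glA * g * glA⁻¹)) =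
        mk (glA * Matrix.GeneralLinearGroup.map (starRingEnd ℂ) g * glA⁻¹) by rwa [← h]
    have e1 : glB * Matrix.GeneralLinearGroup.map (starRingEnd ℂ) glA =
        Matrix.GeneralLinearGroup.scalar (Fin 3) (Units.mk0 2 two_ne_zero) * glA := by
      apply Units.ext
      ext i j
      have := congrFun (congrFun matB_mul_conj_matA i) j
      simpa using this
    have e2 : mk (glB * Matrix.GeneralLinearGroup.map (starRingEnd ℂ) glA) = mk glA := by
      rw [e1, map_mul, Matrix.ProjGenLinGroup.mk_scalar, one_mul]
    have e3 : conjGL (glA * g * glA⁻¹) =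
        (glB * Matrix.GeneralLinearGroup.map (starRingEnd ℂ) glA) *
          Matrix.GeneralLinearGroup.map (starRingEnd ℂ) g *
          (glB * Matrix.GeneralLinearGroup.map (starRingEnd ℂ) glA)⁻¹ := by
      rw [conjGL, map_mul, map_mul, map_inv]
      group
    rw [e3, map_mul, map_mul, map_inv, e2, map_mul, map_mul, map_inv]
  exchanges g hg c h := by
    have hC1 : C1 = quad 1 := by
      apply MvPolynomial.funext
      intro v
      rw [eval_quad]
      simp [C1, dotProduct, Fin.sum_univ_three, pow_two]
    -- The conjugate of the first conic is the first conic of the second family.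
    have h1 (v : Fin 3 → ℂ) : MvPolynomial.eval v
        (MvPolynomial.map (starRingEnd ℂ) (precompPoly glA C1)) =
        conj (qf 1 (matA *ᵥ fun i => conj (v i))) := by
      have : conj (MvPolynomial.eval (fun i => conj (v i)) (precompPoly glA C1)) =
          MvPolynomial.eval v (MvPolynomial.map (starRingEnd ℂ) (precompPoly glA C1)) := by
        rw [MvPolynomial.eval_map, ← MvPolynomial.eval₂_id, MvPolynomial.eval₂_comp_left]
        congr 1
        ext i
        simp
      rw [← this, eval_precompPoly, hC1, eval_quad, qf, coe_glA]
    obtain ⟨b, hb, h2⟩ := matB_fam 0 0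
    have h3 (w : Fin 3 → ℂ) :
        4 * conj (qf 1 w) = b⁻¹ * qf (fam 1 0) (matB *ᵥ fun i => conj (w i)) := by
      rw [sub_zero] at h2
      rw [qf_mulVec, h2, qf_matrix_smul, qf_conj, fam_zero_zero, qf_matrix_smul, ← mul_assoc,
        inv_mul_cancel₀ hb, map_mul, Complex.conj_ofNat, one_mul]
    obtain ⟨i, d, hd, h4⟩ : ∃ (i : Fin 6) (d : ℂ), d ≠ 0 ∧
        ((glA * g * glA⁻¹ : GL (Fin 3) ℂ) : Matrix (Fin 3) (Fin 3) ℂ)ᵀ * fam 0 0 *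
          ((glA * g * glA⁻¹ : GL (Fin 3) ℂ) : Matrix (Fin 3) (Fin 3) ℂ) = d • fam 0 i := by
      obtain ⟨d, hd, h4⟩ := scales_permHom 0 hg ((permHom 0 ⟨mk (glA * g * glA⁻¹), hg⟩).symm 0)
      rw [Equiv.apply_symm_apply] at h4
      exact ⟨_, d, hd, h4⟩
    have h5 (w : Fin 3 → ℂ) : d * qf (fam 0 i) w = c * 4 * b⁻¹ * qf (fam 1 0) w := by
      obtain ⟨v, rfl⟩ := mulVec_surjective glA w
      have e1 : (glA : Matrix (Fin 3) (Fin 3) ℂ) *ᵥ ((g : Matrix (Fin 3) (Fin 3) ℂ) *ᵥ v) =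
          ((glA * g * glA⁻¹ : GL (Fin 3) ℂ) : Matrix (Fin 3) (Fin 3) ℂ) *ᵥ
            ((glA : Matrix (Fin 3) (Fin 3) ℂ) *ᵥ v) := by
        rw [Matrix.mulVec_mulVec, Matrix.mulVec_mulVec, ← Units.val_mul, ← Units.val_mul,
          inv_mul_cancel_right]
      have e2 : matB *ᵥ (fun i => conj ((matA *ᵥ fun i => conj (v i)) i)) =
          (2 : ℂ) • (matA *ᵥ v) := by
        rw [map_conj_mulVec, Matrix.mulVec_mulVec, matB_mul_conj_matA, Matrix.smul_mulVec]
        simp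
      have e3 := congrArg (MvPolynomial.eval v) h
      rw [map_mul, MvPolynomial.eval_C, h1, eval_precompPoly, eval_precompPoly, hC1,
        eval_quad] at e3
      change qf 1 _ = _ at e3
      have e4 := h3 (matA *ᵥ fun i => conj (v i))
      rw [e2, qf_smul] at e4
      have e5 : qf (fam 0 0) ((glA : Matrix (Fin 3) (Fin 3) ℂ) *ᵥ
          ((g : Matrix (Fin 3) (Fin 3) ℂ) *ᵥ v)) = d * qf (fam 0 i) (matA *ᵥ v) := by
        rw [e1, qf_mulVec, h4, qf_matrix_smul, coe_glA]
      rw [fam_zero_zero, qf_matrix_smul, e3] at e5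
      change d * qf (fam 0 i) (matA *ᵥ v) = c * 4 * b⁻¹ * qf (fam 1 0) (matA *ᵥ v)
      rw [← e5]
      linear_combination c * e4
    obtain ⟨x, hx⟩ := eq_smul_fam_of_vanish (k := 1) (i := 0) (fam_transpose 0 i) fun v hv => by
      have h6 := h5 v
      rw [show qf (fam 1 0) v = 0 from hv, mul_zero] at h6
      exact (mul_eq_zero.1 h6).resolve_left hd
    exact zero_ne_one (congrArg Prod.fst (fam_eq_of_eq_smul hx))
  sextic g hg := by
    obtain ⟨c, -, h⟩ := F_semi_invariant g hg
    exact ⟨c, h⟩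

/-! ### The multipliers of a semi-invariant -/

theorem matQ_pow_four : matQ ^ 4 = 1 := by
  have h := map_toC_eq_smul_one (M := eG 2 ^ 4) (n := 16) (by decide +kernel)
  rw [map_toC_pow] at h
  rw [matQ_eq, smul_pow, h, smul_smul]
  norm_num

theorem matQ_mul_matP_sq_pow_three : (matQ * matP ^ 2) ^ 3 = 1 := by
  have h := map_toC_eq_smul_one (M := (eG 2 * eG 1 ^ 2) ^ 3) (n := 512) (by decide +kernel)
  rw [map_toC_pow, map_toC_mul, map_toC_pow] at h
  rw [matQ_eq, matP_eq, smul_pow, Matrix.smul_mul, Matrix.mul_smul, smul_smul, smul_pow, h,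
    smul_smul]
  norm_num

/-- The multipliers of the generators are trivial, by the orders of a few words in the
generators. -/
theorem multiplier_eq_one (S : Submonoid (ℂ × Matrix (Fin 3) (Fin 3) ℂ))
    (h1 : ∀ c, (c, 1) ∈ S → c = 1) {c : Fin 3 → ℂ} (h : ∀ a, (c a, matG a) ∈ S) (a : Fin 3) :
    c a = 1 := by
  have hZ : (c 0, matZ) ∈ S := h 0
  have hP : (c 1, matP) ∈ S := h 1
  have hQ : (c 2, matQ) ∈ S := h 2
  have eZ : c 0 ^ 2 = 1 := h1 _ (by simpa [matZ_sq] using pow_mem hZ 2)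
  have eP : c 1 ^ 5 = 1 := h1 _ (by simpa [matP_pow_five] using pow_mem hP 5)
  have eZP : (c 0 * c 1) ^ 3 = 1 :=
    h1 _ (by simpa [matZ_mul_matP_pow_three] using pow_mem (mul_mem hZ hP) 3)
  have eQ : c 2 ^ 4 = 1 := h1 _ (by simpa [matQ_pow_four] using pow_mem hQ 4)
  have eQP : (c 2 * c 1 ^ 2) ^ 3 = 1 :=
    h1 _ (by simpa [matQ_mul_matP_sq_pow_three] using pow_mem (mul_mem hQ (pow_mem hP 2)) 3)
  obtain ⟨h0, h1⟩ := eq_one_of_pow_eq_one eZ eP eZP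
  rw [h1, one_pow, mul_one] at eQP
  fin_cases a
  · exact h0
  · exact h1
  · calc c 2 = c 2 ^ 3 * c 2 := by rw [eQP, one_mul]
      _ = c 2 ^ 4 := by ring
      _ = 1 := eQ

/-! ### The generators as substitutions -/

theorem matZ_mulVec (v : Fin 3 → ℂ) : matZ *ᵥ v = ![-v 0, v 1, -v 2] := by
  ext i
  fin_cases i <;> simp [matZ, Matrix.mulVec, dotProduct, Fin.sum_univ_three]

theorem matQ_mulVec (v : Fin 3 → ℂ) : matQ *ᵥ v = ![v 0, ρ ^ 2 * v 2, -ρ * v 1] := by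
  ext i
  fin_cases i <;> simp [matQ, Matrix.mulVec, dotProduct, Fin.sum_univ_three]

theorem matQ_mulVec_mulVec (v : Fin 3 → ℂ) : matQ *ᵥ (matQ *ᵥ v) = ![v 0, -v 1, -v 2] := by
  have h := rho_cube
  rw [matQ_mulVec, matQ_mulVec]
  ext i
  fin_cases i
  · rfl
  · simp
    linear_combination v 1 * h
  · simp
    linear_combination v 2 * h

/-- The vector `2 P v`, with a parameter in place of the golden ratio. -/
def twoP {R : Type*} [CommRing R] (t : R) (v : Fin 3 → R) : Fin 3 → R :=
  ![v 0 + (t - 1) * v 1 - t * v 2, (t - 1) * v 0 + t * v 1 + v 2, t * v 0 - v 1 + (t - 1) * v 2]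

theorem two_smul_matP_mulVec (v : Fin 3 → ℂ) : (2 : ℂ) • (matP *ᵥ v) = twoP τ v := by
  ext i
  fin_cases i <;>
    simp [matP, twoP, dotProduct, Fin.sum_univ_three, tau_inv] <;> ring

/-- The cyclic permutation of the coordinates is a word in the generators. -/
theorem cyclic_mulVec (v : Fin 3 → ℂ) :
    matP *ᵥ (matP *ᵥ (matP *ᵥ (matZ *ᵥ (matP *ᵥ v)))) = ![v 1, v 2, v 0] := by
  have h : (eG 1 * (eG 1 * (eG 1 * (eG 0 * eG 1)))).map toC =
      (32 : ℂ) • !![0, 1, 0; 0, 0, 1; 1, 0, 0] := by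
    rw [show eG 1 * (eG 1 * (eG 1 * (eG 0 * eG 1))) = (32 : E) • !![0, 1, 0; 0, 0, 1; 1, 0, 0] by
      decide +kernel, map_toC_smul, show toC 32 = 32 from map_ofNat toC 32]
    congr 1
    ext i j
    fin_cases i <;> fin_cases j <;> simp
  simp only [map_toC_mul] at h
  rw [Matrix.mulVec_mulVec, Matrix.mulVec_mulVec, Matrix.mulVec_mulVec, Matrix.mulVec_mulVec,
    matP_eq, matZ_eq]
  simp only [Matrix.smul_mul, Matrix.mul_smul, smul_smul, Matrix.mul_assoc]
  rw [h, smul_smul, show (2 : ℂ)⁻¹ * (2⁻¹ * (2⁻¹ * (2⁻¹ * 2⁻¹))) * 32 = 1 by norm_num, one_smul]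
  ext i
  fin_cases i <;> simp [Matrix.mulVec, dotProduct, Fin.sum_univ_three]

/-! ### Forms with the monomial symmetries -/

/-- The symmetrization of a monomial with even exponents of `x₂` and `x₃` under the substitution
of `Q`, with a parameter `r` in place of `ρ`. -/
def bas {R : Type*} [CommRing R] (n : ℕ) (r : R) (p : ℕ × ℕ) (v : Fin 3 → R) : R :=
  v 0 ^ (n - 2 * p.1 - 2 * p.2) *
    (v 1 ^ (2 * p.1) * v 2 ^ (2 * p.2) + r ^ (p.1 + 2 * p.2) * v 1 ^ (2 * p.2) * v 2 ^ (2 * p.1))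

theorem map_bas {R S : Type*} [CommRing R] [CommRing S] (φ : R →+* S) (n : ℕ) (r : R) (p : ℕ × ℕ)
    (v : Fin 3 → R) : φ (bas n r p v) = bas n (φ r) p fun i => φ (v i) := by
  simp [bas]

/-- The sign changes leave only monomials with even exponents of the last two variables, and the
exchange of these variables pairs the monomials: the form is a combination of the forms `bas`. -/
theorem exists_eq_sum_bas {m n : ℕ} {idx : Fin m → ℕ × ℕ}
    (hidx : ∀ i j, i ≤ j → 2 * i + 2 * j ≤ n → ∃ k, idx k = (i, j)) {q : Poly}
    (hq : q.IsHomogeneous n)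
    (h1 : ∀ v, MvPolynomial.eval ![v 0, -v 1, -v 2] q = MvPolynomial.eval v q)
    (h2 : ∀ v, MvPolynomial.eval ![-v 0, v 1, -v 2] q = (-1) ^ n * MvPolynomial.eval v q)
    (h3 : ∀ v, MvPolynomial.eval ![v 0, ρ ^ 2 * v 2, -ρ * v 1] q = MvPolynomial.eval v q) :
    ∃ a : Fin m → ℂ, ∀ v, MvPolynomial.eval v q = ∑ k, a k * bas n ρ (idx k) v := by
  have hn (x : ℕ) : ((-1 : ℂ) ^ x) * (-1) ^ x = 1 := by rw [← mul_pow]; simp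
  have ev (v : Fin 3 → ℂ) : MvPolynomial.eval v q =
      ∑ d ∈ q.support, q.coeff d * (v 0 ^ d 0 * v 1 ^ d 1 * v 2 ^ d 2) := by
    rw [MvPolynomial.eval_eq']
    simp [Fin.prod_univ_three]
  have hd {d : Fin 3 →₀ ℕ} (h : d ∈ q.support) : d 0 + d 1 + d 2 = n := by
    have := hq (MvPolynomial.mem_support_iff.1 h)
    rw [← this, Finsupp.weight_apply, Finsupp.sum_fintype _ _ (by simp)]
    simp [Fin.sum_univ_three]
  -- The average over the diagonal substitutions kills the monomials with an odd exponent.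
  have e1 (v : Fin 3 → ℂ) : 4 * MvPolynomial.eval v q = ∑ d ∈ q.support, q.coeff d *
      ((1 + (-1) ^ d 1 * (-1) ^ d 2) * (1 + (-1) ^ d 1)) * (v 0 ^ d 0 * v 1 ^ d 1 * v 2 ^ d 2) := by
    have h4 := h2 ![v 0, -v 1, -v 2]
    rw [h1] at h4
    have h5 : 4 * MvPolynomial.eval v q = MvPolynomial.eval v q +
        MvPolynomial.eval ![v 0, -v 1, -v 2] q + (-1) ^ n * MvPolynomial.eval ![-v 0, v 1, -v 2] q +
        (-1) ^ n * MvPolynomial.eval ![-(![v 0, -v 1, -v 2] 0), ![v 0, -v 1, -v 2] 1,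
          -(![v 0, -v 1, -v 2] 2)] q := by
      rw [h4, h1, h2, ← mul_assoc, hn]
      ring
    rw [h5, ev, ev, ev, ev, Finset.mul_sum, Finset.mul_sum, ← Finset.sum_add_distrib,
      ← Finset.sum_add_distrib, ← Finset.sum_add_distrib]
    refine Finset.sum_congr rfl fun d h => ?_
    simp only [Matrix.cons_val_zero, Matrix.cons_val_one, Matrix.cons_val, neg_neg]
    rw [← hd h, neg_pow (v 0), neg_pow (v 1), neg_pow (v 2), pow_add, pow_add]
    linear_combination (q.coeff d * (v 0 ^ d 0 * v 1 ^ d 1 * v 2 ^ d 2)) *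
      (((-1) ^ d 1 * (-1) ^ d 2 * (-1) ^ d 2 + (-1) ^ d 1 * (-1) ^ d 1 * (-1) ^ d 2) * hn (d 0) +
        (-1) ^ d 1 * hn (d 2))
  have e2 (v : Fin 3 → ℂ) : 8 * MvPolynomial.eval v q = ∑ d ∈ q.support, q.coeff d *
      ((1 + (-1) ^ d 1 * (-1) ^ d 2) * (1 + (-1) ^ d 1)) * (v 0 ^ d 0 * (v 1 ^ d 1 * v 2 ^ d 2 +
        (ρ ^ 2 * v 2) ^ d 1 * (-ρ * v 1) ^ d 2)) := by
    have h5 : 8 * MvPolynomial.eval v q = 4 * MvPolynomial.eval v q +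
        4 * MvPolynomial.eval ![v 0, ρ ^ 2 * v 2, -ρ * v 1] q := by
      rw [h3]
      ring
    rw [h5, e1, e1, ← Finset.sum_add_distrib]
    refine Finset.sum_congr rfl fun d h => ?_
    simp only [Matrix.cons_val_zero, Matrix.cons_val_one, Matrix.cons_val]
    ring
  have hmem : (fun v => MvPolynomial.eval v q) ∈
      Submodule.span ℂ (Set.range fun k => bas n ρ (idx k)) := by
    have e3 : (fun v => MvPolynomial.eval v q) = ∑ d ∈ q.support, ((8 : ℂ)⁻¹ * (q.coeff d *
        ((1 + (-1) ^ d 1 * (-1) ^ d 2) * (1 + (-1) ^ d 1)))) • fun v : Fin 3 → ℂ =>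
          v 0 ^ d 0 * (v 1 ^ d 1 * v 2 ^ d 2 + (ρ ^ 2 * v 2) ^ d 1 * (-ρ * v 1) ^ d 2) := by
      ext v
      rw [Finset.sum_apply]
      simp only [Pi.smul_apply, smul_eq_mul, mul_assoc (8 : ℂ)⁻¹]
      rw [← Finset.mul_sum, ← e2, ← mul_assoc, inv_mul_cancel₀ (by norm_num), one_mul]
    rw [e3]
    refine Submodule.sum_mem _ fun d h => ?_
    rcases Nat.even_or_odd (d 1) with he | ho
    swap
    · rw [ho.neg_one_pow]
      simp
    rcases Nat.even_or_odd (d 2) with he' | ho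
    swap
    · rw [ho.neg_one_pow, he.neg_one_pow]
      simp
    apply Submodule.smul_mem
    obtain ⟨i, hi⟩ := he
    obtain ⟨j, hj⟩ := he'
    have h0 : d 0 = n - 2 * i - 2 * j := by
      have := hd h
      omega
    have hij : 2 * i + 2 * j ≤ n := by
      have := hd h
      omega
    rw [← two_mul] at hi hj
    rw [h0, hi, hj]
    have h6 (v : Fin 3 → ℂ) : (ρ ^ 2 * v 2) ^ (2 * i) * (-ρ * v 1) ^ (2 * j) =
        ρ ^ (i + 2 * j) * v 1 ^ (2 * j) * v 2 ^ (2 * i) := by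
      have h7 : ρ ^ (4 * i) = ρ ^ i := by
        rw [show 4 * i = 3 * i + i by ring, pow_add, pow_mul, rho_cube, one_pow, one_mul]
      rw [mul_pow, mul_pow, Even.neg_pow (even_two_mul j), ← pow_mul, pow_add, ← h7]
      ring
    rcases le_total i j with hle | hle
    · obtain ⟨k, hk⟩ := hidx i j hle hij
      refine Submodule.subset_span ⟨k, ?_⟩
      ext v
      simp only [bas, hk, h6]
    · obtain ⟨k, hk⟩ := hidx j i hle (by omega)
      have h8 : (fun v : Fin 3 → ℂ => v 0 ^ (n - 2 * i - 2 * j) * (v 1 ^ (2 * i) * v 2 ^ (2 * j) +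
          (ρ ^ 2 * v 2) ^ (2 * i) * (-ρ * v 1) ^ (2 * j))) = ρ ^ (i + 2 * j) • bas n ρ (idx k) := by
        ext v
        have h9 : ρ ^ (i + 2 * j) * ρ ^ (j + 2 * i) = 1 := by
          rw [← pow_add, show i + 2 * j + (j + 2 * i) = 3 * (i + j) by ring, pow_mul, rho_cube,
            one_pow]
        simp only [bas, hk, h6, Pi.smul_apply, smul_eq_mul]
        rw [show n - 2 * j - 2 * i = n - 2 * i - 2 * j by omega]
        linear_combination -(v 0 ^ (n - 2 * i - 2 * j) * v 1 ^ (2 * i) * v 2 ^ (2 * j)) * h9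
      rw [h8]
      exact Submodule.smul_mem _ _ (Submodule.subset_span ⟨k, rfl⟩)
  obtain ⟨a, ha⟩ := (Submodule.mem_span_range_iff_exists_fun ℂ).1 hmem
  refine ⟨a, fun v => ?_⟩
  have := congrFun ha v
  simp only [Finset.sum_apply, Pi.smul_apply, smul_eq_mul] at this
  exact this.symm

/-! ### A linear system for the covariants of degree 19 and the invariants of degree 6 -/

/-- The reduction of `ℤ[τ, ρ]` at a prime above 31. -/
def toF31 : E →+* ZMod 31 := liftE 13 5 (by decide) (by decide)

/-- The digit of `n` with the given position, in base 31. -/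
def digit (n k : ℕ) : ℕ := n / 31 ^ k % 31

/-- If a square part of a linear system over `ℤ[τ, ρ]` is invertible modulo a prime above 31, then
a solution with the value zero for the other unknowns is zero. The lists `T` and `C` are the rows
of the reduction and the columns of its inverse, by their digits in base 31. -/
theorem eq_zero_of_rows {m n : ℕ} {row : Fin m → Fin (m + n) → E} {T C : List ℕ}
    (hT : ∀ i k : Fin m, toF31 (row i (Fin.castAdd n k)) = (digit (T.getD i 0) k : ZMod 31))
    (hC : ∀ i j : Fin m, (∑ k : Fin m, digit (T.getD i 0) k * digit (C.getD j 0) k) % 31 =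
      if i = j then 1 else 0)
    {a : Fin (m + n) → ℂ} (h : ∀ i, ∑ k, a k * toC (row i k) = 0)
    (ha : ∀ j, a (Fin.natAdd m j) = 0) : a = 0 := by
  have h1 : (Matrix.of fun i k => row i (Fin.castAdd n k)).map toF31 *
      Matrix.of (fun k j : Fin m => (digit (C.getD j 0) k : ZMod 31)) = 1 := by
    ext i j
    have h2 := congrArg (Nat.cast (R := ZMod 31)) (hC i j)
    rw [ZMod.natCast_mod] at h2
    rw [Matrix.mul_apply, Matrix.one_apply]
    simp only [Matrix.map_apply, Matrix.of_apply, hT]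
    push_cast at h2
    exact h2
  have h2 : (Matrix.of fun i k => row i (Fin.castAdd n k)).det ≠ 0 := by
    intro h0
    have h3 := congrArg Matrix.det h1
    rw [Matrix.det_mul, ← RingHom.mapMatrix_apply, ← RingHom.map_det, h0, map_zero, zero_mul,
      Matrix.det_one] at h3
    exact absurd h3 (by decide)
  have h3 : ((Matrix.of fun i k => row i (Fin.castAdd n k)).map toC).det ≠ 0 := by
    rw [← RingHom.mapMatrix_apply, ← RingHom.map_det]
    exact toC_ne_zero h2
  have h4 : (fun k => a (Fin.castAdd n k)) = 0 := by
    apply Matrix.eq_zero_of_mulVec_eq_zero h3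
    ext i
    have h5 := h i
    rw [Fin.sum_univ_add] at h5
    simp only [ha, zero_mul, Finset.sum_const_zero, add_zero] at h5
    simpa [Matrix.mulVec, dotProduct, mul_comm] using h5
  ext k
  refine Fin.addCases (fun k => congrFun h4 k) ha k

/-- The equation for the value of the first component of a covariant of degree 19 at `2 P v`, for
the basis form with the index `p`. -/
def row19 {R : Type*} [CommRing R] (t r : R) (v : Fin 3 → R) (p : ℕ × ℕ) : R :=
  bas 19 r p (twoP t v) - 2 ^ 18 * (bas 19 r p v + (t - 1) * bas 19 r p ![v 1, v 2, v 0] -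
    t * bas 19 r p ![v 2, v 0, v 1])

/-- The equation for the value of an invariant of degree 6 at `2 P v`, for the basis form with the
index `p`. -/
def row6 {R : Type*} [CommRing R] (t r : R) (v : Fin 3 → R) (p : ℕ × ℕ) : R :=
  bas 6 r p (twoP t v) - 2 ^ 6 * bas 6 r p v

section

variable {R S : Type*} [CommRing R] [CommRing S] (φ : R →+* S) (t r : R) (v : Fin 3 → R) (p : ℕ × ℕ)

theorem map_twoP : (fun i => φ (twoP t v i)) = twoP (φ t) fun i => φ (v i) := by
  ext i
  fin_cases i <;> simp [twoP]

theorem map_row19 : φ (row19 t r v p) = row19 (φ t) (φ r) (fun i => φ (v i)) p := by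
  have h (a b c : R) : (fun i => φ ((![a, b, c] : Fin 3 → R) i)) = ![φ a, φ b, φ c] := by
    ext i
    fin_cases i <;> rfl
  simp [row19, map_bas, map_twoP, h, show φ 2 = 2 from map_ofNat φ 2]

theorem map_row6 : φ (row6 t r v p) = row6 (φ t) (φ r) (fun i => φ (v i)) p := by
  simp [row6, map_bas, map_twoP, show φ 2 = 2 from map_ofNat φ 2]

end

/-- The indices of the basis forms of degree 19. -/
def idx19 : Fin (27 + 3) → ℕ × ℕ :=
  ![(0, 0), (0, 1), (0, 2), (0, 3), (0, 4), (0, 5), (0, 6), (0, 7), (0, 8), (0, 9), (1, 1),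
    (1, 2), (1, 3), (1, 4), (1, 5), (1, 6), (1, 7), (1, 8), (2, 2), (2, 3), (2, 4), (2, 5),
    (2, 6), (2, 7), (3, 3), (3, 4), (3, 5), (3, 6), (4, 4), (4, 5)]

/-- Points at which the equations of degree 19 are independent. -/
def pt19 : Fin 27 → Fin 3 → ℤ :=
  ![![0, 0, 1], ![0, 1, 0], ![1, 0, 0], ![0, 1, 1], ![1, 0, 1], ![1, 1, 0], ![0, 1, 2],
    ![0, 2, 1], ![1, 0, 2], ![1, 2, 0], ![2, 0, 1], ![2, 1, 0], ![0, 1, 3], ![0, 3, 1],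
    ![1, 0, 3], ![1, 1, 2], ![1, 2, 1], ![1, 3, 0], ![2, 1, 1], ![3, 0, 1], ![3, 1, 0],
    ![0, 1, 4], ![0, 2, 3], ![0, 3, 2], ![0, 4, 1], ![1, 0, 4], ![1, 1, 3]]

/-- The reduction modulo 31 of the system at the points, by rows, with the entries as the digits
in base 31. -/
def rows19 : List ℕ :=
  [9889234979224371295964546552471138933173, 7881518830843474364910840246832570879201,
    15849191993472945484905264638521491067700, 10769641140598679538255826541301929865826,
    12602020496707162067507870673932674054417, 9632702876205629556602012556520299622718,
    2194600389090735450411188826691407974490, 1322087915328057288763820536290757305332,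
    10118720022665978189127194995952808176460, 14652093166574577635373434824602415075313,
    16283959041718531262566900867594162916766, 8332592423881120295216754456609838657358,
    6521403671744111378081894057904677643512, 2476211901130005141599328901133322518214,
    13050919906564352699971230776106764488811, 14131428402953857706171638147895317279226,
    1302438681610443613044734204132789568695, 14157608550860962178197411355562324374347,
    5408906288055580277836081965194345979189, 12806272638197239630213977993702156146319,
    9115785011567367162073446676998798415599, 11779084451977639321619548299058371529033,
    14626922840809674308873718974538258570937, 9004351199312427459148556486568215255073,
    8213893254096021991236718175806339618155, 12201835657160791969396761696860470203068,
    17059720019332674178639446849044000374058]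

/-- The columns of the inverse matrix modulo 31, with the entries as the digits in base 31. -/
def cols19 : List ℕ :=
  [16537636359080382355347773708632282708479, 14417791513496107259153669411265663583557,
    9687958192261735535516428528680910133459, 8024911184589151019162760037528632628340,
    4295295355059878496903109501279406853755, 18467139040606236842284398417807622102864,
    15896708903248984610719313641677864946561, 1015483260860229591186096633990736397670,
    3406989043521790523531232054687591177061, 15840781782970188763329511655468982414829,
    15624182111134942818389863407789484600338, 14887472694961482210545375262243046094372,
    2716494117133612563421458091611346564726, 1849842213150371479586314998661806637236,
    9657581674045372862227508532706818965230, 2447484632755059021191106689874150899166,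
    3053690146611521524181641935789551908074, 17199631503703645520681232637133245485995,
    3407929188156792995185916508363967117766, 17965305719072280920550244734426226076621,
    12580333253082620214487346667045064655703, 16790717670242359218051282973021262193606,
    7759893576671736502064415460945263455531, 15465904883457180516166690091842179965954,
    10836700050067067488453514133625686215471, 3964198784019999348302520811209807597442,
    15493539633005521945821776867569979279187]

theorem row19_mod (i k : Fin 27) : (row19 13 5 (pt19 i) (idx19 (Fin.castAdd 3 k)) -
    digit (rows19.getD i 0) k) % 31 = 0 := by
  revert i k
  decide +kernel

theorem rows19_mul_cols19 (i j : Fin 27) :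
    (∑ k : Fin 27, digit (rows19.getD i 0) k * digit (cols19.getD j 0) k) % 31 =
      if i = j then 1 else 0 := by
  revert i j
  decide +kernel

/-- The linear system for the covariants of degree 19 has corank at most 3. -/
theorem eq_zero_of_row19 {a : Fin (27 + 3) → ℂ}
    (h : ∀ v, ∑ k, a k * row19 τ ρ v (idx19 k) = 0) (ha : ∀ j, a (Fin.natAdd 27 j) = 0) :
    a = 0 := by
  refine eq_zero_of_rows
    (row := fun i k => row19 (e 0 1 0 0) (e 0 0 1 0) (fun j => (pt19 i j : E)) (idx19 k))
    (fun i k => ?_) rows19_mul_cols19 (fun i => ?_) ha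
  · have h1 := row19_mod i k
    rw [← Int.dvd_iff_emod_eq_zero, show (31 : ℤ) = (31 : ℕ) from rfl,
      ← ZMod.intCast_zmod_eq_zero_iff_dvd, Int.cast_sub, sub_eq_zero, Int.cast_natCast] at h1
    rw [← h1, ← eq_intCast (Int.castRingHom (ZMod 31)), map_row19, map_row19]
    simp [toF31, liftE_apply, e]
  · have h1 := h fun j => (pt19 i j : ℂ)
    rw [← h1]
    refine Finset.sum_congr rfl fun k _ => ?_
    rw [map_row19]
    simp [toC_e]

/-- The indices of the basis forms of degree 6. -/
def idx6 : Fin (5 + 1) → ℕ × ℕ :=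
  ![(0, 0), (0, 1), (0, 2), (0, 3), (1, 1), (1, 2)]

/-- Points at which the equations of degree 6 are independent. -/
def pt6 : Fin 5 → Fin 3 → ℤ :=
  ![![0, 0, 1], ![0, 1, 0], ![1, 0, 0], ![0, 1, 1], ![1, 0, 1]]

/-- The reduction modulo 31 of the system at the points, by rows, with the entries as the digits
in base 31. -/
def rows6 : List ℕ :=
  [1904238, 2320850, 2408853, 2098795, 9692243]

/-- The columns of the inverse matrix modulo 31, with the entries as the digits in base 31. -/
def cols6 : List ℕ :=
  [14711418, 18606355, 21940397, 20360872, 11873980]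

theorem row6_mod (i k : Fin 5) : (row6 13 5 (pt6 i) (idx6 (Fin.castAdd 1 k)) -
    digit (rows6.getD i 0) k) % 31 = 0 := by
  revert i k
  decide +kernel

theorem rows6_mul_cols6 (i j : Fin 5) :
    (∑ k : Fin 5, digit (rows6.getD i 0) k * digit (cols6.getD j 0) k) % 31 =
      if i = j then 1 else 0 := by
  revert i j
  decide +kernel

/-- The linear system for the invariants of degree 6 has corank at most 1. -/
theorem eq_zero_of_row6 {a : Fin (5 + 1) → ℂ}
    (h : ∀ v, ∑ k, a k * row6 τ ρ v (idx6 k) = 0) (ha : ∀ j, a (Fin.natAdd 5 j) = 0) :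
    a = 0 := by
  refine eq_zero_of_rows
    (row := fun i k => row6 (e 0 1 0 0) (e 0 0 1 0) (fun j => (pt6 i j : E)) (idx6 k))
    (fun i k => ?_) rows6_mul_cols6 (fun i => ?_) ha
  · have h1 := row6_mod i k
    rw [← Int.dvd_iff_emod_eq_zero, show (31 : ℤ) = (31 : ℕ) from rfl,
      ← ZMod.intCast_zmod_eq_zero_iff_dvd, Int.cast_sub, sub_eq_zero, Int.cast_natCast] at h1
    rw [← h1, ← eq_intCast (Int.castRingHom (ZMod 31)), map_row6, map_row6]
    simp [toF31, liftE_apply, e]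
  · have h1 := h fun j => (pt6 i j : ℂ)
    rw [← h1]
    refine Finset.sum_congr rfl fun k _ => ?_
    rw [map_row6]
    simp [toC_e]

/-! ### Invariants of degree 6 -/

/-- The multipliers of a semi-invariant form are trivial. -/
theorem lin_matG_eq_self {q : Poly} (hq : q ≠ 0)
    (h : ∀ a, ∃ c : ℂ, lin (matG a) q = MvPolynomial.C c * q) (a : Fin 3) : lin (matG a) q = q := by
  choose c hc using h
  have h1 := multiplier_eq_one
    { carrier := {x : ℂ × Matrix (Fin 3) (Fin 3) ℂ | lin x.2 q = MvPolynomial.C x.1 * q}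
      one_mem' := by
        change lin 1 q = MvPolynomial.C 1 * q
        rw [lin_one, map_one, one_mul]
      mul_mem' := by
        rintro ⟨c, M⟩ ⟨d, N⟩ hM hN
        change lin M q = MvPolynomial.C c * q at hM
        change lin N q = MvPolynomial.C d * q at hN
        change lin (M * N) q = MvPolynomial.C (c * d) * q
        rw [← lin_mul, hM, map_mul, lin_C, hN, map_mul, mul_assoc] }
    (fun c hc => by
      change lin 1 q = MvPolynomial.C c * q at hc
      rw [lin_one] at hc
      have h2 : MvPolynomial.C (c - 1) * q = 0 := by
        rw [map_sub, map_one]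
        linear_combination -hc
      have h3 := (mul_eq_zero.1 h2).resolve_right hq
      exact sub_eq_zero.1 ((map_eq_zero_iff _ (MvPolynomial.C_injective _ _)).1 h3))
    hc a
  rw [hc, h1, map_one, one_mul]

theorem eval_matG_mulVec {q : Poly} (h : ∀ a, lin (matG a) q = q) (a : Fin 3) (v : Fin 3 → ℂ) :
    MvPolynomial.eval (matG a *ᵥ v) q = MvPolynomial.eval v q := by
  rw [← eval_lin, h]

theorem exists_eq_sum_bas_six {q : Poly} (hq : q.IsHomogeneous 6)
    (h : ∀ a, lin (matG a) q = q) :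
    ∃ a : Fin (5 + 1) → ℂ, (∀ v, MvPolynomial.eval v q = ∑ k, a k * bas 6 ρ (idx6 k) v) ∧
      ∀ v, ∑ k, a k * row6 τ ρ v (idx6 k) = 0 := by
  have hi : ∀ i j : Fin 4, i ≤ j → 2 * (i : ℕ) + 2 * j ≤ 6 → ∃ k, idx6 k = ((i : ℕ), (j : ℕ)) := by
    decide +kernel
  have hs := eval_matG_mulVec h
  obtain ⟨a, ha⟩ := exists_eq_sum_bas (idx := idx6)
    (fun i j hij h => hi ⟨i, by omega⟩ ⟨j, by omega⟩ hij h) hq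
    (fun v => by rw [← matQ_mulVec_mulVec]; exact (hs 2 _).trans (hs 2 v))
    (fun v => by rw [← matZ_mulVec, (by norm_num : (-1 : ℂ) ^ 6 = 1), one_mul]; exact hs 0 v)
    (fun v => by rw [← matQ_mulVec]; exact hs 2 v)
  refine ⟨a, ha, fun v => ?_⟩
  have h1 : MvPolynomial.eval (twoP τ v) q = 2 ^ 6 * MvPolynomial.eval v q := by
    rw [← two_smul_matP_mulVec, eval_smul_of_isHomogeneous hq]
    congr 1
    exact hs 1 v
  rw [ha, ha] at h1
  simp only [row6, mul_sub, Finset.sum_sub_distrib]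
  rw [h1, Finset.mul_sum, ← Finset.sum_sub_distrib]
  exact Finset.sum_eq_zero fun k _ => by ring

/-- The invariants of degree 6 form a line. -/
theorem exists_eq_C_mul_of_invariant {p q : Poly} (hp : p.IsHomogeneous 6) (hq : q.IsHomogeneous 6)
    (hp' : ∀ a, lin (matG a) p = p) (hq' : ∀ a, lin (matG a) q = q) (hq0 : q ≠ 0) :
    ∃ c, p = MvPolynomial.C c * q := by
  obtain ⟨a, ha, ha'⟩ := exists_eq_sum_bas_six hp hp'
  obtain ⟨b, hb, hb'⟩ := exists_eq_sum_bas_six hq hq'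
  have hlast {x : Fin (5 + 1) → ℂ} (hx : x 5 = 0) (j : Fin 1) : x (Fin.natAdd 5 j) = 0 := by
    rw [Subsingleton.elim j 0]
    exact hx
  have hb5 : b 5 ≠ 0 := by
    intro h
    apply hq0
    apply MvPolynomial.funext
    intro v
    rw [hb, eq_zero_of_row6 hb' (hlast h)]
    simp
  have h1 : (fun k => b 5 * a k - a 5 * b k) = 0 := by
    refine eq_zero_of_row6 (fun v => ?_)
      (hlast (x := fun k => b 5 * a k - a 5 * b k) (by ring))
    have h2 : ∑ k, (b 5 * a k - a 5 * b k) * row6 τ ρ v (idx6 k) =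
        b 5 * ∑ k, a k * row6 τ ρ v (idx6 k) - a 5 * ∑ k, b k * row6 τ ρ v (idx6 k) := by
      rw [Finset.mul_sum, Finset.mul_sum, ← Finset.sum_sub_distrib]
      exact Finset.sum_congr rfl fun k _ => by ring
    rw [h2, ha', hb', mul_zero, mul_zero, sub_zero]
  refine ⟨a 5 / b 5, MvPolynomial.funext fun v => ?_⟩
  rw [map_mul, MvPolynomial.eval_C, ha, hb, Finset.mul_sum]
  refine Finset.sum_congr rfl fun k _ => ?_
  have h2 := congrFun h1 k
  simp only [Pi.zero_apply] at h2
  field_simp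
  linear_combination (bas 6 ρ (idx6 k) v) * h2

/-! ### Covariants of degree 19 -/

/-- The map given by the triple commutes with the matrices that generate the group. -/
def IsCovariant (H : Fin 3 → Poly) : Prop :=
  ∀ a v, evalMap H (matG a *ᵥ v) = matG a *ᵥ evalMap H v

/-- The multipliers of a map that commutes with the group up to scalars are trivial. -/
theorem IsEquivariant.isCovariant {H : Fin 3 → Poly} (hH : IsEquivariant V H) (h0 : H ≠ 0) :
    IsCovariant H := by
  have h (a : Fin 3) : ∃ c : ℂ, ∀ v, evalMap H (matG a *ᵥ v) = c • (matG a *ᵥ evalMap H v) := by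
    obtain ⟨c, -, h⟩ := hH (glG a) (mk_glG_mem a)
    refine ⟨c, fun v => ?_⟩
    rw [← coe_glG, ← evalMap_precomp, h, ← evalMap_postcomp]
    ext i
    simp [evalMap]
  choose c hc using h
  have h1 := multiplier_eq_one
    { carrier := {x : ℂ × Matrix (Fin 3) (Fin 3) ℂ |
        ∀ v, evalMap H (x.2 *ᵥ v) = x.1 • (x.2 *ᵥ evalMap H v)}
      one_mem' := by
        intro v
        simp
      mul_mem' := by
        rintro ⟨c, M⟩ ⟨d, N⟩ hM hN v
        have h1 := hM (N *ᵥ v)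
        have h2 := hN v
        simp only [Prod.mk_mul_mk] at h1 h2 ⊢
        rw [← Matrix.mulVec_mulVec, h1, h2, Matrix.mulVec_smul, smul_smul, Matrix.mulVec_mulVec] }
    (fun c hc => by
      by_contra hc1
      apply h0
      apply evalMap_injective
      intro v
      have h2 : evalMap H v = c • evalMap H v := by simpa using hc v
      have h3 : (1 - c) • evalMap H v = 0 := by rw [sub_smul, one_smul, ← h2, sub_self]
      rw [(smul_eq_zero.1 h3).resolve_left (sub_ne_zero.2 (Ne.symm hc1))]
      ext i
      simp [evalMap])
    hc
  intro a v
  rw [hc, h1, one_smul]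

theorem IsCovariant.cyclic {H : Fin 3 → Poly} (hH : IsCovariant H) (v : Fin 3 → ℂ) :
    evalMap H ![v 1, v 2, v 0] = ![evalMap H v 1, evalMap H v 2, evalMap H v 0] := by
  have hZ : ∀ w, evalMap H (matZ *ᵥ w) = matZ *ᵥ evalMap H w := hH 0
  have hP : ∀ w, evalMap H (matP *ᵥ w) = matP *ᵥ evalMap H w := hH 1
  rw [← cyclic_mulVec, hP, hP, hP, hZ, hP, cyclic_mulVec]

theorem IsCovariant.eval_zero_cyclic {H : Fin 3 → Poly} (hH : IsCovariant H) (v : Fin 3 → ℂ) :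
    MvPolynomial.eval ![v 1, v 2, v 0] (H 0) = MvPolynomial.eval v (H 1) :=
  congrFun (hH.cyclic v) 0

theorem IsCovariant.eval_one_cyclic {H : Fin 3 → Poly} (hH : IsCovariant H) (v : Fin 3 → ℂ) :
    MvPolynomial.eval ![v 1, v 2, v 0] (H 1) = MvPolynomial.eval v (H 2) :=
  congrFun (hH.cyclic v) 1

/-- A covariant of degree 19 is given by its first component, which satisfies a linear system. -/
theorem IsCovariant.exists_eq_sum_bas {H : Fin 3 → Poly} (hH : IsCovariant H)
    (hd : ∀ i, (H i).IsHomogeneous 19) :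
    ∃ a : Fin (27 + 3) → ℂ,
      (∀ v, MvPolynomial.eval v (H 0) = ∑ k, a k * bas 19 ρ (idx19 k) v) ∧
      ∀ v, ∑ k, a k * row19 τ ρ v (idx19 k) = 0 := by
  have hi : ∀ i j : Fin 10, i ≤ j → 2 * (i : ℕ) + 2 * j ≤ 19 →
      ∃ k, idx19 k = ((i : ℕ), (j : ℕ)) := by
    decide +kernel
  have hZ : ∀ v, evalMap H (matZ *ᵥ v) = matZ *ᵥ evalMap H v := hH 0
  have hP : ∀ v, evalMap H (matP *ᵥ v) = matP *ᵥ evalMap H v := hH 1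
  have hQ : ∀ v, evalMap H (matQ *ᵥ v) = matQ *ᵥ evalMap H v := hH 2
  obtain ⟨a, ha⟩ := Valentiner.exists_eq_sum_bas (idx := idx19)
    (fun i j hij h => hi ⟨i, by omega⟩ ⟨j, by omega⟩ hij h) (hd 0)
    (fun v => by
      have h := hQ (matQ *ᵥ v)
      rw [hQ v, matQ_mulVec_mulVec, matQ_mulVec_mulVec] at h
      exact congrFun h 0)
    (fun v => by
      have h := hZ v
      rw [matZ_mulVec, matZ_mulVec] at h
      have h0 := congrFun h 0
      rw [(by norm_num : (-1 : ℂ) ^ 19 = -1), neg_one_mul]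
      exact h0)
    (fun v => by
      have h := hQ v
      rw [matQ_mulVec, matQ_mulVec] at h
      exact congrFun h 0)
  refine ⟨a, ha, fun v => ?_⟩
  have h1 : MvPolynomial.eval (twoP τ v) (H 0) = 2 ^ 18 * (MvPolynomial.eval v (H 0) +
      (τ - 1) * MvPolynomial.eval ![v 1, v 2, v 0] (H 0) -
      τ * MvPolynomial.eval ![v 2, v 0, v 1] (H 0)) := by
    have e1 : MvPolynomial.eval ![v 2, v 0, v 1] (H 0) = MvPolynomial.eval v (H 2) :=
      (hH.eval_zero_cyclic ![v 1, v 2, v 0]).trans (hH.eval_one_cyclic v)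
    rw [hH.eval_zero_cyclic, e1]
    have e2 := congrFun (congrArg (fun w => (2 : ℂ) • w) (hP v)) 0
    simp only [two_smul_matP_mulVec] at e2
    rw [← two_smul_matP_mulVec, eval_smul_of_isHomogeneous (hd 0)]
    simp only [Pi.smul_apply, smul_eq_mul, evalMap, twoP, Matrix.cons_val_zero] at e2
    linear_combination 2 ^ 18 * e2
  rw [ha, ha, ha, ha] at h1
  simp only [row19, mul_sub, Finset.sum_sub_distrib]
  rw [h1]
  simp only [mul_add, mul_sub, Finset.mul_sum, Finset.sum_add_distrib]
  simp only [mul_left_comm]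
  ring

/-- Four covariants of degree 19 are linearly dependent. -/
theorem exists_linear_relation {H : Fin 4 → Fin 3 → Poly} (hH : ∀ s, IsCovariant (H s))
    (hd : ∀ s i, (H s i).IsHomogeneous 19) :
    ∃ w : Fin 4 → ℂ, w ≠ 0 ∧ ∀ v, ∑ s, w s • evalMap (H s) v = 0 := by
  choose a ha ha' using fun s => (hH s).exists_eq_sum_bas (hd s)
  have h1 : ¬ LinearIndependent ℂ fun (s : Fin 4) (j : Fin 3) => a s (Fin.natAdd 27 j) := by
    intro h
    have := h.fintype_card_le_finrank
    simp at this
  obtain ⟨w, hw, s, hs⟩ := Fintype.not_linearIndependent_iff.1 h1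
  refine ⟨w, fun h => hs (congrFun h s), ?_⟩
  have h2 : (fun k => ∑ s, w s * a s k) = 0 := by
    refine eq_zero_of_row19 (fun v => ?_) fun j => ?_
    · simp only [Finset.sum_mul, mul_assoc]
      rw [Finset.sum_comm]
      refine Finset.sum_eq_zero fun s _ => ?_
      rw [← Finset.mul_sum, ha', mul_zero]
    · have := congrFun hw j
      simpa using this
  have h3 (v : Fin 3 → ℂ) : ∑ s, w s * MvPolynomial.eval v (H s 0) = 0 := by
    simp only [ha, Finset.mul_sum]
    rw [Finset.sum_comm]
    refine Finset.sum_eq_zero fun k _ => ?_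
    have h4 := congrFun h2 k
    simp only [Pi.zero_apply] at h4
    simp only [← mul_assoc]
    rw [← Finset.sum_mul, h4, zero_mul]
  intro v
  ext i
  simp only [Finset.sum_apply, Pi.smul_apply, smul_eq_mul, evalMap, Pi.zero_apply]
  fin_cases i
  · exact h3 v
  · have := h3 ![v 1, v 2, v 0]
    simp only [(hH _).eval_zero_cyclic] at this
    exact this
  · have := h3 ![v 2, v 0, v 1]
    have e1 (s : Fin 4) :
        MvPolynomial.eval ![v 2, v 0, v 1] (H s 0) = MvPolynomial.eval v (H s 2) :=
      ((hH s).eval_zero_cyclic ![v 1, v 2, v 0]).trans ((hH s).eval_one_cyclic v)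
    simp only [e1] at this
    exact this

/-! ### The invariant of degree 12 and the covariants with linear factors -/

theorem precompPoly_mul (g k : GL (Fin 3) ℂ) (q : Poly) :
    precompPoly (g * k) q = precompPoly k (precompPoly g q) :=
  (lin_mul _ _ q).symm

theorem precompPoly_one (q : Poly) : precompPoly 1 q = q := lin_one q

theorem Φ_isHomogeneous : Φ.IsHomogeneous 12 := by
  rw [Φ_eq]
  exact poly_isHomogeneous (by decide +kernel)

/-- The invariant of degree 12 in the coordinates `x`. -/
noncomputable def ΦX : Poly := precompPoly glA⁻¹ Φ

theorem ΦX_isHomogeneous : ΦX.IsHomogeneous 12 := precompPoly_isHomogeneous Φ_isHomogeneous _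

theorem lin_matG_ΦX (a : Fin 3) : lin (matG a) ΦX = ΦX := by
  have h1 : precompPoly (glA⁻¹ * glG a * glA) F = F := by
    have h2 : precompPoly (glG a) (precompPoly glA⁻¹ F) = precompPoly glA⁻¹ F := lin_matG_FX a
    rw [precompPoly_mul, precompPoly_mul, h2, ← precompPoly_mul, inv_mul_cancel, precompPoly_one]
  have h3 : precompPoly (glA⁻¹ * glG a * glA) Φ = Φ := lin_Φ h1
  have h4 := congrArg (precompPoly glA⁻¹) h3
  rw [← precompPoly_mul, mul_inv_cancel_right, precompPoly_mul] at h4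
  exact h4

theorem evalMap_mul_X (q : Poly) (v : Fin 3 → ℂ) :
    evalMap (fun i => q * MvPolynomial.X i) v = MvPolynomial.eval v q • v := by
  ext i
  simp [evalMap]

/-- The product of an invariant with the identity is a covariant. -/
theorem isCovariant_mul_X {q : Poly} (hq : ∀ a, lin (matG a) q = q) :
    IsCovariant fun i => q * MvPolynomial.X i := by
  intro a v
  rw [evalMap_mul_X, evalMap_mul_X, eval_matG_mulVec hq, Matrix.mulVec_smul]

/-! ### Two points on the conics -/

/-- The number `β` and its complex conjugate. -/
def eb : Fin 2 → E := ![eβ, conjE eβ]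

/-- A point of the conic `4 y₁ y₂ + b² y₃² = 0`, for `b = β` and for its conjugate. -/
def eY (k : Fin 2) : Fin 3 → E := ![eb k, -eb k, 2]

/-- The value of a form with integer coefficients at this point. -/
def evY (k : Fin 2) (l : SP ℤ) : E := ev (Int.castRingHom E) (eY k) l

/-- The point of the conic, with complex coordinates. -/
noncomputable def ptY (k : Fin 2) : Fin 3 → ℂ := fun i => toC (eY k i)

theorem eval_ptY (k : Fin 2) (l : SP ℤ) :
    MvPolynomial.eval (ptY k) (poly l) = toC (evY k l) := by
  rw [eval_toPoly, evY, map_ev]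
  congr 1
  exact Subsingleton.elim _ _

theorem evY_facts (k : Fin 2) :
    4 * evY k (lH 0) * evY k (lH 1) + eb k ^ 2 * evY k (lH 2) ^ 2 = 0 ∧
    4 * (evY k (lH 0) * eY k 1 + evY k (lH 1) * eY k 0) + 2 * eb k ^ 2 * evY k (lH 2) * eY k 2 ≠ 0 ∧
    evY k lF ≠ 0 := by
  revert k
  decide +kernel

theorem evY_det : evY 0 lF ^ 2 * evY 1 lΦ - evY 1 lF ^ 2 * evY 0 lΦ ≠ 0 := by
  decide +kernel

theorem eval_F_ptY_ne_zero (k : Fin 2) : MvPolynomial.eval (ptY k) F ≠ 0 := by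
  rw [F_eq, eval_ptY]
  exact toC_ne_zero (evY_facts k).2.2

/-- A combination of `F²` and `Φ` with zeros at both points is trivial. -/
theorem eq_zero_of_ptY {b c : ℂ} (h : ∀ k, b * MvPolynomial.eval (ptY k) F ^ 2 +
    c * MvPolynomial.eval (ptY k) Φ = 0) : b = 0 ∧ c = 0 := by
  have hd : MvPolynomial.eval (ptY 0) F ^ 2 * MvPolynomial.eval (ptY 1) Φ -
      MvPolynomial.eval (ptY 1) F ^ 2 * MvPolynomial.eval (ptY 0) Φ ≠ 0 := by
    have := toC_ne_zero evY_det
    rwa [map_sub, map_mul, map_mul, map_pow, map_pow, ← eval_ptY, ← eval_ptY, ← eval_ptY,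
      ← eval_ptY, ← F_eq, ← Φ_eq] at this
  have h0 := h 0
  have h1 := h 1
  constructor
  · apply mul_right_cancel₀ hd
    linear_combination MvPolynomial.eval (ptY 1) Φ * h0 - MvPolynomial.eval (ptY 0) Φ * h1
  · apply mul_right_cancel₀ hd
    linear_combination MvPolynomial.eval (ptY 0) F ^ 2 * h1 - MvPolynomial.eval (ptY 1) F ^ 2 * h0

/-- The quadratic form of one of the two conics. -/
noncomputable def conicK (k : Fin 2) (v : Fin 3 → ℂ) : ℂ :=
  4 * v 0 * v 1 + toC (eb k) ^ 2 * v 2 ^ 2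

theorem conicK_ptY (k : Fin 2) : conicK k (ptY k) = 0 := by
  simp [conicK, ptY, eY]
  ring

/-- A combination of a point of the conic with its image is on the conic only if it is trivial. -/
theorem mul_eq_zero_of_conicK {k : Fin 2} {a b : ℂ}
    (h : conicK k (a • evalMap hExplicit (ptY k) + b • ptY k) = 0) : a * b = 0 := by
  obtain ⟨h1, h2, -⟩ := evY_facts k
  have hH (i : Fin 3) : evalMap hExplicit (ptY k) i = toC (evY k (lH i)) := by
    rw [evalMap, hExplicit_eq, eval_ptY]
  have hY (i : Fin 3) : ptY k i = toC (eY k i) := rfl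
  have e1 := congrArg toC h1
  have e2 := toC_ne_zero h2
  have e3 := conicK_ptY k
  simp only [conicK, Pi.add_apply, Pi.smul_apply, smul_eq_mul, hH, hY] at h e3
  simp only [map_add, map_mul, map_pow, map_zero, toC_two, toC_four] at e1 e2
  apply mul_right_cancel₀ e2
  linear_combination h - a ^ 2 * e1 - b ^ 2 * e3

theorem qf_fam_matA (k : Fin 2) :
    ∃ c : ℂ, c ≠ 0 ∧ ∀ v, qf (fam k 0) (matA *ᵥ v) = c * conicK k v := by
  have hz : toC (eb 0) = β := rfl
  have ho : toC (eb 1) = conj β := by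
    rw [← hz, conj_toC]
    rfl
  fin_cases k
  · refine ⟨4 * (τ + 2), by simp [tau_add_two_ne_zero], fun v => ?_⟩
    rw [Fin.zero_eta, qf_fam_zero_zero_matA]
    simp only [conicQ, conicK, hz]
  · obtain ⟨b, hb, h2⟩ := matB_fam 0 0
    rw [sub_zero] at h2
    refine ⟨b * (τ + 2), by simp [hb, tau_add_two_ne_zero], fun v => ?_⟩
    have h1 := qf_fam_zero_zero_matA fun i => conj (v i)
    have e2 : matB *ᵥ (fun i => conj ((matA *ᵥ fun i => conj (v i)) i)) =
        (2 : ℂ) • (matA *ᵥ v) := by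
      rw [map_conj_mulVec, Matrix.mulVec_mulVec, matB_mul_conj_matA, Matrix.smul_mulVec]
      simp
    have h3 : qf (fam 1 0) ((2 : ℂ) • (matA *ᵥ v)) =
        b * conj (qf (fam 0 0) (matA *ᵥ fun i => conj (v i))) := by
      rw [← e2, qf_mulVec, h2, qf_matrix_smul, qf_conj]
    rw [h1, qf_smul] at h3
    simp only [conicQ, map_mul, map_add, map_pow, Complex.conj_conj, Complex.conj_ofNat,
      conj_tau] at h3
    simp only [Fin.mk_one, conicK, ho]
    linear_combination h3 / 4

/-! ### Uniqueness -/

theorem eval_FX_matA (y : Fin 3 → ℂ) :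
    MvPolynomial.eval (matA *ᵥ y) FX = MvPolynomial.eval y F := by
  rw [FX, eval_precompPoly, ← coe_glA, inv_mulVec_mulVec]

theorem eval_ΦX_matA (y : Fin 3 → ℂ) :
    MvPolynomial.eval (matA *ᵥ y) ΦX = MvPolynomial.eval y Φ := by
  rw [ΦX, eval_precompPoly, ← coe_glA, inv_mulVec_mulVec]

theorem not_isUnit_FX : ¬ IsUnit FX := by
  intro h
  have h1 := h.map (MvPolynomial.eval (0 : Fin 3 → ℂ))
  have h2 := eval_smul_of_isHomogeneous FX_isHomogeneous 0 0
  rw [zero_smul, zero_pow (by norm_num), zero_mul] at h2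
  rw [h2] at h1
  exact not_isUnit_zero h1

theorem IsRationalMap.ne_zero {d : ℕ} {h : Fin 3 → Poly} (hh : IsRationalMap d h) : h ≠ 0 := by
  rintro rfl
  exact not_isUnit_FX (hh.2 FX fun i => dvd_zero _)

/-- An equivariant map of degree 19 that preserves the conics is the map `hX`. -/
theorem eq_smul_hX {h : Fin 3 → Poly} (hh : IsRationalMap 19 h) (heq : IsEquivariant V h)
    (hS : ∀ S ∈ icosahedralConics V, ratImage h S ⊆ S) : ∃ c : ℂ, c ≠ 0 ∧ h = c • hX := by
  have hp1 (a : Fin 3) : lin (matG a) (FX ^ 3) = FX ^ 3 := by rw [map_pow, lin_matG_FX]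
  have hp2 (a : Fin 3) : lin (matG a) (FX * ΦX) = FX * ΦX := by
    rw [map_mul, lin_matG_FX, lin_matG_ΦX]
  -- The space of covariants of degree 19 is spanned by three explicit ones.
  obtain ⟨w, hw, hrel⟩ := exists_linear_relation
    (H := ![h, hX, fun i => FX ^ 3 * MvPolynomial.X i, fun i => FX * ΦX * MvPolynomial.X i])
    (fun s => by
      fin_cases s
      · exact heq.isCovariant hh.ne_zero
      · exact isEquivariant_hX.isCovariant isRationalMap_hX.ne_zero
      · exact isCovariant_mul_X hp1
      · exact isCovariant_mul_X hp2)
    (fun s i => by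
      fin_cases s
      · exact hh.1 i
      · exact isRationalMap_hX.1 i
      · exact (FX_isHomogeneous.pow 3).mul (MvPolynomial.isHomogeneous_X ℂ i)
      · exact (FX_isHomogeneous.mul ΦX_isHomogeneous).mul (MvPolynomial.isHomogeneous_X ℂ i))
  simp only [Fin.sum_univ_four, Matrix.cons_val_zero, Matrix.cons_val_one, Matrix.cons_val,
    evalMap_mul_X, map_pow, map_mul, smul_smul] at hrel
  have hrelA (y : Fin 3 → ℂ) : w 0 • evalMap h (matA *ᵥ y) + matA *ᵥ (w 1 • evalMap hExplicit y +
      (MvPolynomial.eval y F * (w 2 * MvPolynomial.eval y F ^ 2 +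
        w 3 * MvPolynomial.eval y Φ)) • y) = 0 := by
    rw [← hrel (matA *ᵥ y), evalMap_hX, eval_FX_matA, eval_ΦX_matA, Matrix.mulVec_add,
      Matrix.mulVec_smul, Matrix.mulVec_smul, add_assoc, add_assoc, ← add_smul]
    ring_nf
  -- At the two points, the image by the second part of the relation is on the conic.
  have hmul (k : Fin 2) : w 1 * (w 2 * MvPolynomial.eval (ptY k) F ^ 2 +
      w 3 * MvPolynomial.eval (ptY k) Φ) = 0 := by
    obtain ⟨c, hc, hq⟩ := qf_fam_matA k
    have h1 := hrelA (ptY k)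
    have hy : matA *ᵥ ptY k ≠ 0 := by
      rw [Ne, ← coe_glA, mulVec_eq_zero_iff]
      intro h0
      have := congrFun h0 2
      simp [ptY, eY] at this
    have hz {v : Fin 3 → ℂ} (hv : v ≠ 0) :
        Projectivization.mk ℂ v hv ∈ zeroLocus (quad (fam k 0)) ↔ qf (fam k 0) v = 0 := by
      rw [mem_zeroLocus_mk (quad_isHomogeneous _), eval_quad, qf]
    have h2 : qf (fam k 0) (evalMap h (matA *ᵥ ptY k)) = 0 := by
      by_cases h0 : evalMap h (matA *ᵥ ptY k) = 0
      · rw [h0]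
        simp [qf]
      · rw [← hz h0]
        apply hS (zeroLocus (quad (fam k 0)))
        · rw [icosahedralConics_V]
          exact ⟨(k, 0), rfl⟩
        · refine ⟨_, hy, h0, ?_, rfl⟩
          rw [hz hy, hq, conicK_ptY, mul_zero]
    have h3 := congrArg (qf (fam k 0)) (eq_neg_of_add_eq_zero_right h1)
    rw [hq, ← neg_smul, qf_smul, h2, mul_zero] at h3
    have h4 := mul_eq_zero_of_conicK ((mul_eq_zero.1 h3).resolve_left hc)
    rcases mul_eq_zero.1 h4 with h5 | h5
    · rw [h5, zero_mul]
    · rw [(mul_eq_zero.1 h5).resolve_left (eval_F_ptY_ne_zero k), mul_zero]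
  have hw1 : w 1 ≠ 0 := by
    intro h1
    by_cases h0 : w 0 = 0
    · have h23 := eq_zero_of_ptY (b := w 2) (c := w 3) fun k => by
        have h2 := congrFun (mulVec_eq_zero_iff glA |>.1 (by
          have := hrelA (ptY k)
          rwa [h0, h1, zero_smul, zero_smul, zero_add, zero_add] at this)) 2
        rw [Pi.smul_apply, smul_eq_mul, show ptY k 2 = 2 from toC_two] at h2
        exact (mul_eq_zero.1 ((mul_eq_zero.1 h2).resolve_right two_ne_zero)).resolve_left
          (eval_F_ptY_ne_zero k)
      apply hw
      ext s
      fin_cases s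
      · exact h0
      · exact h1
      · exact h23.1
      · exact h23.2
    · apply not_isUnit_FX
      apply hh.2
      intro i
      refine ⟨MvPolynomial.C (-(w 0)⁻¹) *
        (MvPolynomial.C (w 2) * FX ^ 2 + MvPolynomial.C (w 3) * ΦX) * MvPolynomial.X i,
        MvPolynomial.funext fun v => ?_⟩
      have h2 := congrFun (hrel v) i
      simp only [h1, zero_smul, add_zero, Pi.add_apply, Pi.smul_apply, smul_eq_mul, evalMap,
        Pi.zero_apply] at h2
      simp only [map_mul, map_add, map_pow, MvPolynomial.eval_C, MvPolynomial.eval_X]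
      field_simp
      linear_combination h2
  obtain ⟨h2, h3⟩ := eq_zero_of_ptY fun k => (mul_eq_zero.1 (hmul k)).resolve_left hw1
  have hrel' (v : Fin 3 → ℂ) : w 0 • evalMap h v + w 1 • evalMap hX v = 0 := by
    have := hrel v
    rwa [h2, h3, zero_mul, zero_mul, zero_smul, add_zero, add_zero] at this
  have hw0 : w 0 ≠ 0 := by
    intro h0
    apply isRationalMap_hX.ne_zero
    apply evalMap_injective
    intro v
    have h4 := hrel' v
    rw [h0, zero_smul, zero_add] at h4
    rw [(smul_eq_zero.1 h4).resolve_left hw1]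
    ext i
    simp [evalMap]
  refine ⟨-(w 1 / w 0), neg_ne_zero.2 (div_ne_zero hw1 hw0), evalMap_injective fun v => ?_⟩
  ext i
  have h4 := congrFun (hrel' v) i
  simp only [Pi.add_apply, Pi.smul_apply, smul_eq_mul, evalMap, Pi.zero_apply] at h4
  simp only [evalMap, Pi.smul_apply, MvPolynomial.smul_eval]
  field_simp
  linear_combination h4

/-! ### The map in bub-coordinates -/

theorem F_ne_zero : F ≠ 0 := by
  intro h
  apply eval_F_ptY_ne_zero 0
  rw [h, map_zero]

theorem precompPoly_ne_zero {q : Poly} (hq : q ≠ 0) (g : GL (Fin 3) ℂ) : precompPoly g q ≠ 0 := by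
  intro h
  apply hq
  rw [← precompPoly_one q, ← mul_inv_cancel g, precompPoly_mul, h]
  exact map_zero _

theorem precompPoly_C_mul (g : GL (Fin 3) ℂ) (c : ℂ) (q : Poly) :
    precompPoly g (MvPolynomial.C c * q) = MvPolynomial.C c * precompPoly g q := by
  rw [precompPoly_eq_lin, map_mul, lin_C, precompPoly_eq_lin]

/-- Two systems of bub-coordinates differ by a linear map that preserves the sextic. -/
theorem IsBub.precompPoly_F {A : GL (Fin 3) ℂ} (hA : IsBub A) :
    ∃ c : ℂ, c ≠ 0 ∧ precompPoly (glA⁻¹ * A) F = MvPolynomial.C c * F := by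
  have h1 (a : Fin 3) : ∃ c : ℂ,
      lin (matG a) (precompPoly A⁻¹ F) = MvPolynomial.C c * precompPoly A⁻¹ F := by
    obtain ⟨c, hc⟩ := hA.sextic (A⁻¹ * glG a * A) (by
      have e1 : A * (A⁻¹ * glG a * A) * A⁻¹ = glG a := by group
      rw [MemVIn, e1]
      exact mk_glG_mem a)
    refine ⟨c, ?_⟩
    have h2 := congrArg (precompPoly A⁻¹) hc
    rw [← precompPoly_mul, mul_inv_cancel_right, precompPoly_mul] at h2
    rw [precompPoly_C_mul] at h2
    exact h2
  obtain ⟨c, hc⟩ := exists_eq_C_mul_of_invariant (precompPoly_isHomogeneous F_isHomogeneous A⁻¹)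
    FX_isHomogeneous (lin_matG_eq_self (precompPoly_ne_zero F_ne_zero A⁻¹) h1) lin_matG_FX
    (precompPoly_ne_zero F_ne_zero _)
  have h2 : F = MvPolynomial.C c * precompPoly (glA⁻¹ * A) F := by
    have h3 := congrArg (precompPoly A) hc
    rwa [← precompPoly_mul, inv_mul_cancel, precompPoly_one, precompPoly_C_mul, FX,
      ← precompPoly_mul] at h3
  have hc0 : c ≠ 0 := by
    rintro rfl
    rw [map_zero, zero_mul] at h2
    exact F_ne_zero h2
  refine ⟨c⁻¹, inv_ne_zero hc0, ?_⟩
  conv_rhs => rw [h2]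
  rw [← mul_assoc, ← map_mul, inv_mul_cancel₀ hc0, map_one, one_mul]

theorem IsBub.inCoords_hX {A : GL (Fin 3) ℂ} (hA : IsBub A) :
    ∃ c : ℂ, c ≠ 0 ∧ inCoords A hX = c • hExplicit := by
  obtain ⟨c, hc, h⟩ := hA.precompPoly_F
  obtain ⟨d, hd, h1⟩ := evalMap_hExplicit_mulVec hc h
  refine ⟨d, hd, evalMap_injective fun v => ?_⟩
  have h2 (w : Fin 3 → ℂ) : matA *ᵥ
      (((glA⁻¹ * A : GL (Fin 3) ℂ) : Matrix (Fin 3) (Fin 3) ℂ) *ᵥ w) =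
        (A : Matrix (Fin 3) (Fin 3) ℂ) *ᵥ w := by
    rw [← coe_glA, Matrix.mulVec_mulVec, ← Units.val_mul, mul_inv_cancel_left]
  rw [inCoords, evalMap_postcomp, evalMap_precomp, ← h2, evalMap_hX, h1, Matrix.mulVec_smul, h2,
    Matrix.mulVec_smul, inv_mulVec_mulVec]
  ext i
  simp [evalMap]

theorem g19_lf19 : g19 (fun i => SP.poly (lf19 i)) 1620 0 = (810 : ℂ) • hExplicit := by
  ext1 i
  rw [g19, lf19_eq, Pi.smul_apply, MvPolynomial.smul_eq_C_mul, map_zero]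
  ring

end Valentiner

theorem mainTheorem1 :
    Nonempty (Valentiner.V ≃* alternatingGroup (Fin 6)) ∧
    (Valentiner.icosahedralConics Valentiner.V).ncard = 12 ∧
    (∃ A : GL (Fin 3) ℂ, Valentiner.IsBub A) ∧
    Valentiner.X45 ≠ 0 ∧
    ∃ f19 : Fin 3 → Valentiner.Poly,
      (∀ i, Valentiner.X45 * f19 i = Valentiner.f64 i) ∧
      Valentiner.g19 f19 1620 0 = (810 : ℂ) • Valentiner.hExplicit ∧
      ∃ h : Fin 3 → Valentiner.Poly,
        (Valentiner.IsRationalMap 19 h ∧ Valentiner.IsEquivariant Valentiner.V h ∧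
          ∀ S ∈ Valentiner.icosahedralConics Valentiner.V,
            (∀ p ∈ S, Valentiner.IsDefinedAt h p) ∧ Valentiner.ratImage h S = S) ∧
        (∀ h' : Fin 3 → Valentiner.Poly,
          Valentiner.IsRationalMap 19 h' → Valentiner.IsEquivariant Valentiner.V h' →
          (∀ S ∈ Valentiner.icosahedralConics Valentiner.V, Valentiner.ratImage h' S ⊆ S) →
          ∃ c : ℂ, c ≠ 0 ∧ h' = c • h) ∧
        ∀ A : GL (Fin 3) ℂ, Valentiner.IsBub A →
          ∃ c : ℂ, c ≠ 0 ∧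
            Valentiner.inCoords A h = c • Valentiner.g19 f19 1620 0 := by
  refine ⟨⟨Valentiner.altEquiv 0⟩, Valentiner.ncard_icosahedralConics,
    ⟨Valentiner.glA, Valentiner.isBub_glA⟩, Valentiner.X45_ne_zero, _,
    Valentiner.X45_mul_lf19, Valentiner.g19_lf19, Valentiner.hX,
    ⟨Valentiner.isRationalMap_hX, Valentiner.isEquivariant_hX, ?_⟩,
    fun h' h1 h2 h3 => Valentiner.eq_smul_hX h1 h2 h3, fun A hA => ?_⟩
  · rw [Valentiner.icosahedralConics_V]
    rintro _ ⟨x, rfl⟩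
    exact Valentiner.preserves_conic x.1 x.2
  · obtain ⟨c, hc, h⟩ := hA.inCoords_hX
    refine ⟨c / 810, div_ne_zero hc (by norm_num), ?_⟩
    rw [Valentiner.g19_lf19, h, smul_smul, div_mul_cancel₀ c (by norm_num)]
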